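/- **Setting.** Let $\mathcal P$ be a polygonal domain with $n$ vertices in total: a closed outer simple polygon containing pairwise disjoint holes, each a simple polygon, with the open interiors of the holes removed. No two vertices have the same $x$- or the same $y$-coordinate. A path in $\mathcal P$ is polygonal, and lengths are $L_1$ lengths. Points $p,q$ are *visible* to each other if $\overline{pq}\subseteq\mathcal P$; $p$ is *horizontally visible* to the line $x=c$ if $p$ and $(c,y(p))$ are visible to each other, and then $(c,y(p))$ is its horizontal projection on that line. The four *projections* of $p\in\mathcal P$ on $\partial\mathcal P$ are the points $p^l,p^r,p^u,p^d$ at which the leftward, rightward, upward and downward rays from $p$ are stopped by the boundary (the far end of the longest segment in $\mathcal P$ starting at $p$ in that direction). Let $\mathcal V$ be the set of vertices of $\mathcal P$ and $\mathcal V_1$ the set of all vertices and their projections on $\partial\mathcal P$. **Cut-line tree $\mathcal T$.** Each node $u$ has a set $\mathcal V(u)\subseteq\mathcal V$ and a vertical cut-line $l(u)$; the root has $\mathcal V(u)=\mathcal V$. If $|\mathcal V(u)|=1$, then $u$ is a leaf and $l(u)$ passes through that vertex. Otherwise $l(u)$ avoids $\mathcal V(u)$ and splits it into a left and a right part whose sizes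 differ by at most one; these are the sets of the left and the right child. Group the levels of $\mathcal T$ from the root on into super-levels of $\max(1,\lfloor\log_2\log_2 n\rfloor)$ consecutive levels (the last may have fewer). For a node $u$ on the highest level of a super-level let $\mathcal T_u$ be the part of the subtree of $u$ in that super-level. Each $p\in\mathcal V(u)$ defines a *type-3 Steiner point*, its horizontal projection, on $l(v)$ for every node $v$ of $\mathcal T_u$ such that $p$ is horizontally visible to $l(v)$. Let $\mathcal V_3$ be the set of all type-3 Steiner points. **Graph $G_1$.** The vertex set is $\mathcal V_1\cup\mathcal V_3$. Every vertex $p$ of $\mathcal P$ is joined to its projections on $\partial\mathcal P$ and to the type-3 Steiner points defined by it; adjacent points of $\mathcal V_1\cup\mathcal V_3$ on a common polygon edge are joined; adjacent points of $\mathcal V_3$ on a common cut-line are joined if they are visible to each other. All edges are straight segments. **Graph $G_2$.** It is obtained from $G_1$ in three steps. 1. For each $p\in\mathcal V_1\cup\mathcal V_3$ and each projection $q\notin\mathcal V_1$ of $p$ on $\partial\mathcal P$, add $q$ as a vertex and join it to $p$ and to the two adjacent Steiner points on the polygon edge containing $q$. 2. For every point of $\mathcal V_1$ that is not on a cut-line,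 insert the vertical line through it by its $x$-coordinate as a new leaf of $\mathcal T$ (points with equal $x$-coordinate share the line), giving a binary search tree $\mathcal T'$; the insertions are made in an order for which $\mathcal T'$ has height $O(\log n)$. For each $p\in\mathcal V_1\setminus\mathcal V$, let $u$ be the node of $\mathcal T'$ whose cut-line contains $p$; for each node $v$ on the path from $u$ to the root such that $p$ is horizontally visible to $l(v)$, add the horizontal projection $p'$ of $p$ on $l(v)$ as a Steiner point on $l(v)$ defined by $p$, join it to $p$, and join it to its adjacent visible Steiner points on $l(v)$. 3. For each $p\in\mathcal V_1$ let $S(p)$ consist of $p$, $p^l$, $p^r$ and all Steiner points on cut-lines defined by $p$. Remove the edges joining $p$ to the other points of $S(p)$, and join each pair of adjacent points of $S(p)$ from left to right. **Lemma.** (a) Insertions in step 2 for which $\mathcal T'$ has height $O(\log n)$ exist: there is an absolute constant $K$ such that every such $\mathcal P$ has a cut-line tree, and for every cut-line tree $\mathcal T$ of $\mathcal P$ the insertions can be made so that $\mathcal T'$ has height at most $K\log n$. (b) $G_2$ has $O(n\log^2 n/\log\log n)$ vertices and edges: for every $K$ there is a constant $C$ such that for all $\mathcal P$, $\mathcal T$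 and $\mathcal T'$ with $\mathcal T'$ of height at most $K\log n$, the graph $G_2$ has at most $C\,n\log^2 n/\log\log n$ vertices and at most as many edges. (c) For all $\mathcal P$, $\mathcal T$ and $\mathcal T'$ (whatever the height of $\mathcal T'$) and any two points $p,q\in\mathcal V_1\cup\mathcal V_3$ (that is, any two vertices of $G_1$), there is a shortest path from $p$ to $q$ in $G_2$, where each edge has its $L_1$ length as weight, and every shortest path from $p$ to $q$ in $G_2$ is also an $L_1$ shortest path from $p$ to $q$ in $\mathcal P$. -/

import Mathlib

namespace L1Domain

/-- Points of the plane, `p.1 = x(p)` and `p.2 = y(p)`. Lengths are always measured by `l1Dist`. -/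
abbrev Pt : Type := ℝ × ℝ

/-- The `L₁` distance of two points. -/
noncomputable def l1Dist (p q : Pt) : ℝ := |p.1 - q.1| + |p.2 - q.2|

/-! ### Polygonal domains -/

/-- A simple polygon: at least three pairwise distinct vertices, consecutive edges share exactly
their common vertex, and all other pairs of distinct edges are disjoint. -/
structure IsSimplePolygon {m : ℕ} (Q : Polygon Pt m) : Prop where
  three_le : 3 ≤ m
  injective : Function.Injective Q.vertices
  adjacent : ∀ i : Fin m,
    Q.edgeSet ℝ i ∩ Q.edgeSet ℝ (finRotate m i) = {Q.vertices (finRotate m i)}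
  nonadjacent : ∀ i j : Fin m, i ≠ j → j ≠ finRotate m i → i ≠ finRotate m j →
    Disjoint (Q.edgeSet ℝ i) (Q.edgeSet ℝ j)

/-- The open region enclosed by a polygon: the points off the boundary curve whose connected
component in the complement of the curve is bounded. -/
def inside {m : ℕ} (Q : Polygon Pt m) : Set Pt :=
  {z | z ∉ Q.boundary ℝ ∧ Bornology.IsBounded (connectedComponentIn (Q.boundary ℝ)ᶜ z)}

/-- The closed region of a polygon. -/
def closedInside {m : ℕ} (Q : Polygon Pt m) : Set Pt := Q.boundary ℝ ∪ inside Q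

/-- A polygonal domain: an outer simple polygon containing `h` disjoint holes, each of which is a
simple polygon. -/
structure PolygonalDomain where
  outerSize : ℕ
  outer : Polygon Pt outerSize
  outer_simple : IsSimplePolygon outer
  h : ℕ
  holeSize : Fin h → ℕ
  hole : ∀ j, Polygon Pt (holeSize j)
  hole_simple : ∀ j, IsSimplePolygon (hole j)
  hole_inside : ∀ j, closedInside (hole j) ⊆ inside outer
  hole_disjoint : ∀ i j, i ≠ j → Disjoint (closedInside (hole i)) (closedInside (hole j))

namespace PolygonalDomain

/-- The domain as a (closed) set of points of the plane. -/
def region (D : PolygonalDomain) : Set Pt := closedInside D.outer \ ⋃ j, inside (D.hole j)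

/-- The number `n` of polygon vertices. -/
def n (D : PolygonalDomain) : ℕ := D.outerSize + ∑ j, D.holeSize j

/-- The polygon vertices. -/
def vertices (D : PolygonalDomain) : Set Pt :=
  Set.range D.outer.vertices ∪ ⋃ j, Set.range (D.hole j).vertices

/-- The polygon edges. -/
def edges (D : PolygonalDomain) : Set (Set Pt) :=
  {e | (∃ i, e = D.outer.edgeSet ℝ i) ∨ ∃ j i, e = (D.hole j).edgeSet ℝ i}

/-- No two polygon vertices have the same `x`- or the same `y`-coordinate. -/
def GeneralPosition (D : PolygonalDomain) : Prop :=
  ∀ a ∈ D.vertices, ∀ b ∈ D.vertices, a ≠ b → a.1 ≠ b.1 ∧ a.2 ≠ b.2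

/-- Two points are visible to each other if their segment lies in the domain. -/
def Visible (D : PolygonalDomain) (p q : Pt) : Prop := segment ℝ p q ⊆ D.region

/-- `p` is horizontally visible to the vertical line `x = c`; the horizontal projection of `p` on
that line is then `(c, p.2)`. -/
def HorizVisible (D : PolygonalDomain) (p : Pt) (c : ℝ) : Prop := D.Visible p (c, p.2)

/-- `q` is the projection of `p` on the boundary in the direction `d`: the point at which the ray
from `p` in direction `d` is stopped by the boundary, i.e. the far end of the longest segment of
the domain that starts at `p` and has direction `d`. (It is `p` itself if the ray leaves the domain
immediately.) -/
def IsProjDir (D : PolygonalDomain) (d p q : Pt) : Prop :=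
  ∃ t : ℝ, 0 ≤ t ∧ q = p + t • d ∧ D.Visible p q ∧ ∀ s : ℝ, t < s → ¬ D.Visible p (p + s • d)

/-- `q` is the leftward or the rightward projection of `p`. -/
def IsHorizProj (D : PolygonalDomain) (p q : Pt) : Prop :=
  D.IsProjDir (1, 0) p q ∨ D.IsProjDir (-1, 0) p q

/-- `q` is the upward or the downward projection of `p`. -/
def IsVertProj (D : PolygonalDomain) (p q : Pt) : Prop :=
  D.IsProjDir (0, 1) p q ∨ D.IsProjDir (0, -1) p q

/-- `q` is one of the four projections of `p` on the boundary. -/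
def IsProj (D : PolygonalDomain) (p q : Pt) : Prop := D.IsHorizProj p q ∨ D.IsVertProj p q

/-- The set `V₁`: all polygon vertices and their projections on the boundary. -/
def V1 (D : PolygonalDomain) : Set Pt := D.vertices ∪ {q | ∃ p ∈ D.vertices, D.IsProj p q}

end PolygonalDomain

/-! ### Paths and their lengths -/

/-- The `L₁` length of the polygonal path through the points of a list. -/
noncomputable def l1Length : List Pt → ℝ
  | [] => 0
  | [_] => 0
  | a :: b :: l => l1Dist a b + l1Length (b :: l)

/-- The list `l` is the sequence of vertices of a polygonal path from `p` to `q` in the domain. -/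
def IsPathIn (D : PolygonalDomain) (p q : Pt) (l : List Pt) : Prop :=
  l.head? = some p ∧ l.getLast? = some q ∧ (∀ a ∈ l, a ∈ D.region) ∧
    l.IsChain (fun a b => D.Visible a b)

/-- An `L₁` shortest path from `p` to `q` in the domain. -/
def IsShortestPathIn (D : PolygonalDomain) (p q : Pt) (l : List Pt) : Prop :=
  IsPathIn D p q l ∧ ∀ l', IsPathIn D p q l' → l1Length l ≤ l1Length l'

/-- A shortest path from `p` to `q` in a graph on points of the plane, where each edge is weighted
by the `L₁` distance of its end points. -/
def IsShortestWalk {G : SimpleGraph Pt} {p q : Pt} (w : G.Walk p q) : Prop :=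
  ∀ w' : G.Walk p q, l1Length w.support ≤ l1Length w'.support

/-! ### Cut-line trees

A cut-line tree is a binary tree whose nodes carry the `x`-coordinates of the (vertical) cut-lines.
A node is addressed by the list of turns on the way to it from the root (`false` is left and `true`
is right); the length of the address is the level of the node, the root being on level `0`. -/

/-- The cut-line stored at an address (`none` if there is no node at this address). -/
def cutAt : BinaryTree ℝ → List Bool → Option ℝ
  | .nil, _ => none
  | .node c _ _, [] => some c
  | .node _ l _, false :: a => cutAt l a
  | .node _ _ r, true :: a => cutAt r a

/-- The set of all cut-lines of a tree. -/
def cuts (T : BinaryTree ℝ) : Set ℝ := {c | ∃ a, cutAt T a = some c}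

/-- `T` is a cut-line tree for the point set `W`. A single point gets a leaf whose cut-line passes
through it. A larger set is cut by a vertical line that avoids it and splits it at the median
`x`-coordinate (into two halves, whose sizes differ by one if the size of the set is odd), and the
two parts are treated recursively. -/
inductive IsCutTree : BinaryTree ℝ → Finset Pt → Prop
  | leaf (p : Pt) : IsCutTree (.node p.1 .nil .nil) {p}
  | node (c : ℝ) (l r : BinaryTree ℝ) (A B : Finset Pt)
      (hA : ∀ a ∈ A, a.1 < c) (hB : ∀ b ∈ B, c < b.1)
      (hAB : A.card ≤ B.card + 1) (hBA : B.card ≤ A.card + 1)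
      (hl : IsCutTree l A) (hr : IsCutTree r B) : IsCutTree (.node c l r) (A ∪ B)

/-- `T` is a cut-line tree of the domain, i.e. a cut-line tree for its set of vertices. -/
def IsCutLineTree (D : PolygonalDomain) (T : BinaryTree ℝ) : Prop :=
  ∃ W : Finset Pt, (W : Set Pt) = D.vertices ∧ IsCutTree T W

/-- The descent in the tree by the `x`-coordinate `x` (left of the cut-line: to the left child,
right of it: to the right child) passes through the address `a`. -/
def Routes (x : ℝ) : BinaryTree ℝ → List Bool → Prop
  | _, [] => True
  | .nil, _ :: _ => False
  | .node c l _, false :: a => x < c ∧ Routes x l a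
  | .node c _ r, true :: a => c < x ∧ Routes x r a

/-- The set `V(u)` of the polygon vertices that belong to the node with address `u`. -/
def nodeVertices (D : PolygonalDomain) (T : BinaryTree ℝ) (u : List Bool) : Set Pt :=
  {p | p ∈ D.vertices ∧ Routes p.1 T u}

/-- The number of levels in a super-level: `log log n` rounded down, but at least one. -/
def superSize (D : PolygonalDomain) : ℕ := max 1 (Nat.log 2 (Nat.log 2 D.n))

/-- The address of the highest node `u` of the super-level of the node with address `v` such that
`v` is in the subtree `T_u`. -/
def superTop (D : PolygonalDomain) (v : List Bool) : List Bool :=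
  v.take (superSize D * (v.length / superSize D))

/-- The type-3 Steiner points defined by the polygon vertex `p`: its horizontal projections on the
cut-lines of those nodes `v` to which it is horizontally visible and for which `p` is in `V(u)`,
where `u` is the top node of the super-level subtree `T_u` containing `v`. -/
def type3 (D : PolygonalDomain) (T : BinaryTree ℝ) (p : Pt) : Set Pt :=
  {s | ∃ v c, cutAt T v = some c ∧ p ∈ nodeVertices D T (superTop D v) ∧
    D.HorizVisible p c ∧ s = (c, p.2)}

/-- The set `V₃` of all type-3 Steiner points. -/
def V3 (D : PolygonalDomain) (T : BinaryTree ℝ) : Set Pt := ⋃ p ∈ D.vertices, type3 D T p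

/-! ### The graph `G₁` -/

/-- `a` and `b` are two adjacent points of `S`: no other point of `S` is on their segment. It is
used for sets `S` of points on a line. -/
def Consecutive (S : Set Pt) (a b : Pt) : Prop :=
  a ∈ S ∧ b ∈ S ∧ a ≠ b ∧ ∀ z ∈ S, z ∈ segment ℝ a b → z = a ∨ z = b

/-- `a` and `b` are adjacent among the points of `S` that lie on a common polygon edge. -/
def EdgeAdj (D : PolygonalDomain) (S : Set Pt) (a b : Pt) : Prop :=
  ∃ e ∈ D.edges, Consecutive (S ∩ e) a b

/-- `a` and `b` are adjacent among the points of `S` on a common cut-line, and visible to each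
other. Here `S` is a set of Steiner points that are defined on cut-lines, and those on the cut-line
`x = c` are the ones with `x`-coordinate `c`. -/
def CutAdj (D : PolygonalDomain) (S : Set Pt) (a b : Pt) : Prop :=
  ∃ c : ℝ, Consecutive {s | s ∈ S ∧ s.1 = c} a b ∧ D.Visible a b

/-- The graph `G₁`; its vertex set is `V₁ ∪ V₃`. A polygon vertex is connected to all Steiner points
defined by it; adjacent Steiner points on a polygon edge are connected; and adjacent Steiner points
on a cut-line are connected if they are visible to each other. -/
def G1 (D : PolygonalDomain) (T : BinaryTree ℝ) : SimpleGraph Pt :=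
  SimpleGraph.fromRel fun a b =>
    (a ∈ D.vertices ∧ (D.IsProj a b ∨ b ∈ type3 D T a)) ∨
    EdgeAdj D (D.V1 ∪ V3 D T) a b ∨
    CutAdj D (V3 D T) a b

/-! ### The graph `G₂` -/

/-- First step, the vertices: the projections on the boundary of all points of `V₁ ∪ V₃`. -/
def newType1 (D : PolygonalDomain) (T : BinaryTree ℝ) : Set Pt :=
  {q | ∃ p ∈ D.V1 ∪ V3 D T, D.IsProj p q}

/-- First step, the edges: a projection `q ∉ V₁` of a point `p` of `V₁ ∪ V₃` is connected to `p`
and to the two adjacent Steiner points on the polygon edge that contains `q`. -/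
def step1 (D : PolygonalDomain) (T : BinaryTree ℝ) : SimpleGraph Pt :=
  SimpleGraph.fromRel fun a b =>
    (a ∈ D.V1 ∪ V3 D T ∧ D.IsProj a b ∧ b ∉ D.V1) ∨
    EdgeAdj D (D.V1 ∪ V3 D T ∪ newType1 D T) a b

/-- `Extends T T'`: the tree `T'` is obtained from `T` by attaching new nodes below `T`. -/
inductive Extends : BinaryTree ℝ → BinaryTree ℝ → Prop
  | nil (t : BinaryTree ℝ) : Extends .nil t
  | node (c : ℝ) (l r l' r' : BinaryTree ℝ) (hl : Extends l l') (hr : Extends r r') :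
      Extends (.node c l r) (.node c l' r')

/-- The tree is ordered as a binary search tree. -/
def IsSearchTree : BinaryTree ℝ → Prop
  | .nil => True
  | .node c l r => (∀ x ∈ cuts l, x < c) ∧ (∀ x ∈ cuts r, c < x) ∧ IsSearchTree l ∧ IsSearchTree r

/-- `T'` results from the cut-line tree `T` when a cut-line through each point of `V₁` that is not
yet on a cut-line is inserted by its `x`-coordinate as a new leaf, one cut-line after the other in
any order. -/
def IsInsertion (D : PolygonalDomain) (T T' : BinaryTree ℝ) : Prop :=
  Extends T T' ∧ IsSearchTree T' ∧ cuts T' = cuts T ∪ Prod.fst '' D.V1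

/-- Second step: the type-2 Steiner points defined by a point `p` of `V₁` that is not a polygon
vertex, namely its horizontal projections on the cut-lines to which it is horizontally visible and
which are stored at the nodes `v` on the path to the root from the node `u` whose cut-line passes
through `p` (`u` included). -/
def newType2 (D : PolygonalDomain) (T' : BinaryTree ℝ) (p : Pt) : Set Pt :=
  {s | p ∈ D.V1 \ D.vertices ∧ ∃ u v c, cutAt T' u = some p.1 ∧ v <+: u ∧ cutAt T' v = some c ∧
    D.HorizVisible p c ∧ s = (c, p.2)}

/-- Second step: all new type-2 Steiner points. -/
def allNewType2 (D : PolygonalDomain) (T' : BinaryTree ℝ) : Set Pt := ⋃ p ∈ D.V1, newType2 D T' p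

/-- Second step, the edges: each defining point is connected to its new type-2 Steiner points, and
these are connected to the adjacent visible Steiner points on the cut-line. -/
def step2 (D : PolygonalDomain) (T T' : BinaryTree ℝ) : SimpleGraph Pt :=
  SimpleGraph.fromRel fun a b =>
    b ∈ newType2 D T' a ∨ CutAdj D (V3 D T ∪ allNewType2 D T') a b

/-- Third step: the set `S(p)` of all Steiner points on cut-lines defined by `p`, together with `p`
itself and its leftward and rightward projections. All of its points lie on one horizontal line. -/
def steinerRow (D : PolygonalDomain) (T T' : BinaryTree ℝ) (p : Pt) : Set Pt :=
  {p} ∪ type3 D T p ∪ newType2 D T' p ∪ {q | D.IsHorizProj p q}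

/-- Third step, the removed edges: from each `p` of `V₁` to the other points of `S(p)`. -/
def rowStars (D : PolygonalDomain) (T T' : BinaryTree ℝ) : SimpleGraph Pt :=
  SimpleGraph.fromRel fun a b => a ∈ D.V1 ∧ b ∈ steinerRow D T T' a

/-- Third step, the added edges: between adjacent points of `S(p)`, for each `p` of `V₁`. -/
def rowChains (D : PolygonalDomain) (T T' : BinaryTree ℝ) : SimpleGraph Pt :=
  SimpleGraph.fromRel fun a b => ∃ p ∈ D.V1, Consecutive (steinerRow D T T' p) a b

/-- The vertex set of `G₂`. -/
def G2Vertices (D : PolygonalDomain) (T T' : BinaryTree ℝ) : Set Pt :=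
  D.V1 ∪ V3 D T ∪ newType1 D T ∪ allNewType2 D T'

/-- The graph `G₂`: the result of applying the three steps to `G₁`. It is a graph on the vertex set
`G2Vertices D T T'` (all other points of the plane are isolated and are not counted). -/
def G2 (D : PolygonalDomain) (T T' : BinaryTree ℝ) : SimpleGraph Pt :=
  ((G1 D T ⊔ step1 D T ⊔ step2 D T T') \ rowStars D T T') ⊔ rowChains D T T'

end L1Domain

/-! ### Topology of polygon interiors -/

namespace L1Domain
open Set Filter Topology

/-! Shortest paths. Every edge of `G2` is a segment inside the domain (`G2_visible`), so a walk is a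
path of the domain and cannot beat the domain distance. It remains to produce, for every polygonal
path between vertices of `G1`, a walk in `G2` that is not longer. Sweeping triangles with a segment
turning about a corner replaces a path by a chain of mutually visible polygon vertices
(`exists_chain_of_isPathIn`), so it suffices to join two visible points `a`, `b` of `V₁ ∪ V₃` by a
walk of length `l1Dist a b` (`walkLE_of_visible`).

For such a pair, consider the right triangle on `ab` with corner at `(a.1, b.2)`. By
`corner_trichotomy` either it is contained in the domain, or a polygon vertex in the bounding box of
`a` and `b` sees both of them, or a polygon edge cuts the corner off and a monotone path runs from
`a` vertically to this edge, along it, and then horizontally to `b`. A vertex between the points is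
handled by induction on the number of vertices in the box. The edge detour is available in `G2`
because step 1 added the projections of all vertices of `G1`. If neither occurs for either of the
two triangles, the whole box is free. Then the cut-line at the lowest common ancestor of the nodes
of `a` and `b` passes between them, both points have their horizontal projections on it as Steiner
points, and the walk goes along a row, the cut-line and another row (`walkLE_of_rect`). That these
projections exist is `exists_row_of_mem`: the points defined by a single owner are closed under
visible projection to ancestor cut-lines.

Some walk exists because the domain is connected by polygonal paths (`reach_of_mem_region`); a
shortest one exists because only finitely many points have edges.

Size and height. A polygon vertex defines at most `2 ^ superSize D` points in each super-level, and
there are O(log n / log log n) super-levels with `2 ^ superSize D` of order log n; a point of `V₁`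
defines at most one type-2 point per level of the logarithmic tree. All remaining edges join
neighbours on lines or join points to their projections, hence are linear in the number of points.
The logarithmic height is obtained by filling the empty subtrees of the cut-line tree with balanced
search trees (`exists_extends`). -/

lemma edgeSet_eq_segment {m : ℕ} (Q : Polygon Pt m) (i : Fin m) :
    Q.edgeSet ℝ i = segment ℝ (Q.vertices i) (Q.vertices (finRotate m i)) :=
  affineSegment_eq_segment ℝ _ _

lemma isClosed_segment (a b : Pt) : IsClosed (segment ℝ a b) := by
  rw [← convexHull_pair]
  exact (Set.Finite.isCompact_convexHull ℝ (by simp)).isClosed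

lemma isClosed_boundary {m : ℕ} (Q : Polygon Pt m) : IsClosed (Q.boundary ℝ) := by
  refine isClosed_iUnion_of_finite fun i => ?_
  rw [edgeSet_eq_segment]
  exact isClosed_segment _ _

lemma inside_disjoint_boundary {m : ℕ} (Q : Polygon Pt m) :
    Disjoint (inside Q) (Q.boundary ℝ) :=
  Set.disjoint_left.2 fun _ h => h.1

/-- A connected set off the boundary curve stays in one component of the complement, and being
enclosed depends on that component only. -/
lemma subset_inside {m : ℕ} {Q : Polygon Pt m} {C : Set Pt} (hC : IsPreconnected C)
    (hd : Disjoint C (Q.boundary ℝ)) {z : Pt} (hz : z ∈ C) (hi : z ∈ inside Q) : C ⊆ inside Q := by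
  intro w hw
  have hsub : C ⊆ (Q.boundary ℝ)ᶜ := Set.disjoint_left.1 hd
  refine ⟨hsub hw, ?_⟩
  have : w ∈ connectedComponentIn (Q.boundary ℝ)ᶜ z :=
    hC.subset_connectedComponentIn hz hsub hw
  rw [← connectedComponentIn_eq this]
  exact hi.2

lemma isOpen_inside {m : ℕ} (Q : Polygon Pt m) : IsOpen (inside Q) := by
  rw [Metric.isOpen_iff]
  intro z hz
  obtain ⟨r, hr, hb⟩ := Metric.isOpen_iff.1 (isClosed_boundary Q).isOpen_compl z hz.1
  exact ⟨r, hr, subset_inside (convex_ball z r).isPreconnected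
    (Set.disjoint_left.2 hb) (Metric.mem_ball_self hr) hz⟩

lemma isClosed_closedInside {m : ℕ} (Q : Polygon Pt m) : IsClosed (closedInside Q) := by
  rw [← isOpen_compl_iff, Metric.isOpen_iff]
  intro z hz
  have hz' : z ∉ Q.boundary ℝ ∧ z ∉ inside Q := by simpa [closedInside] using hz
  obtain ⟨r, hr, hb⟩ := Metric.isOpen_iff.1 (isClosed_boundary Q).isOpen_compl z hz'.1
  refine ⟨r, hr, fun w hw hw' => ?_⟩
  rcases hw' with hw' | hw'
  · exact hb hw hw'
  · exact hz'.2 (subset_inside (convex_ball z r).isPreconnected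
      (Set.disjoint_left.2 hb) hw hw' (Metric.mem_ball_self hr))

/-- A point from which a ray avoids the polygon is not enclosed by it. -/
lemma not_inside_of_ray {m : ℕ} {Q : Polygon Pt m} {z d : Pt} (hd : d ≠ 0)
    (h : ∀ t : ℝ, 0 ≤ t → z + t • d ∉ Q.boundary ℝ) : z ∉ inside Q := by
  intro hz
  set C : Set Pt := (fun t : ℝ => z + t • d) '' Ici 0 with hCdef
  have hC : IsPreconnected C := by
    refine isPreconnected_Ici.image _ (Continuous.continuousOn (by fun_prop))
  have hsub : C ⊆ connectedComponentIn (Q.boundary ℝ)ᶜ z := by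
    refine hC.subset_connectedComponentIn ⟨0, by simp, by simp⟩ ?_
    rintro _ ⟨t, ht, rfl⟩
    exact h t ht
  obtain ⟨r, hr⟩ := (hz.2.subset hsub).exists_norm_le
  have hdn : 0 < ‖d‖ := norm_pos_iff.2 hd
  -- The parameter is chosen so that the point of the ray has distance `|r| + ‖z‖ + 1` from `z`, too
  -- far for the norm bound `r`.
  have h1 := hr _ ⟨(|r| + ‖z‖ + 1) / ‖d‖, by simp; positivity, rfl⟩
  have h2 : ‖((|r| + ‖z‖ + 1) / ‖d‖) • d‖ = |r| + ‖z‖ + 1 := by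
    rw [norm_smul, Real.norm_of_nonneg (by positivity)]; field_simp
  have h3 := norm_sub_le (z + ((|r| + ‖z‖ + 1) / ‖d‖) • d) z
  rw [add_sub_cancel_left, h2] at h3
  have := le_abs_self r
  simp only at h1
  linarith

/-! ### Edges of a domain and its local shape -/

namespace PolygonalDomain

variable (D : PolygonalDomain)

/-- Number of vertices of the outer polygon (`none`) or of a hole. -/
def size : Option (Fin D.h) → ℕ
  | none => D.outerSize
  | some j => D.holeSize j

/-- The outer polygon (`none`) and the holes. -/
def poly : (o : Option (Fin D.h)) → Polygon Pt (D.size o)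
  | none => D.outer
  | some j => D.hole j

lemma poly_simple (o : Option (Fin D.h)) : IsSimplePolygon (D.poly o) := by
  cases o
  · exact D.outer_simple
  · exact D.hole_simple _

lemma n_eq : D.n = ∑ o, D.size o := by
  rw [Fintype.sum_option]; rfl

lemma vertices_eq : D.vertices = ⋃ o, Set.range (D.poly o).vertices := by
  ext z
  simp only [vertices, Set.mem_union, Set.mem_iUnion]
  constructor
  · rintro (h | ⟨j, h⟩)
    exacts [⟨none, h⟩, ⟨some j, h⟩]
  · rintro ⟨_ | j, h⟩
    exacts [Or.inl h, Or.inr ⟨j, h⟩]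

lemma mem_edges {e : Set Pt} : e ∈ D.edges ↔ ∃ o i, e = (D.poly o).edgeSet ℝ i := by
  constructor
  · rintro (⟨i, h⟩ | ⟨j, i, h⟩)
    exacts [⟨none, i, h⟩, ⟨some j, i, h⟩]
  · rintro ⟨_ | j, i, h⟩
    exacts [Or.inl ⟨i, h⟩, Or.inr ⟨j, i, h⟩]

lemma boundary_disjoint {o o' : Option (Fin D.h)} (h : o ≠ o') :
    Disjoint ((D.poly o).boundary ℝ) ((D.poly o').boundary ℝ) := by
  have key : ∀ j, Disjoint (D.outer.boundary ℝ) ((D.hole j).boundary ℝ) := fun j =>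
    ((inside_disjoint_boundary D.outer).mono_left
      (Set.subset_union_left.trans (D.hole_inside j))).symm
  rcases o with _ | j <;> rcases o' with _ | k
  · exact absurd rfl h
  · exact key k
  · exact (key j).symm
  · exact (D.hole_disjoint j k (fun e => h (by rw [e]))).mono
      Set.subset_union_left Set.subset_union_left

lemma edges_finite : D.edges.Finite := by
  have : D.edges = ⋃ o, Set.range fun i => (D.poly o).edgeSet ℝ i := by
    ext e
    simp only [mem_edges, Set.mem_iUnion, Set.mem_range, eq_comm]
  rw [this]
  exact Set.finite_iUnion fun o => Set.finite_range _

lemma vertices_finite : D.vertices.Finite := by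
  rw [vertices_eq]
  exact Set.finite_iUnion fun o => Set.finite_range _

lemma three_le_n : 3 ≤ D.n := D.outer_simple.three_le.trans (Nat.le_add_right _ _)

lemma vertices_ncard_le : D.vertices.ncard ≤ D.n := by
  rw [n_eq, vertices_eq]
  have : (⋃ o, Set.range (D.poly o).vertices) =
      Set.range fun x : Σ o, Fin (D.size o) => (D.poly x.1).vertices x.2 := by
    ext z; simp
  rw [this, ← Set.image_univ]
  refine (Set.ncard_image_le).trans ?_
  rw [Set.ncard_univ, Nat.card_eq_fintype_card]
  simp

end PolygonalDomain

lemma finRotate_ne {m : ℕ} (hm : 2 ≤ m) (i : Fin m) : finRotate m i ≠ i := by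
  obtain ⟨k, rfl⟩ : ∃ k, m = k + 2 := ⟨m - 2, by omega⟩
  rw [finRotate_apply]
  intro h
  simp at h

lemma IsSimplePolygon.eq_or_vertex {m : ℕ} {Q : Polygon Pt m} (hQ : IsSimplePolygon Q) {i j : Fin m}
    {z : Pt} (hi : z ∈ Q.edgeSet ℝ i) (hj : z ∈ Q.edgeSet ℝ j) :
    i = j ∨ (j = finRotate m i ∧ z = Q.vertices j) ∨ (i = finRotate m j ∧ z = Q.vertices i) := by
  by_cases h : i = j
  · exact Or.inl h
  by_cases h1 : j = finRotate m i
  · subst h1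
    have : z ∈ Q.edgeSet ℝ i ∩ Q.edgeSet ℝ (finRotate m i) := ⟨hi, hj⟩
    rw [hQ.adjacent i] at this
    exact Or.inr (Or.inl ⟨rfl, this⟩)
  by_cases h2 : i = finRotate m j
  · subst h2
    have : z ∈ Q.edgeSet ℝ j ∩ Q.edgeSet ℝ (finRotate m j) := ⟨hj, hi⟩
    rw [hQ.adjacent j] at this
    exact Or.inr (Or.inr ⟨rfl, this⟩)
  · exact absurd hj (Set.disjoint_left.1 (hQ.nonadjacent i j h h1 h2) hi)

lemma left_mem_edgeSet {m : ℕ} (Q : Polygon Pt m) (i : Fin m) : Q.vertices i ∈ Q.edgeSet ℝ i := by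
  rw [edgeSet_eq_segment]; exact left_mem_segment ℝ _ _

lemma right_mem_edgeSet {m : ℕ} (Q : Polygon Pt m) (i : Fin m) :
    Q.vertices (finRotate m i) ∈ Q.edgeSet ℝ i := by
  rw [edgeSet_eq_segment]; exact right_mem_segment ℝ _ _

namespace PolygonalDomain

variable (D : PolygonalDomain)

/-- The end points of an edge, which are the only polygon vertices on it. -/
lemma exists_edge_eq_segment {e : Set Pt} (he : e ∈ D.edges) :
    ∃ A B, A ∈ D.vertices ∧ B ∈ D.vertices ∧ A ≠ B ∧ e = segment ℝ A B ∧
      ∀ v ∈ D.vertices, v ∈ e → v = A ∨ v = B := by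
  obtain ⟨o, i, rfl⟩ := D.mem_edges.1 he
  have hs := D.poly_simple o
  have hV : ∀ k, (D.poly o).vertices k ∈ D.vertices := fun k => by
    rw [vertices_eq]; exact Set.mem_iUnion.2 ⟨o, k, rfl⟩
  refine ⟨(D.poly o).vertices i, (D.poly o).vertices (finRotate _ i), hV _, hV _,
    fun h => finRotate_ne (by have := hs.three_le; omega) i (hs.injective h).symm,
    edgeSet_eq_segment _ _, ?_⟩
  intro v hv hve
  rw [vertices_eq] at hv
  obtain ⟨o', k, rfl⟩ := Set.mem_iUnion.1 hv
  have ho : o' = o := by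
    by_contra hne
    exact Set.disjoint_left.1 (D.boundary_disjoint hne)
      (Set.mem_iUnion.2 ⟨k, left_mem_edgeSet _ k⟩) (Set.mem_iUnion.2 ⟨i, hve⟩)
  subst ho
  rcases hs.eq_or_vertex hve (left_mem_edgeSet _ k) with h | ⟨h, -⟩ | ⟨h, h'⟩
  · exact Or.inl (by rw [h])
  · exact Or.inr (by rw [h])
  · exact Or.inl h'

lemma edge_unique {e e' : Set Pt} (he : e ∈ D.edges) (he' : e' ∈ D.edges) {z : Pt} (hz : z ∈ e)
    (hz' : z ∈ e') (hv : z ∉ D.vertices) : e = e' := by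
  obtain ⟨o, i, rfl⟩ := D.mem_edges.1 he
  obtain ⟨o', k, rfl⟩ := D.mem_edges.1 he'
  have hV : ∀ o k, (D.poly o).vertices k ∈ D.vertices := fun o k => by
    rw [vertices_eq]; exact Set.mem_iUnion.2 ⟨o, k, rfl⟩
  have ho : o' = o := by
    by_contra hne
    exact Set.disjoint_left.1 (D.boundary_disjoint hne)
      (Set.mem_iUnion.2 ⟨k, hz'⟩) (Set.mem_iUnion.2 ⟨i, hz⟩)
  subst ho
  rcases (D.poly_simple o').eq_or_vertex hz hz' with h | ⟨-, h'⟩ | ⟨-, h'⟩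
  · rw [h]
  · exact absurd (h' ▸ hV _ _) hv
  · exact absurd (h' ▸ hV _ _) hv

/-- An edge meets only itself and its two cyclic neighbours. The bound 3 is crude, but any constant
serves the edge count. -/
lemma ncard_edges_through_le (z : Pt) : {e | e ∈ D.edges ∧ z ∈ e}.ncard ≤ 3 := by
  rcases Set.eq_empty_or_nonempty {e | e ∈ D.edges ∧ z ∈ e} with h | ⟨e, he, hz⟩
  · simp [h]
  obtain ⟨o, i, rfl⟩ := D.mem_edges.1 he
  have : {e | e ∈ D.edges ∧ z ∈ e} ⊆ {(D.poly o).edgeSet ℝ i,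
      (D.poly o).edgeSet ℝ (finRotate _ i), (D.poly o).edgeSet ℝ ((finRotate _).symm i)} := by
    rintro e' ⟨he', hz'⟩
    obtain ⟨o', k, rfl⟩ := D.mem_edges.1 he'
    have ho : o' = o := by
      by_contra hne
      exact Set.disjoint_left.1 (D.boundary_disjoint hne)
        (Set.mem_iUnion.2 ⟨k, hz'⟩) (Set.mem_iUnion.2 ⟨i, hz⟩)
    subst ho
    rcases (D.poly_simple o').eq_or_vertex hz hz' with h | ⟨h, -⟩ | ⟨h, -⟩
    · exact Or.inl (by rw [h])
    · exact Or.inr (Or.inl (by rw [h]))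
    · exact Or.inr (Or.inr (by rw [h, Equiv.symm_apply_apply]; rfl))
  refine (Set.ncard_le_ncard this (by simp)).trans ?_
  refine (Set.ncard_insert_le _ _).trans ?_
  exact Nat.succ_le_succ ((Set.ncard_insert_le _ _).trans (by rw [Set.ncard_singleton]))

lemma isClosed_region : IsClosed D.region :=
  (isClosed_closedInside _).sdiff (isOpen_iUnion fun _ => isOpen_inside _)

lemma isClosed_edge {e : Set Pt} (he : e ∈ D.edges) : IsClosed e := by
  obtain ⟨A, B, -, -, -, rfl, -⟩ := D.exists_edge_eq_segment he
  exact isClosed_segment _ _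

lemma edge_subset_region {e : Set Pt} (he : e ∈ D.edges) : e ⊆ D.region := by
  intro z hz
  rcases he with ⟨i, rfl⟩ | ⟨j, i, rfl⟩
  · have hb : z ∈ D.outer.boundary ℝ := Set.mem_iUnion.2 ⟨i, hz⟩
    refine ⟨Or.inl hb, fun h => ?_⟩
    obtain ⟨j, hj⟩ := Set.mem_iUnion.1 h
    exact Set.disjoint_left.1 (inside_disjoint_boundary _) (D.hole_inside j (Or.inr hj)) hb
  · have hb : z ∈ (D.hole j).boundary ℝ := Set.mem_iUnion.2 ⟨i, hz⟩
    refine ⟨Or.inr (D.hole_inside j (Or.inl hb)), fun h => ?_⟩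
    obtain ⟨k, hk⟩ := Set.mem_iUnion.1 h
    by_cases hjk : k = j
    · subst hjk
      exact hk.1 hb
    · exact Set.disjoint_left.1 (D.hole_disjoint k j hjk) (Or.inr hk) (Or.inl hb)

lemma vertex_mem_edge {v : Pt} (hv : v ∈ D.vertices) : ∃ e ∈ D.edges, v ∈ e := by
  rw [vertices_eq] at hv
  obtain ⟨o, k, rfl⟩ := Set.mem_iUnion.1 hv
  exact ⟨_, D.mem_edges.2 ⟨o, k, rfl⟩, left_mem_edgeSet _ k⟩

lemma vertices_subset_region : D.vertices ⊆ D.region := fun v hv => by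
  obtain ⟨e, he, hve⟩ := D.vertex_mem_edge hv
  exact D.edge_subset_region he hve

/-- A connected set that avoids the polygon edges lies in the domain or misses it. -/
lemma subset_region {C : Set Pt} (hC : IsPreconnected C) (hd : ∀ e ∈ D.edges, Disjoint C e)
    {z : Pt} (hz : z ∈ C) (hr : z ∈ D.region) : C ⊆ D.region := by
  have hb : ∀ o, Disjoint C ((D.poly o).boundary ℝ) := fun o =>
    Set.disjoint_iUnion_right.2 fun i => hd _ (D.mem_edges.2 ⟨o, i, rfl⟩)
  intro w hw
  have hzi : z ∈ inside D.outer := by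
    rcases hr.1 with h | h
    · exact absurd h (Set.disjoint_left.1 (hb none) hz)
    · exact h
  refine ⟨Or.inr (subset_inside hC (hb none) hz hzi hw), fun h => ?_⟩
  obtain ⟨j, hj⟩ := Set.mem_iUnion.1 h
  exact hr.2 (Set.mem_iUnion.2 ⟨j, subset_inside hC (hb (some j)) hw hj hz⟩)

/-- Near a point, only the edges through this point are present. -/
lemma exists_ball_edges (z : Pt) :
    ∃ r > 0, ∀ e ∈ D.edges, (Metric.ball z r ∩ e).Nonempty → z ∈ e := by
  have hcl : IsClosed (⋃ e ∈ {e | e ∈ D.edges ∧ z ∉ e}, e) :=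
    (D.edges_finite.subset fun _ h => h.1).isClosed_biUnion fun e he => D.isClosed_edge he.1
  obtain ⟨r, hr, hb⟩ := Metric.isOpen_iff.1 hcl.isOpen_compl z (by simp)
  refine ⟨r, hr, fun e he ⟨w, hw, hwe⟩ => ?_⟩
  by_contra hz
  exact hb hw (Set.mem_biUnion (show e ∈ {e | e ∈ D.edges ∧ z ∉ e} from ⟨he, hz⟩) hwe)

/-- Near a point, there is no polygon vertex except possibly this point. -/
lemma exists_ball_vertices (z : Pt) :
    ∃ r > 0, ∀ v ∈ D.vertices, v ∈ Metric.ball z r → v = z := by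
  have hcl : IsClosed (D.vertices \ {z}) := (D.vertices_finite.subset Set.sdiff_subset).isClosed
  obtain ⟨r, hr, hb⟩ := Metric.isOpen_iff.1 hcl.isOpen_compl z (by simp)
  refine ⟨r, hr, fun v hv hvb => ?_⟩
  by_contra h
  exact hb hvb ⟨hv, h⟩

lemma exists_ball_subset_of_not_edge {z : Pt} (hz : z ∈ D.region) (h : ∀ e ∈ D.edges, z ∉ e) :
    ∃ r > 0, Metric.ball z r ⊆ D.region := by
  obtain ⟨r, hr, hb⟩ := D.exists_ball_edges z
  refine ⟨r, hr, D.subset_region (convex_ball z r).isPreconnected (fun e he => ?_)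
    (Metric.mem_ball_self hr) hz⟩
  rw [Set.disjoint_iff_inter_eq_empty, ← Set.not_nonempty_iff_eq_empty]
  exact fun hne => h e he (hb e he hne)

/-- The domain is locally star-shaped at each of its points. -/
lemma exists_ball_star (z : Pt) :
    ∃ r > 0, ∀ w ∈ D.region, w ∈ Metric.ball z r → D.Visible z w := by
  obtain ⟨r, hr, hb⟩ := D.exists_ball_edges z
  refine ⟨r, hr, fun w hw hwb y hy => ?_⟩
  have hball : segment ℝ z w ⊆ Metric.ball z r :=
    (convex_ball z r).segment_subset (Metric.mem_ball_self hr) hwb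
  by_cases h : ∃ e ∈ D.edges, (segment ℝ y w ∩ e).Nonempty
  · obtain ⟨e, he, u, hu, hue⟩ := h
    have hyw : segment ℝ y w ⊆ segment ℝ z w :=
      (convex_segment z w).segment_subset hy (right_mem_segment ℝ z w)
    have hze : z ∈ e := hb e he ⟨u, hball (hyw hu), hue⟩
    apply D.edge_subset_region he
    have hcv : Convex ℝ e := by
      obtain ⟨A, B, -, -, -, rfl, -⟩ := D.exists_edge_eq_segment he
      exact convex_segment _ _
    refine hcv.segment_subset hze hue ?_
    obtain ⟨s, hs, rfl⟩ := (segment_eq_image' ℝ z w ▸ hy)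
    obtain ⟨t, ht, rfl⟩ := (segment_eq_image' ℝ _ w ▸ hu)
    -- With `y` at parameter `s` on `zw` and `u` at parameter `t` on `yw`, the point `u` has
    -- parameter `s + t * (1 - s)` on `zw`. So `y` lies between `z` and `u`, both on the edge, and
    -- the quotient is its parameter there.
    rw [segment_eq_image']
    simp only [mem_Icc] at hs ht
    by_cases hs0 : s = 0
    · exact ⟨0, by simp, by simp [hs0]⟩
    have hspos : 0 < s := lt_of_le_of_ne hs.1 (Ne.symm hs0)
    have hden : 0 < s + t * (1 - s) := by nlinarith [mul_nonneg ht.1 (sub_nonneg.2 hs.2)]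
    refine ⟨s / (s + t * (1 - s)), ⟨by positivity, ?_⟩, ?_⟩
    · rw [div_le_one hden]; nlinarith [mul_nonneg ht.1 (sub_nonneg.2 hs.2)]
    · ext <;> simp <;> field_simp <;> ring
  · push Not at h
    exact D.subset_region (convex_segment y w).isPreconnected
      (fun e he => Set.disjoint_iff_inter_eq_empty.2 (h e he)) (right_mem_segment ℝ y w) hw
      (left_mem_segment ℝ y w)

/-- The domain is locally convex at each of its points that is not a polygon vertex. -/
lemma exists_ball_convex {z : Pt} (hz : z ∈ D.region) (hv : z ∉ D.vertices) :
    ∃ r > 0, Convex ℝ (Metric.ball z r ∩ D.region) := by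
  by_cases h : ∃ e ∈ D.edges, z ∈ e
  swap
  · push Not at h
    obtain ⟨r, hr, hb⟩ := D.exists_ball_subset_of_not_edge hz h
    exact ⟨r, hr, by rw [Set.inter_eq_left.2 hb]; exact convex_ball z r⟩
  obtain ⟨e, he, hze⟩ := h
  obtain ⟨A, B, hA, hB, hAB, rfl, -⟩ := D.exists_edge_eq_segment he
  obtain ⟨r₁, hr₁, hb₁⟩ := D.exists_ball_edges z
  obtain ⟨τ, hτ, rfl⟩ := (segment_eq_image' ℝ A B ▸ hze)
  simp only at *
  have hτ0 : 0 < τ := lt_of_le_of_ne hτ.1 fun h => hv (by simpa [← h] using hA)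
  have hτ1 : τ < 1 := lt_of_le_of_ne hτ.2 fun h => hv (by simpa [h] using hB)
  set z := A + τ • (B - A) with hzdef
  have hn : 0 < ‖B - A‖ := norm_pos_iff.2 (sub_ne_zero.2 hAB.symm)
  -- The second bound forces points of the ball on the line through `A` and `B` to lie on the edge
  -- itself and not on its continuation.
  set r := min r₁ (min τ (1 - τ) * ‖B - A‖) with hrdef
  have hτm : 0 < min τ (1 - τ) := lt_min hτ0 (by linarith)
  have hr : 0 < r := lt_min hr₁ (by positivity)
  have hb : ∀ e ∈ D.edges, (Metric.ball z r ∩ e).Nonempty → e = segment ℝ A B := by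
    rintro e he' ⟨w, hw, hwe⟩
    have hz' := hb₁ e he' ⟨w, Metric.ball_subset_ball (min_le_left _ _) hw, hwe⟩
    exact D.edge_unique he' he hz' hze hv
  set φ : Pt → ℝ := fun w => (B.1 - A.1) * (w.2 - A.2) - (B.2 - A.2) * (w.1 - A.1) with hφ
  have hlin : ∀ (x y : Pt) (a b : ℝ), a + b = 1 → φ (a • x + b • y) = a * φ x + b * φ y := by
    intro x y a b hab
    obtain rfl : b = 1 - a := by linarith
    simp only [hφ, Prod.fst_add, Prod.snd_add, Prod.smul_fst, Prod.smul_snd, smul_eq_mul]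
    ring
  have hline : ∀ w ∈ Metric.ball z r, φ w = 0 → w ∈ segment ℝ A B := by
    intro w hw hw0
    have : ∃ k : ℝ, w = A + k • (B - A) := by
      by_cases hx : B.1 - A.1 = 0
      · have hy : B.2 - A.2 ≠ 0 := fun hy => hAB (by
          ext
          · linarith
          · linarith)
        refine ⟨(w.2 - A.2) / (B.2 - A.2), ?_⟩
        have : w.1 - A.1 = 0 := by
          have : (B.2 - A.2) * (w.1 - A.1) = 0 := by
            simp only [hφ, hx] at hw0; linarith
          exact (mul_eq_zero.1 this).resolve_left hy
        ext
        · simp [hx]; linarith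
        · simp [hy]
      · refine ⟨(w.1 - A.1) / (B.1 - A.1), ?_⟩
        ext
        · simp [hx]
        · simp only [hφ] at hw0
          simp only [Prod.snd_add, Prod.smul_snd, Prod.snd_sub, smul_eq_mul]
          field_simp
          linarith
    obtain ⟨k, rfl⟩ := this
    rw [Metric.mem_ball, dist_eq_norm, hzdef, add_sub_add_left_eq_sub, ← sub_smul, norm_smul,
      Real.norm_eq_abs] at hw
    have hk : |k - τ| < min τ (1 - τ) :=
      lt_of_mul_lt_mul_right (hw.trans_le (min_le_right _ _)) hn.le
    obtain ⟨h1, h2⟩ := abs_lt.1 hk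
    have := min_le_left τ (1 - τ)
    have := min_le_right τ (1 - τ)
    rw [segment_eq_image']
    exact ⟨k, ⟨by linarith, by linarith⟩, rfl⟩
  have hedge0 : ∀ w ∈ segment ℝ A B, φ w = 0 := by
    rintro w ⟨a, b, -, -, hab, rfl⟩
    rw [hlin _ _ _ _ hab]
    simp only [hφ]; ring
  -- The only edge met by the ball lies on the line `φ = 0`. Hence each open half of the ball is
  -- convex and free of edges, so it lies in the domain or misses it.
  have hside : ∀ P : ℝ → Prop, Convex ℝ {t | P t} → ¬ P 0 →
      ({w | P (φ w)} ∩ Metric.ball z r ⊆ D.region ∨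
        Disjoint ({w | P (φ w)} ∩ Metric.ball z r) D.region) := by
    intro P hP h0
    by_cases hne : Disjoint ({w | P (φ w)} ∩ Metric.ball z r) D.region
    · exact Or.inr hne
    left
    obtain ⟨w, hw, hwr⟩ := Set.not_disjoint_iff.1 hne
    refine D.subset_region (Convex.isPreconnected ?_) (fun e he' => ?_) hw hwr
    · refine Convex.inter ?_ (convex_ball z r)
      intro x hx y hy a b ha hb hab
      change P _
      rw [hlin _ _ _ _ hab]
      exact hP hx hy ha hb hab
    · refine Set.disjoint_left.2 fun u hu hue => ?_
      rw [hb e he' ⟨u, hu.2, hue⟩] at hue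
      have := hu.1
      simp only [Set.mem_ofPred_eq, hedge0 u hue] at this
      exact h0 this
  refine ⟨r, hr, ?_⟩
  have hneg := hside (fun t => t < 0) (convex_Iio 0) (lt_irrefl _)
  have hpos := hside (fun t => 0 < t) (convex_Ioi 0) (lt_irrefl _)
  intro x hx y hy a b ha hb' hab
  have hball := convex_ball z r hx.1 hy.1 ha hb' hab
  refine ⟨hball, ?_⟩
  have hxn : φ x < 0 → {w | φ w < 0} ∩ Metric.ball z r ⊆ D.region := fun h =>
    hneg.resolve_right fun hd => Set.disjoint_left.1 hd ⟨h, hx.1⟩ hx.2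
  have hyn : φ y < 0 → {w | φ w < 0} ∩ Metric.ball z r ⊆ D.region := fun h =>
    hneg.resolve_right fun hd => Set.disjoint_left.1 hd ⟨h, hy.1⟩ hy.2
  have hxp : 0 < φ x → {w | 0 < φ w} ∩ Metric.ball z r ⊆ D.region := fun h =>
    hpos.resolve_right fun hd => Set.disjoint_left.1 hd ⟨h, hx.1⟩ hx.2
  have hyp : 0 < φ y → {w | 0 < φ w} ∩ Metric.ball z r ⊆ D.region := fun h =>
    hpos.resolve_right fun hd => Set.disjoint_left.1 hd ⟨h, hy.1⟩ hy.2
  have hval := hlin x y a b hab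
  -- If the combination is strictly on one side, then so is `x` or `y`, and this side is contained
  -- in the domain.
  rcases lt_trichotomy (φ (a • x + b • y)) 0 with h | h | h
  · have : φ x < 0 ∨ φ y < 0 := by
      by_contra! hc
      have := mul_nonneg ha hc.1
      have := mul_nonneg hb' hc.2
      linarith
    exact this.elim (fun h' => hxn h' ⟨h, hball⟩) (fun h' => hyn h' ⟨h, hball⟩)
  · exact D.edge_subset_region he (hline _ hball h)
  · have : 0 < φ x ∨ 0 < φ y := by
      by_contra! hc
      have := mul_nonneg ha (neg_nonneg.2 hc.1)
      have := mul_nonneg hb' (neg_nonneg.2 hc.2)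
      linarith
    exact this.elim (fun h' => hxp h' ⟨h, hball⟩) (fun h' => hyp h' ⟨h, hball⟩)

end PolygonalDomain
end L1Domain

/-! ### Sweeping the unit triangle -/

namespace L1Domain
open Set Filter Topology

lemma convex_comb_three {K : Set Pt} (hK : Convex ℝ K) {x y z : Pt} (hx : x ∈ K) (hy : y ∈ K)
    (hz : z ∈ K) {a b c : ℝ} (ha : 0 ≤ a) (hb : 0 ≤ b) (hc : 0 ≤ c) (h : a + b + c = 1) :
    a • x + b • y + c • z ∈ K := by
  by_cases h0 : a + b = 0
  · obtain rfl : a = 0 := by linarith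
    obtain rfl : b = 0 := by linarith
    obtain rfl : c = 1 := by linarith
    simpa using hz
  · have hab : 0 < a + b := lt_of_le_of_ne (by positivity) (Ne.symm h0)
    have h1 : (a / (a + b)) • x + (b / (a + b)) • y ∈ K :=
      hK hx hy (by positivity) (by positivity) (by field_simp)
    have h2 := hK h1 hz hab.le hc h
    convert h2 using 2
    rw [smul_add, smul_smul, smul_smul]
    congr 2 <;> field_simp

/-- A closed set that contains the part of the unit triangle `0 ≤ w ≤ s ≤ 1` below the line of slope
`t` contains the part below a line of larger slope, unless the line meets a bad point. -/
lemma exists_slope_gt {F bad : Set Pt}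
    (hloc : ∀ z ∈ F, z ∉ bad → ∃ N ∈ 𝓝 z, Convex ℝ (N ∩ F))
    (hstar : ∀ᶠ z in 𝓝 (0 : Pt), z ∈ F → segment ℝ 0 z ⊆ F)
    (h1 : ∀ t ∈ Icc (0 : ℝ) 1, ((1, t) : Pt) ∈ F)
    (hsec : ∃ ε > 0, ∀ s w : ℝ, 1 - ε ≤ s → s ≤ 1 → 0 ≤ w → w ≤ ε → ((s, w) : Pt) ∈ F)
    {t : ℝ} (ht : t ∈ Ico (0 : ℝ) 1) (hs : ∀ s ∈ Icc (0 : ℝ) 1, ((s, s * t) : Pt) ∈ F)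
    (hbad : ∀ s, 0 < s → s ≤ 1 → (s, t) ≠ ((1, 0) : Pt) → ((s, s * t) : Pt) ∉ bad) :
    ∃ t' ∈ Ioc t 1, ∀ t'' ∈ Icc t t', ∀ s ∈ Icc (0 : ℝ) 1, ((s, s * t'') : Pt) ∈ F := by
  -- `B` consists of the missing points on or above the current line. The goal is that its closure
  -- avoids the line away from the origin; compactness then leaves room to turn the line.
  set B : Set Pt := {z | z ∉ F ∧ z.1 * t ≤ z.2 ∧ z.1 ≤ 1} with hB
  -- At the right end, for `t = 0` the point `(1, 0)` may be bad, and the free sector `hsec`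
  -- replaces local convexity. For `t > 0`, a small triangle with one side on the line and one on `s
  -- = 1` covers all nearby points above the line.
  have hend : ((1, t) : Pt) ∉ closure B := by
    rw [mem_closure_iff_frequently, Filter.not_frequently]
    rcases ht.1.eq_or_lt with h0 | h0
    · subst h0
      obtain ⟨ε, hε, he⟩ := hsec
      filter_upwards [Metric.ball_mem_nhds ((1, 0) : Pt) hε] with y hy hyB
      rw [Metric.mem_ball, Prod.dist_eq, max_lt_iff, Real.dist_eq, Real.dist_eq, abs_lt, abs_lt] at hy
      simp only at hy
      have := hyB.2.1
      rw [mul_zero] at this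
      exact hyB.1 (he y.1 y.2 (by linarith) hyB.2.2 this (by linarith))
    · have hmem := h1 t ⟨ht.1, ht.2.le⟩
      obtain ⟨N, hN, hc⟩ := hloc _ hmem (by
        simpa using hbad 1 one_pos le_rfl (by simp [h0.ne']))
      obtain ⟨ρ, hρ, hb⟩ := Metric.mem_nhds_iff.1 hN
      obtain ⟨η, hη, hη1, hη2, hη3⟩ : ∃ η > 0, η < ρ ∧ η < 1 - t ∧ η < 1 := by
        refine ⟨min ρ (min (1 - t) 1) / 2, ?_, ?_, ?_, ?_⟩
        · have : 0 < 1 - t := by linarith [ht.2]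
          positivity
        all_goals
          have h1 : 0 < 1 - t := by linarith [ht.2]
          have h2 : 0 < min ρ (min (1 - t) 1) := by positivity
          have h3 := min_le_left ρ (min (1 - t) 1)
          have h4 := min_le_right ρ (min (1 - t) 1)
          have h5 := min_le_left (1 - t) 1
          have h6 := min_le_right (1 - t) 1
          linarith
      have hp : ((1, t + η) : Pt) ∈ N ∩ F := by
        refine ⟨hb ?_, h1 _ ⟨by linarith [ht.1], by linarith⟩⟩
        rw [Metric.mem_ball, Prod.dist_eq, max_lt_iff, Real.dist_eq, Real.dist_eq, abs_lt, abs_lt]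
        constructor <;> constructor <;> simp <;> linarith
      have hq : ((1 - η, (1 - η) * t) : Pt) ∈ N ∩ F := by
        refine ⟨hb ?_, hs _ ⟨by linarith, by linarith⟩⟩
        rw [Metric.mem_ball, Prod.dist_eq, max_lt_iff, Real.dist_eq, Real.dist_eq, abs_lt, abs_lt]
        constructor <;> constructor <;> simp <;> nlinarith [ht.2]
      have hz : ((1, t) : Pt) ∈ N ∩ F := ⟨mem_of_mem_nhds hN, hmem⟩
      have hcont : ContinuousAt (fun y : Pt => (y.2 - y.1 * t) / η + (1 - y.1) / η) (1, t) := by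
        fun_prop
      have hev := hcont.tendsto.eventually_lt_const (u := 1) (by simp)
      filter_upwards [hev] with y hy hyB
      refine hyB.1 ?_
      have hcomb := convex_comb_three hc hz hp hq (a := 1 - (y.2 - y.1 * t) / η - (1 - y.1) / η)
        (b := (y.2 - y.1 * t) / η) (c := (1 - y.1) / η) (by linarith)
        (div_nonneg (by linarith [hyB.2.1]) hη.le) (div_nonneg (by linarith [hyB.2.2]) hη.le)
        (by ring)
      convert hcomb.2 using 1
      ext <;> simp <;> field_simp <;> ring
  -- Take the rightmost point `m` of the line in the closure of `B`. Just to its right some point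
  -- above the line is in `F`; together with points of the line on both sides of `m` it spans a
  -- triangle that, by local convexity, contains all points near `m` above the line.
  have hmid : ∀ s, 0 < s → s ≤ 1 → ((s, s * t) : Pt) ∉ closure B := by
    intro σ hσ hσ1 hcon
    set A : Set ℝ := {s | s ∈ Icc σ 1 ∧ ((s, s * t) : Pt) ∈ closure B} with hA
    have hAc : IsCompact A := by
      refine isCompact_Icc.inter_right (isClosed_closure.preimage (f := fun s : ℝ => ((s, s * t) : Pt)) ?_)
      fun_prop
    obtain ⟨m, hm, hmax⟩ := hAc.exists_isGreatest ⟨σ, ⟨le_rfl, hσ1⟩, hcon⟩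
    have hm0 : 0 < m := hσ.trans_le hm.1.1
    have hm1 : m < 1 := by
      refine lt_of_le_of_ne hm.1.2 fun h => hend ?_
      have := hm.2
      rwa [h, one_mul] at this
    have hmem := hs m ⟨hm0.le, hm1.le⟩
    obtain ⟨N, hN, hc⟩ := hloc _ hmem (hbad m hm0 hm1.le (by simp [hm1.ne]))
    obtain ⟨ρ, hρ, hb⟩ := Metric.mem_nhds_iff.1 hN
    obtain ⟨η, hη, hη1, hη2, hη3⟩ : ∃ η > 0, η < ρ ∧ η < m ∧ η < 1 - m := by
      refine ⟨min ρ (min m (1 - m)) / 2, ?_, ?_, ?_, ?_⟩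
      · have : 0 < 1 - m := by linarith
        positivity
      all_goals
        have h1 : 0 < 1 - m := by linarith
        have h2 : 0 < min ρ (min m (1 - m)) := by positivity
        have h3 := min_le_left ρ (min m (1 - m))
        have h4 := min_le_right ρ (min m (1 - m))
        have h5 := min_le_left m (1 - m)
        have h6 := min_le_right m (1 - m)
        linarith
    have hon : ∀ s, |s - m| ≤ η → ((s, s * t) : Pt) ∈ Metric.ball ((m, m * t) : Pt) ρ ∩ F := by
      intro s hs'
      obtain ⟨ha, hb'⟩ := abs_le.1 hs'
      refine ⟨?_, hs s ⟨by linarith, by linarith⟩⟩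
      rw [Metric.mem_ball, Prod.dist_eq, max_lt_iff, Real.dist_eq, Real.dist_eq]
      simp only
      refine ⟨by linarith, ?_⟩
      rw [← sub_mul, abs_mul, abs_of_nonneg ht.1]
      nlinarith [abs_nonneg (s - m), ht.2, ht.1]
    have hp := hon (m - η) (by simp [abs_of_pos hη])
    have hq := hon (m + η) (by simp [abs_of_pos hη])
    have hqC : ((m + η, (m + η) * t) : Pt) ∉ closure B := fun h => by
      have := hmax ⟨⟨by linarith [hm.1.1], by linarith⟩, h⟩
      linarith
    have hup : ∃ κ > 0, ((m + η, (m + η) * t + κ) : Pt) ∈ N ∩ F := by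
      rw [mem_closure_iff_frequently, Filter.not_frequently] at hqC
      have hcont : Tendsto (fun κ : ℝ => ((m + η, (m + η) * t + κ) : Pt)) (𝓝 0)
          (𝓝 (m + η, (m + η) * t)) := by
        have : Continuous (fun κ : ℝ => ((m + η, (m + η) * t + κ) : Pt)) := by fun_prop
        simpa using this.tendsto 0
      have h2 := hcont.eventually (hqC.and (Metric.isOpen_ball.mem_nhds hq.1))
      obtain ⟨κ, ⟨hκ, hκb⟩, hκ0⟩ :=
        ((h2.filter_mono (nhdsWithin_le_nhds (s := Ioi 0))).and self_mem_nhdsWithin).exists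
      refine ⟨κ, hκ0, hb hκb, ?_⟩
      by_contra hF'
      exact hκ ⟨hF', by simpa using le_of_lt hκ0, by simp only; linarith⟩
    obtain ⟨κ, hκ, hu⟩ := hup
    refine absurd hm.2 ?_
    rw [mem_closure_iff_frequently, Filter.not_frequently]
    have hcont1 : ContinuousAt (fun y : Pt => (y.1 - (m - η)) / (2 * η) - (y.2 - y.1 * t) / κ)
        (m, m * t) := by fun_prop
    have hev1 := hcont1.eventually (lt_mem_nhds (a := 0) (by
      simp only [sub_sub_cancel, sub_self, zero_div, sub_zero]; positivity))
    have hcont2 : ContinuousAt (fun y : Pt => y.1) (m, m * t) := by fun_prop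
    have hev2 := hcont2.tendsto.eventually_lt_const (u := m + η) (by simpa using hη)
    filter_upwards [hev1, hev2] with y hy hy2 hyB
    refine hyB.1 ?_
    have hcomb := convex_comb_three hc ⟨hb hp.1, hp.2⟩ ⟨hb hq.1, hq.2⟩ hu
      (a := 1 - (y.1 - (m - η)) / (2 * η))
      (b := (y.1 - (m - η)) / (2 * η) - (y.2 - y.1 * t) / κ) (c := (y.2 - y.1 * t) / κ)
      (by rw [sub_nonneg, div_le_one (by positivity)]; linarith) hy.le
      (div_nonneg (by linarith [hyB.2.1]) hκ.le) (by ring)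
    convert hcomb.2 using 1
    ext <;> simp <;> field_simp <;> ring
  -- Local convexity gives no uniform room at the origin, where all lines meet. Compactness is used
  -- only for `s ≥ ρ`, and the rest follows from star-shapedness at the origin.
  obtain ⟨r, hr, hst⟩ := Metric.eventually_nhds_iff_ball.1 hstar
  set ρ := min r 1 / 2 with hρ
  have hρ0 : 0 < ρ := by positivity
  have hρr : ρ < r := by
    have := min_le_left r 1
    have : 0 < min r 1 := by positivity
    linarith
  have hρ1 : ρ < 1 := by
    have := min_le_right r 1
    linarith
  have hK : IsCompact ((fun s : ℝ => ((s, s * t) : Pt)) '' Icc ρ 1) :=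
    isCompact_Icc.image (by fun_prop)
  obtain ⟨δ, hδ, hth⟩ := hK.exists_thickening_subset_open isClosed_closure.isOpen_compl (by
    rintro _ ⟨s, hs', rfl⟩
    exact hmid s (hρ0.trans_le hs'.1) hs'.2)
  set d := min (δ / 2) (1 - t) with hd
  have hd0 : 0 < d := lt_min (by positivity) (by linarith [ht.2])
  have hd1 : d ≤ δ / 2 := min_le_left _ _
  have hd2 : d ≤ 1 - t := min_le_right _ _
  refine ⟨t + d, ⟨by linarith, by linarith⟩, ?_⟩
  intro t' ht'
  have hlarge : ∀ s ∈ Icc ρ 1, ((s, s * t') : Pt) ∈ F := by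
    intro s hs'
    have hin : ((s, s * t') : Pt) ∈ Metric.thickening δ ((fun s : ℝ => ((s, s * t) : Pt)) '' Icc ρ 1) := by
      rw [Metric.mem_thickening_iff]
      refine ⟨_, ⟨s, hs', rfl⟩, ?_⟩
      rw [Prod.dist_eq, max_lt_iff, Real.dist_eq, Real.dist_eq]
      simp only [sub_self, abs_zero]
      refine ⟨hδ, ?_⟩
      rw [← mul_sub, abs_mul, abs_of_nonneg (by linarith [hs'.1] : 0 ≤ s),
        abs_of_nonneg (by linarith [ht'.1])]
      nlinarith [ht'.2, ht'.1, hs'.1, hs'.2]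
    by_contra hn
    exact hth hin (subset_closure ⟨hn, mul_le_mul_of_nonneg_left ht'.1 (by linarith [hs'.1]), hs'.2⟩)
  intro s hs'
  by_cases hsρ : ρ ≤ s
  · exact hlarge s ⟨hsρ, hs'.2⟩
  · push Not at hsρ
    have hb : ((ρ, ρ * t') : Pt) ∈ Metric.ball (0 : Pt) r := by
      rw [Metric.mem_ball, Prod.dist_eq, max_lt_iff, Real.dist_eq, Real.dist_eq]
      simp only [Prod.fst_zero, Prod.snd_zero, sub_zero]
      rw [abs_of_pos hρ0, abs_of_nonneg (mul_nonneg hρ0.le (ht.1.trans ht'.1))]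
      refine ⟨hρr, ?_⟩
      have : t' ≤ 1 := by linarith [ht'.2]
      nlinarith
    refine hst _ hb (hlarge ρ ⟨le_rfl, hρ1.le⟩) ?_
    rw [segment_eq_image']
    refine ⟨s / ρ, ⟨div_nonneg hs'.1 hρ0.le, (div_le_one hρ0).2 hsρ.le⟩, ?_⟩
    ext <;> simp <;> field_simp

/-- Sweeping the unit triangle `0 ≤ w ≤ s ≤ 1` by the lines through the origin. -/
lemma exists_slope_eq_one_or_bad {F bad : Set Pt} (hF : IsClosed F)
    (hloc : ∀ z ∈ F, z ∉ bad → ∃ N ∈ 𝓝 z, Convex ℝ (N ∩ F))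
    (hstar : ∀ᶠ z in 𝓝 (0 : Pt), z ∈ F → segment ℝ 0 z ⊆ F)
    (h0 : ∀ s ∈ Icc (0 : ℝ) 1, ((s, 0) : Pt) ∈ F)
    (h1 : ∀ t ∈ Icc (0 : ℝ) 1, ((1, t) : Pt) ∈ F)
    (hsec : ∃ ε > 0, ∀ s w : ℝ, 1 - ε ≤ s → s ≤ 1 → 0 ≤ w → w ≤ ε → ((s, w) : Pt) ∈ F) :
    ∃ t ∈ Icc (0 : ℝ) 1, (∀ t' ∈ Icc 0 t, ∀ s ∈ Icc (0 : ℝ) 1, ((s, s * t') : Pt) ∈ F) ∧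
      (t = 1 ∨ ∃ s, 0 < s ∧ s ≤ 1 ∧ (s, t) ≠ ((1, 0) : Pt) ∧ ((s, s * t) : Pt) ∈ bad) := by
  by_contra! hcon
  set S : Set ℝ := {t | ∀ t' ∈ Icc 0 t, ∀ s ∈ Icc (0 : ℝ) 1, ((s, s * t') : Pt) ∈ F} with hS
  have hclosed : IsClosed (S ∩ Icc 0 1) := by
    -- Writing the smaller slopes as `l * t` with `l` in `[0, 1]` removes the dependence of the
    -- index set on `t`, so that the set becomes an intersection of preimages of `F`.
    have : S ∩ Icc 0 1 = (⋂ l ∈ Icc (0 : ℝ) 1, ⋂ s ∈ Icc (0 : ℝ) 1,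
        (fun t : ℝ => ((s, s * (l * t)) : Pt)) ⁻¹' F) ∩ Icc 0 1 := by
      ext t
      simp only [mem_inter_iff, mem_iInter, mem_preimage, hS, mem_ofPred_eq]
      refine and_congr_left fun ht => ⟨fun h l hl s hs => ?_, fun h t' ht' s hs => ?_⟩
      · exact h _ ⟨mul_nonneg hl.1 ht.1, mul_le_of_le_one_left ht.1 hl.2⟩ s hs
      · rcases ht.1.eq_or_lt with h' | h'
        · have : t' = 0 := le_antisymm (h' ▸ ht'.2) ht'.1
          simpa [this] using h0 s hs
        · have := h (t' / t) ⟨div_nonneg ht'.1 ht.1, (div_le_one h').2 ht'.2⟩ s hs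
          rwa [div_mul_cancel₀ _ h'.ne'] at this
    rw [this]
    refine IsClosed.inter (isClosed_biInter fun l _ => isClosed_biInter fun s _ => ?_) isClosed_Icc
    exact hF.preimage (by fun_prop)
  have h0S : (0 : ℝ) ∈ S := by
    intro t' ht' s hs
    obtain rfl : t' = 0 := le_antisymm ht'.2 ht'.1
    simpa using h0 s hs
  have hsub := hclosed.Icc_subset_of_forall_exists_gt h0S (by
    rintro t ⟨htS, ht⟩ y hy
    obtain ⟨-, h2⟩ := hcon t ⟨ht.1, ht.2.le⟩ htS
    obtain ⟨t', ht', hfree⟩ := exists_slope_gt hloc hstar h1 hsec ht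
      (htS t ⟨ht.1, le_rfl⟩) h2
    refine ⟨min t' y, ?_, lt_min ht'.1 hy, min_le_right _ _⟩
    intro t'' ht'' s hs
    rcases le_total t'' t with h | h
    · exact htS t'' ⟨ht''.1, h⟩ s hs
    · exact hfree t'' ⟨h, ht''.2.trans (min_le_left _ _)⟩ s hs)
  exact (hcon 1 ⟨zero_le_one, le_rfl⟩ (hsub ⟨zero_le_one, le_rfl⟩)).1 rfl

end L1Domain

namespace L1Domain
open Set Filter Topology

/-! ### Distances -/

lemma l1Dist_self (a : Pt) : l1Dist a a = 0 := by simp [l1Dist]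

lemma l1Dist_comm (a b : Pt) : l1Dist a b = l1Dist b a := by
  simp only [l1Dist, abs_sub_comm]

lemma l1Dist_nonneg (a b : Pt) : 0 ≤ l1Dist a b := by unfold l1Dist; positivity

lemma l1Dist_triangle (a b c : Pt) : l1Dist a c ≤ l1Dist a b + l1Dist b c := by
  have h1 := abs_sub_le a.1 b.1 c.1
  have h2 := abs_sub_le a.2 b.2 c.2
  simp only [l1Dist]
  linarith

lemma abs_sub_add_of_mem_uIcc {x y z : ℝ} (h : z ∈ uIcc x y) : |x - z| + |z - y| = |x - y| := by
  rcases mem_uIcc.1 h with ⟨h1, h2⟩ | ⟨h1, h2⟩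
  · rw [abs_of_nonpos (by linarith), abs_of_nonpos (by linarith), abs_of_nonpos (by linarith)]
    ring
  · rw [abs_of_nonneg (by linarith), abs_of_nonneg (by linarith), abs_of_nonneg (by linarith)]
    ring

/-- The smallest axis-parallel rectangle that contains two points. -/
def rect (a b : Pt) : Set Pt := {z | z.1 ∈ uIcc a.1 b.1 ∧ z.2 ∈ uIcc a.2 b.2}

/-- The two coordinates contribute separately. This is why monotone detours inside the bounding box
cost nothing. -/
lemma l1Dist_add_of_mem_rect {a b z : Pt} (h : z ∈ rect a b) :
    l1Dist a z + l1Dist z b = l1Dist a b := by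
  have h1 := abs_sub_add_of_mem_uIcc h.1
  have h2 := abs_sub_add_of_mem_uIcc h.2
  simp only [l1Dist]
  linarith

lemma convex_rect (a b : Pt) : Convex ℝ (rect a b) :=
  ((convex_uIcc a.1 b.1).prod (convex_uIcc a.2 b.2) : Convex ℝ (uIcc a.1 b.1 ×ˢ uIcc a.2 b.2))

lemma left_mem_rect (a b : Pt) : a ∈ rect a b := ⟨left_mem_uIcc, left_mem_uIcc⟩

lemma right_mem_rect (a b : Pt) : b ∈ rect a b := ⟨right_mem_uIcc, right_mem_uIcc⟩

lemma segment_subset_rect (a b : Pt) : segment ℝ a b ⊆ rect a b :=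
  (convex_rect a b).segment_subset (left_mem_rect a b) (right_mem_rect a b)

lemma l1Dist_add_of_mem_segment {a b z : Pt} (h : z ∈ segment ℝ a b) :
    l1Dist a z + l1Dist z b = l1Dist a b :=
  l1Dist_add_of_mem_rect (segment_subset_rect a b h)

/-! ### Triangles -/

/-- The triangle with the given corners. -/
def tri (b x y : Pt) : Set Pt :=
  {z | ∃ s w : ℝ, 0 ≤ w ∧ w ≤ s ∧ s ≤ 1 ∧ z = b + s • (x - b) + w • (y - x)}

lemma tri_subset {K : Set Pt} (hK : Convex ℝ K) {b x y : Pt} (hb : b ∈ K) (hx : x ∈ K)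
    (hy : y ∈ K) : tri b x y ⊆ K := by
  rintro z ⟨s, w, h1, h2, h3, rfl⟩
  have := convex_comb_three hK hb hx hy (a := 1 - s) (b := s - w) (c := w) (by linarith)
    (by linarith) h1 (by ring)
  convert this using 1
  module

lemma convex_tri (b x y : Pt) : Convex ℝ (tri b x y) := by
  rintro _ ⟨s, w, h1, h2, h3, rfl⟩ _ ⟨s', w', h1', h2', h3', rfl⟩ p q hp hq hpq
  refine ⟨p * s + q * s', p * w + q * w', by positivity, by nlinarith, by nlinarith, ?_⟩
  obtain rfl : q = 1 - p := by linarith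
  module

lemma mem_tri_left (b x y : Pt) : b ∈ tri b x y := ⟨0, 0, by simp⟩

lemma mem_tri_middle (b x y : Pt) : x ∈ tri b x y := ⟨1, 0, by simp⟩

lemma mem_tri_right (b x y : Pt) : y ∈ tri b x y := ⟨1, 1, by simp⟩

lemma mem_segment_of_eq {a b z : Pt} {t : ℝ} (h0 : 0 ≤ t) (h1 : t ≤ 1)
    (hz : z = a + t • (b - a)) : z ∈ segment ℝ a b := by
  rw [segment_eq_image']
  exact ⟨t, ⟨h0, h1⟩, hz.symm⟩

lemma exists_of_mem_segment {a b z : Pt} (h : z ∈ segment ℝ a b) :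
    ∃ t : ℝ, 0 ≤ t ∧ t ≤ 1 ∧ z = a + t • (b - a) := by
  rw [segment_eq_image'] at h
  obtain ⟨t, ht, rfl⟩ := h
  exact ⟨t, ht.1, ht.2, rfl⟩

/-- Short moves from a point stay in a given ball. -/
lemma exists_move_mem_ball (z d : Pt) {r : ℝ} (hr : 0 < r) :
    ∃ ε > 0, ∀ t : ℝ, |t| ≤ ε → z + t • d ∈ Metric.ball z r := by
  refine ⟨r / (‖d‖ + 1), by positivity, fun t ht => ?_⟩
  rw [Metric.mem_ball, dist_eq_norm, add_sub_cancel_left, norm_smul, Real.norm_eq_abs]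
  have h1 : |t| * ‖d‖ ≤ r / (‖d‖ + 1) * ‖d‖ := by gcongr
  have h2 : r / (‖d‖ + 1) * ‖d‖ < r := by
    rw [div_mul_eq_mul_div, div_lt_iff₀ (by positivity)]
    nlinarith [norm_nonneg d]
  linarith

namespace PolygonalDomain

variable {D : PolygonalDomain}

lemma Visible.symm {a b : Pt} (h : D.Visible a b) : D.Visible b a := by
  unfold Visible
  rw [segment_symm]
  exact h

lemma Visible.left_mem {a b : Pt} (h : D.Visible a b) : a ∈ D.region := h (left_mem_segment ℝ a b)

lemma Visible.right_mem {a b : Pt} (h : D.Visible a b) : b ∈ D.region :=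
  h (right_mem_segment ℝ a b)

lemma Visible.mono {a b c d : Pt} (h : D.Visible a b) (hc : c ∈ segment ℝ a b)
    (hd : d ∈ segment ℝ a b) : D.Visible c d :=
  ((convex_segment a b).segment_subset hc hd).trans h

lemma visible_self {a : Pt} (h : a ∈ D.region) : D.Visible a a := by
  simpa [Visible] using h

lemma visible_of_convex {K : Set Pt} (hK : Convex ℝ K) (hR : K ⊆ D.region) {a b : Pt}
    (ha : a ∈ K) (hb : b ∈ K) : D.Visible a b :=
  (hK.segment_subset ha hb).trans hR

/-- A small sector at `x` between the directions to `b` and to `y` is contained in the domain. -/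
def SectorFree (D : PolygonalDomain) (x b y : Pt) : Prop :=
  ∃ ε : ℝ, 0 < ε ∧ tri x (x + ε • (b - x)) (x + ε • (y - x)) ⊆ D.region

lemma sectorFree_of_not_vertex {x b y : Pt} (hx : x ∉ D.vertices) (hb : D.Visible x b)
    (hy : D.Visible x y) : SectorFree D x b y := by
  obtain ⟨r, hr, hc⟩ := D.exists_ball_convex hb.left_mem hx
  obtain ⟨ε₁, h₁, hb₁⟩ := exists_move_mem_ball x (b - x) hr
  obtain ⟨ε₂, h₂, hb₂⟩ := exists_move_mem_ball x (y - x) hr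
  have hε : 0 < min (min ε₁ ε₂) 1 := by positivity
  have hl1 : min (min ε₁ ε₂) 1 ≤ ε₁ := (min_le_left _ _).trans (min_le_left _ _)
  have hl2 : min (min ε₁ ε₂) 1 ≤ ε₂ := (min_le_left _ _).trans (min_le_right _ _)
  refine ⟨min (min ε₁ ε₂) 1, hε, (tri_subset hc ⟨Metric.mem_ball_self hr, hb.left_mem⟩
    ⟨hb₁ _ ?_, hb ?_⟩ ⟨hb₂ _ ?_, hy ?_⟩).trans Set.inter_subset_right⟩
  · rwa [abs_of_pos hε]
  · exact mem_segment_of_eq hε.le (min_le_right _ _) rfl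
  · rwa [abs_of_pos hε]
  · exact mem_segment_of_eq hε.le (min_le_right _ _) rfl

/-- Sweeping a triangle by segments from a corner `b` until a polygon vertex is met. -/
lemma exists_sweep {b x y : Pt} (hbx : D.Visible b x) (hxy : D.Visible x y)
    (hsec : SectorFree D x b y) :
    ∃ t ∈ Icc (0 : ℝ) 1, tri b x (x + t • (y - x)) ⊆ D.region ∧
      (t = 1 ∨ ∃ s : ℝ, 0 < s ∧ s ≤ 1 ∧ (s, t) ≠ ((1, 0) : Pt) ∧
        b + s • (x + t • (y - x) - b) ∈ D.vertices) := by
  -- The affine map with `0 ↦ b`, `(1, 0) ↦ x`, `(1, 1) ↦ y` turns the sweep of the unit triangle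
  -- into a sweep by segments from `b`. It may be degenerate, which does no harm because only
  -- preimages are used.
  set f : Pt → Pt := fun p => b + p.1 • (x - b) + p.2 • (y - x) with hf
  have hcont : Continuous f := by fun_prop
  have haff : ∀ (p q : Pt) (u v : ℝ), u + v = 1 → f (u • p + v • q) = u • f p + v • f q := by
    intro p q u v huv
    obtain rfl : v = 1 - u := by linarith
    simp only [hf, Prod.fst_add, Prod.smul_fst, Prod.snd_add, Prod.smul_snd, smul_eq_mul]
    module
  have hf0 : f 0 = b := by simp [hf]
  obtain ⟨t, ht, hfree, hor⟩ := exists_slope_eq_one_or_bad (F := f ⁻¹' D.region)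
    (bad := f ⁻¹' D.vertices) (D.isClosed_region.preimage hcont) (by
      intro z hz hv
      obtain ⟨r, hr, hc⟩ := D.exists_ball_convex hz hv
      refine ⟨f ⁻¹' Metric.ball (f z) r, hcont.continuousAt.preimage_mem_nhds
        (Metric.ball_mem_nhds _ hr), ?_⟩
      rw [← Set.preimage_inter]
      intro p hp q hq u v hu hv huv
      change f _ ∈ Metric.ball (f z) r ∩ D.region
      rw [haff _ _ _ _ huv]
      exact hc hp hq hu hv huv) (by
      obtain ⟨r, hr, hs⟩ := D.exists_ball_star b
      have := hcont.continuousAt.preimage_mem_nhds (x := 0) (t := Metric.ball b r)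
        (by rw [hf0]; exact Metric.ball_mem_nhds _ hr)
      filter_upwards [this] with z hz hzr
      rintro _ ⟨u, v, hu, hv, huv, rfl⟩
      change f _ ∈ D.region
      rw [haff _ _ _ _ huv, hf0]
      exact hs _ hzr hz ⟨u, v, hu, hv, huv, rfl⟩) (by
      intro s hs
      refine hbx (mem_segment_of_eq hs.1 hs.2 ?_)
      simp [hf]) (by
      intro t ht
      refine hxy (mem_segment_of_eq ht.1 ht.2 ?_)
      simp [hf]) (by
      obtain ⟨ε, hε, hs⟩ := hsec
      -- Seen from `x`, the point `f (s, w)` has coordinate `1 - s` towards `b` and `w` towards `y`;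
      -- both are at most `ε / 2`, so it lies in the sector of size `ε`.
      refine ⟨ε / 2, by positivity, fun s w h1 h2 h3 h4 => hs
        ⟨(1 - s + w) / ε, w / ε, by positivity, by gcongr; linarith,
          by rw [div_le_one hε]; linarith, ?_⟩⟩
      simp only [hf]
      ext <;> simp <;> field_simp <;> ring)
  refine ⟨t, ht, ?_, hor.imp_right ?_⟩
  · rintro _ ⟨s, w, h1, h2, h3, rfl⟩
    rcases (h1.trans h2).eq_or_lt with h0 | h0
    · obtain rfl : w = 0 := by linarith
      have := hfree t ⟨ht.1, le_rfl⟩ 0 ⟨le_rfl, zero_le_one⟩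
      simpa [hf, ← h0] using this
    · have := hfree (w / s * t) ⟨by have := ht.1; positivity,
        mul_le_of_le_one_left ht.1 ((div_le_one h0).2 h2)⟩ s ⟨h0.le, h3⟩
      have h' : s * (w / s * t) = w * t := by field_simp
      simp only [hf, mem_preimage, h'] at this
      convert this using 1
      module
  · rintro ⟨s, h1, h2, h3, h4⟩
    refine ⟨s, h1, h2, h3, ?_⟩
    simp only [hf, mem_preimage] at h4
    convert h4 using 1
    module

end PolygonalDomain

/-! ### Shortening paths to chains of visible vertices -/

open PolygonalDomain

/-- `Chain D a b L`: there is a path of length `L` from `a` to `b` in the domain with all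
intermediate points at polygon vertices. -/
inductive Chain (D : PolygonalDomain) : Pt → Pt → ℝ → Prop
  | single {a b : Pt} : D.Visible a b → Chain D a b (l1Dist a b)
  | cons {a v c : Pt} {L : ℝ} : D.Visible a v → v ∈ D.vertices → Chain D v c L →
      Chain D a c (l1Dist a v + L)

lemma Chain.append {D : PolygonalDomain} {a v c : Pt} {L L' : ℝ} (h : Chain D a v L)
    (hv : v ∈ D.vertices) (h' : Chain D v c L') : Chain D a c (L + L') := by
  induction h with
  | single h => exact Chain.cons h hv h'
  | cons h1 h2 _ ih =>
    rw [add_assoc]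
    exact Chain.cons h1 h2 (ih hv h')

/-- The hypothesis is the vanishing of a cross product. The point `b` need not lie between `a` and
`c`: if it is outside, one of the two segments already covers `ac`. -/
lemma segment_subset_union_of_collinear {a b c : Pt}
    (h : (b.1 - a.1) * (c.2 - b.2) - (b.2 - a.2) * (c.1 - b.1) = 0) :
    segment ℝ a c ⊆ segment ℝ a b ∪ segment ℝ b c := by
  by_cases hac : a = c
  · subst hac
    rw [segment_same]
    exact (Set.singleton_subset_iff.2 (left_mem_segment ℝ a b)).trans Set.subset_union_left
  have : ∃ k : ℝ, b = a + k • (c - a) := by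
    by_cases hx : c.1 - a.1 = 0
    · have hy : c.2 - a.2 ≠ 0 := fun hy => hac (by ext <;> linarith)
      refine ⟨(b.2 - a.2) / (c.2 - a.2), ?_⟩
      have : b.1 - a.1 = 0 := by
        have : (b.1 - a.1) * (c.2 - a.2) = 0 := by linear_combination h + (b.2 - a.2) * hx
        exact (mul_eq_zero.1 this).resolve_right hy
      ext
      · simp [hx]; linarith
      · simp [hy]
    · refine ⟨(b.1 - a.1) / (c.1 - a.1), ?_⟩
      ext
      · simp [hx]
      · simp only [Prod.snd_add, Prod.smul_snd, Prod.snd_sub, smul_eq_mul]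
        field_simp
        linear_combination -h
  obtain ⟨k, rfl⟩ := this
  intro z hz
  obtain ⟨t, h0, h1, rfl⟩ := exists_of_mem_segment hz
  rcases le_or_gt t k with htk | htk
  · left
    rcases h0.eq_or_lt with h | h
    · subst h
      simpa using left_mem_segment ℝ a _
    · refine mem_segment_of_eq (t := t / k) (div_nonneg h0 (by linarith)) ((div_le_one (by linarith)).2 htk) ?_
      have : k ≠ 0 := by linarith
      ext <;> simp <;> field_simp
  · right
    have : 1 - k ≠ 0 := by linarith
    refine mem_segment_of_eq (t := (t - k) / (1 - k)) (div_nonneg (by linarith) (by linarith))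
      ((div_le_one (by linarith)).2 (by linarith)) ?_
    ext <;> simp <;> field_simp <;> ring

/-- The two sides of a triangle can be replaced by a chain of visible vertices that is not longer. -/
lemma exists_chain_of_visible (D : PolygonalDomain) : ∀ (k : ℕ) (a b c : Pt),
    ((D.vertices ∩ tri a b c) \ {a}).ncard = k → D.Visible a b → D.Visible b c →
      ∃ L ≤ l1Dist a b + l1Dist b c, Chain D a c L := by
  intro k
  induction k using Nat.strong_induction_on with
  | _ k ih =>
  intro a b c hk hab hbc
  have hdirect : D.Visible a c → ∃ L ≤ l1Dist a b + l1Dist b c, Chain D a c L := fun h =>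
    ⟨_, l1Dist_triangle a b c, Chain.single h⟩
  by_cases hb : b ∈ D.vertices
  · exact ⟨_, le_rfl, Chain.cons hab hb (Chain.single hbc)⟩
  by_cases hcol : (b.1 - a.1) * (c.2 - b.2) - (b.2 - a.2) * (c.1 - b.1) = 0
  · exact hdirect ((segment_subset_union_of_collinear hcol).trans (Set.union_subset hab hbc))
  obtain ⟨t, ht, hfree, h | ⟨s, hs0, hs1, -, hv⟩⟩ :=
    exists_sweep hab hbc (sectorFree_of_not_vertex hb hab.symm hbc)
  · subst h
    rw [one_smul, add_sub_cancel] at hfree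
    exact hdirect (visible_of_convex (convex_tri a b c) hfree (mem_tri_left _ _ _)
      (mem_tri_right _ _ _))
  -- The sweep about `a` stops at the first vertex `v`, on the segment `ax`. It remains to shorten
  -- the path `v, x, c`, whose triangle contains fewer vertices.
  set x := b + t • (c - b) with hx
  set v := a + s • (x - a) with hvdef
  have hxbc : x ∈ segment ℝ b c := mem_segment_of_eq ht.1 ht.2 rfl
  have hvax : v ∈ segment ℝ a x := mem_segment_of_eq hs0.le hs1 rfl
  have hax : D.Visible a x := visible_of_convex (convex_tri a b x) hfree (mem_tri_left _ _ _)
      (mem_tri_right _ _ _)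
  have hvx : D.Visible v x := hax.mono hvax (right_mem_segment ℝ _ _)
  have hxc : D.Visible x c := hbc.mono hxbc (right_mem_segment ℝ _ _)
  have hxT : x ∈ tri a b c :=
    (convex_tri a b c).segment_subset (mem_tri_middle _ _ _) (mem_tri_right _ _ _) hxbc
  have hvT : v ∈ tri a b c := (convex_tri a b c).segment_subset (mem_tri_left _ _ _) hxT hvax
  have haT : a ∉ tri v x c := by
    rintro ⟨s', w', h1, h2, h3, h4⟩
    have e1 := congrArg Prod.fst h4
    have e2 := congrArg Prod.snd h4
    simp only [hvdef, hx, Prod.fst_add, Prod.snd_add, Prod.smul_fst, Prod.smul_snd, Prod.fst_sub,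
      Prod.snd_sub, smul_eq_mul] at e1 e2
    have : (s + s' * (1 - s)) *
        ((b.1 - a.1) * (c.2 - b.2) - (b.2 - a.2) * (c.1 - b.1)) = 0 := by
      linear_combination (c.1 - b.1) * e2 - (c.2 - b.2) * e1
    rcases mul_eq_zero.1 this with h | h
    · have : 0 ≤ s' * (1 - s) := mul_nonneg (h1.trans h2) (by linarith)
      linarith
    · exact hcol h
  have hva : v ≠ a := by
    intro h
    exact haT (h ▸ mem_tri_left v x c)
  -- The count excludes the first corner. The new triangle omits `a`, and `v`, which was counted
  -- before, is now the excluded corner.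
  have hlt : ((D.vertices ∩ tri v x c) \ {v}).ncard < k := by
    rw [← hk]
    refine Set.ncard_lt_ncard ⟨?_, ?_⟩ (D.vertices_finite.subset fun z hz => hz.1.1)
    · rintro z ⟨⟨hz1, hz2⟩, -⟩
      refine ⟨⟨hz1, tri_subset (convex_tri a b c) hvT hxT (mem_tri_right _ _ _) hz2⟩, ?_⟩
      rintro rfl
      exact haT hz2
    · intro hsub
      exact (hsub ⟨⟨hv, hvT⟩, hva⟩).2 rfl
  obtain ⟨L, hL, hch⟩ := ih _ hlt v x c rfl hvx hxc
  refine ⟨_, ?_, Chain.cons (hax.mono (left_mem_segment ℝ _ _) hvax) hv hch⟩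
  have := l1Dist_add_of_mem_segment hxbc
  have := l1Dist_add_of_mem_segment hvax
  have := l1Dist_triangle a b x
  linarith

/-- Only the first turning point `b` may fail to be a vertex; shortening the first two segments
removes it and leaves the rest of the chain untouched. -/
lemma Chain.cons_point {D : PolygonalDomain} {a b c : Pt} {L : ℝ} (hab : D.Visible a b)
    (h : Chain D b c L) : ∃ L' ≤ l1Dist a b + L, Chain D a c L' := by
  cases h with
  | single h => exact exists_chain_of_visible D _ a b c rfl hab h
  | cons h hv h' =>
    obtain ⟨L₁, hL, hch⟩ := exists_chain_of_visible D _ a b _ rfl hab h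
    exact ⟨_, by linarith, hch.append hv h'⟩

/-- Every path in the domain can be replaced by a chain of visible vertices that is not longer. -/
lemma exists_chain_of_isPathIn {D : PolygonalDomain} {p q : Pt} {l : List Pt}
    (h : IsPathIn D p q l) : ∃ L ≤ l1Length l, Chain D p q L := by
  induction l generalizing p with
  | nil => simp [IsPathIn] at h
  | cons a l ih =>
    obtain ⟨h1, h2, h3, h4⟩ := h
    obtain rfl : a = p := by simpa using h1
    cases l with
    | nil =>
      obtain rfl : a = q := by simpa using h2
      refine ⟨l1Dist a a, by simp [l1Length, l1Dist_self], Chain.single (visible_self ?_)⟩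
      exact h3 a (by simp)
    | cons b l =>
      rw [List.isChain_cons_cons] at h4
      obtain ⟨L, hL, hch⟩ := ih (p := b) ⟨rfl, by simpa using h2,
        fun z hz => h3 z (List.mem_cons_of_mem _ hz), h4.2⟩
      obtain ⟨L', hL', hch'⟩ := hch.cons_point h4.1
      exact ⟨L', by simp only [l1Length]; linarith, hch'⟩

end L1Domain

/-! ### Directions of escape and sweeping along an edge -/

namespace L1Domain
open Set Filter Topology
namespace PolygonalDomain

variable {D : PolygonalDomain}

lemma Visible.trans_of_mem {a m v : Pt} (h : D.Visible a m) (h' : D.Visible m v)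
    (hm : m ∈ segment ℝ a v) : D.Visible a v := by
  obtain ⟨t, -, -, rfl⟩ := exists_of_mem_segment hm
  refine (segment_subset_union_of_collinear ?_).trans (Set.union_subset h h')
  simp only [Prod.fst_add, Prod.snd_add, Prod.smul_fst, Prod.smul_snd, Prod.fst_sub,
    Prod.snd_sub, smul_eq_mul]
  ring

/-- One can move from `z` a little in the direction `g` without leaving the domain. -/
def Moves (D : PolygonalDomain) (z g : Pt) : Prop :=
  ∃ η : ℝ, 0 < η ∧ ∀ η' ∈ Icc 0 η, z + η' • g ∈ D.region

lemma Moves.smul {z g : Pt} (h : Moves D z g) {k : ℝ} (hk : 0 < k) : Moves D z (k • g) := by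
  obtain ⟨η, hη, h⟩ := h
  refine ⟨η / k, by positivity, fun η' hη' => ?_⟩
  rw [smul_smul]
  exact h _ ⟨mul_nonneg hη'.1 hk.le, by rw [← le_div_iff₀ hk]; exact hη'.2⟩

lemma moves_of_visible {z w : Pt} (h : D.Visible z w) : Moves D z (w - z) :=
  ⟨1, one_pos, fun _ ht => h (mem_segment_of_eq ht.1 ht.2 rfl)⟩

lemma moves_of_visible_smul {z g : Pt} {k : ℝ} (hk : 0 < k) (h : D.Visible z (z + k • g)) :
    Moves D z g := by
  have := (moves_of_visible h).smul (inv_pos.2 hk)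
  rwa [add_sub_cancel_left, smul_smul, inv_mul_cancel₀ hk.ne', one_smul] at this

/-- The move by `g + g'` is the midpoint of the moves by `2g` and `2g'`, and the domain is locally
convex away from its vertices. -/
lemma Moves.add {z g g' : Pt} (hz : z ∈ D.region) (hv : z ∉ D.vertices) (h : Moves D z g)
    (h' : Moves D z g') : Moves D z (g + g') := by
  obtain ⟨r, hr, hc⟩ := D.exists_ball_convex hz hv
  obtain ⟨η, hη, h⟩ := h
  obtain ⟨η', hη', h'⟩ := h'
  obtain ⟨ε, hε, hb⟩ := exists_move_mem_ball z g hr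
  obtain ⟨ε', hε', hb'⟩ := exists_move_mem_ball z g' hr
  refine ⟨min (min η ε) (min η' ε') / 2, by positivity, fun t ht => ?_⟩
  have h1 := min_le_left (min η ε) (min η' ε')
  have h2 := min_le_right (min η ε) (min η' ε')
  have h3 := min_le_left η ε
  have h4 := min_le_right η ε
  have h5 := min_le_left η' ε'
  have h6 := min_le_right η' ε'
  have h7 : |2 * t| = 2 * t := abs_of_nonneg (by linarith [ht.1])
  have hm : z + (2 * t) • g ∈ Metric.ball z r ∩ D.region :=
    ⟨hb _ (by rw [h7]; linarith [ht.2]), h _ ⟨by linarith [ht.1], by linarith [ht.2]⟩⟩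
  have hm' : z + (2 * t) • g' ∈ Metric.ball z r ∩ D.region :=
    ⟨hb' _ (by rw [h7]; linarith [ht.2]), h' _ ⟨by linarith [ht.1], by linarith [ht.2]⟩⟩
  have := (hc hm hm' (a := 1 / 2) (b := 1 / 2) (by norm_num) (by norm_num) (by norm_num)).2
  convert this using 1
  module

/-- The farthest point of a segment that can be reached from its start within the domain. -/
lemma exists_farthest (z g : Pt) (hz : z ∈ D.region) :
    ∃ σ ∈ Icc (0 : ℝ) 1, (∀ σ' ∈ Icc 0 σ, z + σ' • g ∈ D.region) ∧
      (σ = 1 ∨ ¬ Moves D (z + σ • g) g) := by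
  -- Freeness of the whole initial part is expressed through the factors `l`, which makes `S`
  -- compact, so that it has a greatest element.
  set S : Set ℝ := {σ | σ ∈ Icc (0 : ℝ) 1 ∧ ∀ l ∈ Icc (0 : ℝ) 1, z + (l * σ) • g ∈ D.region} with hS
  have hSc : IsCompact S := by
    have : S = Icc 0 1 ∩ ⋂ l ∈ Icc (0 : ℝ) 1, (fun σ : ℝ => z + (l * σ) • g) ⁻¹' D.region := by
      ext; simp [hS]
    rw [this]
    refine isCompact_Icc.inter_right (isClosed_biInter fun l _ => ?_)
    exact D.isClosed_region.preimage (by fun_prop)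
  obtain ⟨σ, hσ, hmax⟩ := hSc.exists_isGreatest ⟨0, by simp, by simpa using fun _ _ _ => hz⟩
  have hfree : ∀ σ' ∈ Icc 0 σ, z + σ' • g ∈ D.region := by
    intro σ' hσ'
    rcases hσ.1.1.eq_or_lt with h | h
    · obtain rfl : σ' = 0 := le_antisymm (h ▸ hσ'.2) hσ'.1
      simpa using hz
    · have := hσ.2 (σ' / σ) ⟨div_nonneg hσ'.1 h.le, (div_le_one h).2 hσ'.2⟩
      rwa [div_mul_cancel₀ _ h.ne'] at this
  refine ⟨σ, hσ.1, hfree, ?_⟩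
  by_contra! hcon
  obtain ⟨hne, η, hη, hm⟩ := hcon
  have hlt : σ < 1 := lt_of_le_of_ne hσ.1.2 hne
  have h0 : 0 < min η (1 - σ) := lt_min hη (by linarith)
  have h1 := min_le_left η (1 - σ)
  have h2 := min_le_right η (1 - σ)
  have : σ + min η (1 - σ) ∈ S := by
    have hnn : 0 ≤ σ + min η (1 - σ) := by linarith [hσ.1.1]
    refine ⟨⟨hnn, by linarith⟩, fun l hl => ?_⟩
    have hle := mul_le_of_le_one_left hnn hl.2
    rcases le_total (l * (σ + min η (1 - σ))) σ with h | h
    · exact hfree _ ⟨mul_nonneg hl.1 hnn, h⟩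
    · have := hm (l * (σ + min η (1 - σ)) - σ) ⟨by linarith, by linarith⟩
      convert this using 1
      module
  have := hmax this
  linarith

/-- At an inner point of an edge one can move along the edge. -/
lemma moves_along_edge {A B : Pt} (he : segment ℝ A B ⊆ D.region) {τ : ℝ} (hτ : τ ∈ Ioo (0 : ℝ) 1)
    (k : ℝ) : Moves D (A + τ • (B - A)) (k • (B - A)) := by
  have h0 : 0 < min τ (1 - τ) := lt_min hτ.1 (by linarith [hτ.2])
  refine ⟨min τ (1 - τ) / (|k| + 1), by positivity, fun η hη => he ?_⟩
  have h1 : η * (|k| + 1) ≤ min τ (1 - τ) := by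
    rw [← le_div_iff₀ (by positivity)]; exact hη.2
  have h2 : |η * k| ≤ min τ (1 - τ) := by
    rw [abs_mul, abs_of_nonneg hη.1]; linarith [hη.1]
  obtain ⟨h3, h4⟩ := abs_le.1 h2
  have h5 := min_le_left τ (1 - τ)
  have h6 := min_le_right τ (1 - τ)
  refine mem_segment_of_eq (t := τ + η * k) (by linarith) (by linarith) ?_
  module

/-- The directions of escape from the inner points of an edge are all the same. -/
lemma Moves.along_edge {A B : Pt} (he : segment ℝ A B ⊆ D.region)
    (hv : ∀ τ ∈ Ioo (0 : ℝ) 1, A + τ • (B - A) ∉ D.vertices) {g : Pt} {τ τ' : ℝ}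
    (hτ : τ ∈ Ioo (0 : ℝ) 1) (hτ' : τ' ∈ Ioo (0 : ℝ) 1) (h : Moves D (A + τ • (B - A)) g) :
    Moves D (A + τ' • (B - A)) g := by
  have hreg : ∀ τ ∈ Ioo (0 : ℝ) 1, A + τ • (B - A) ∈ D.region := fun τ hτ =>
    he (mem_segment_of_eq hτ.1.le hτ.2.le rfl)
  -- Local convexity makes the set of escape directions locally constant along the open edge;
  -- connectedness of the open interval then makes it constant.
  have key : ∀ τ ∈ Ioo (0 : ℝ) 1, ∃ δ > (0 : ℝ), ∀ τ₁ τ₂, |τ₁ - τ| < δ → |τ₂ - τ| < δ →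
      Moves D (A + τ₁ • (B - A)) g → Moves D (A + τ₂ • (B - A)) g := by
    intro τ hτ
    obtain ⟨r, hr, hc⟩ := D.exists_ball_convex (hreg τ hτ) (hv τ hτ)
    obtain ⟨ε, hε, hb⟩ := exists_move_mem_ball (A + τ • (B - A)) (B - A) hr
    have h0 : 0 < min τ (1 - τ) := lt_min hτ.1 (by linarith [hτ.2])
    have hK : ∀ τ', |τ' - τ| < min ε (min τ (1 - τ)) →
        A + τ' • (B - A) ∈ Metric.ball (A + τ • (B - A)) r ∩ D.region := by
      intro τ' h'
      have h1 := min_le_left ε (min τ (1 - τ))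
      have h2 := min_le_right ε (min τ (1 - τ))
      have h3 := min_le_left τ (1 - τ)
      have h4 := min_le_right τ (1 - τ)
      obtain ⟨h5, h6⟩ := abs_lt.1 h'
      refine ⟨?_, hreg _ ⟨by linarith, by linarith⟩⟩
      convert hb (τ' - τ) (by linarith) using 1
      module
    refine ⟨min ε (min τ (1 - τ)) / 3, by positivity, fun τ₁ τ₂ h₁ h₂ hm => ?_⟩
    have hpos : 0 < min ε (min τ (1 - τ)) := by positivity
    obtain ⟨h5, h6⟩ := abs_lt.1 h₁
    obtain ⟨h7, h8⟩ := abs_lt.1 h₂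
    have k1 := hK τ₁ (by linarith)
    -- The mirror image of `τ₁` in `τ₂`: the point at `τ₂` is then the midpoint of two points of the
    -- convex neighbourhood. The factor 1/3 in the radius keeps this mirror image inside.
    have k3 := hK (2 * τ₂ - τ₁) (by rw [abs_lt]; constructor <;> linarith)
    obtain ⟨η, hη, hm⟩ := hm
    obtain ⟨r', hr', hsub⟩ := Metric.isOpen_iff.1 Metric.isOpen_ball _ k1.1
    obtain ⟨ε', hε', hb'⟩ := exists_move_mem_ball (A + τ₁ • (B - A)) g hr'
    have hη' : 0 < min η ε' := by positivity
    have k2 : A + τ₁ • (B - A) + (min η ε') • g ∈ Metric.ball (A + τ • (B - A)) r ∩ D.region :=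
      ⟨hsub (hb' _ (by rw [abs_of_pos hη']; exact min_le_right _ _)),
        hm _ ⟨hη'.le, min_le_left _ _⟩⟩
    refine ⟨min η ε' / 2, by positivity, fun t ht => ?_⟩
    have := (convex_comb_three hc k1 k3 k2 (a := 1 / 2 - t / min η ε') (b := 1 / 2)
      (c := t / min η ε') (by rw [sub_nonneg, div_le_iff₀ hη']; linarith [ht.2]) (by norm_num)
      (div_nonneg ht.1 hη'.le) (by ring)).2
    convert this using 1
    ext <;> simp <;> field_simp <;> ring
  have := (isPreconnected_Ioo (a := (0 : ℝ)) (b := 1)).induction₂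
    (fun τ τ' => Moves D (A + τ • (B - A)) g ↔ Moves D (A + τ' • (B - A)) g) (by
      intro τ hτ
      obtain ⟨δ, hδ, hk⟩ := key τ hτ
      filter_upwards [nhdsWithin_le_nhds (Metric.ball_mem_nhds τ hδ)] with τ' hτ'
      rw [Metric.mem_ball, Real.dist_eq] at hτ'
      exact ⟨hk τ τ' (by simpa using hδ) hτ', hk τ' τ hτ' (by simpa using hδ)⟩)
    (fun _ _ _ _ _ _ => Iff.trans) (fun _ _ _ _ => Iff.symm) hτ hτ'
  exact this.1 h

lemma exists_edge_of_not_moves {z g : Pt} (hz : z ∈ D.region) (h : ¬ Moves D z g) :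
    ∃ e ∈ D.edges, z ∈ e := by
  by_contra! hcon
  obtain ⟨r, hr, hb⟩ := D.exists_ball_subset_of_not_edge hz hcon
  obtain ⟨ε, hε, hm⟩ := exists_move_mem_ball z g hr
  exact h ⟨ε, hε, fun t ht => hb (hm t (by rw [abs_of_nonneg ht.1]; exact ht.2))⟩

lemma convex_edge {e : Set Pt} (he : e ∈ D.edges) : Convex ℝ e := by
  obtain ⟨A, B, -, -, -, rfl, -⟩ := D.exists_edge_eq_segment he
  exact convex_segment _ _

/-- Links the local obstruction `¬ Moves` with the definition by longest segments: seeing a point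
beyond `q` would allow a move from `q` in direction `d`. -/
lemma isProjDir_of_not_moves {d p q : Pt} {t : ℝ} (ht : 0 ≤ t) (hq : q = p + t • d)
    (hv : D.Visible p q) (hm : ¬ Moves D q d) : D.IsProjDir d p q := by
  refine ⟨t, ht, hq, hv, fun s hs h => hm ⟨s - t, by linarith, fun η hη => ?_⟩⟩
  have hs0 : 0 < s := by linarith
  refine h (mem_segment_of_eq (t := (t + η) / s) (div_nonneg (by linarith [hη.1]) hs0.le)
    ((div_le_one hs0).2 (by linarith [hη.2])) ?_)
  rw [hq, add_sub_cancel_left, smul_smul, div_mul_cancel₀ _ hs0.ne']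
  module

lemma isHorizProj_of_not_moves {p q g : Pt} {t : ℝ} (ht : 0 ≤ t) (hq : q = p + t • g)
    (hg : g.2 = 0) (hg1 : g.1 ≠ 0) (hv : D.Visible p q) (hm : ¬ Moves D q g) :
    D.IsHorizProj p q := by
  rcases hg1.lt_or_gt with h | h
  · have hg' : g = (-g.1) • ((-1, 0) : Pt) := by ext <;> simp [hg]
    refine Or.inr (isProjDir_of_not_moves (t := t * -g.1) (by nlinarith) ?_ hv fun h' => hm ?_)
    · rw [hq, mul_smul, ← hg']
    · rw [hg']; exact h'.smul (by linarith)
  · have hg' : g = g.1 • ((1, 0) : Pt) := by ext <;> simp [hg]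
    refine Or.inl (isProjDir_of_not_moves (t := t * g.1) (by positivity) ?_ hv fun h' => hm ?_)
    · rw [hq, mul_smul, ← hg']
    · rw [hg']; exact h'.smul h

lemma isVertProj_of_not_moves {p q g : Pt} {t : ℝ} (ht : 0 ≤ t) (hq : q = p + t • g)
    (hg : g.1 = 0) (hg1 : g.2 ≠ 0) (hv : D.Visible p q) (hm : ¬ Moves D q g) :
    D.IsVertProj p q := by
  rcases hg1.lt_or_gt with h | h
  · have hg' : g = (-g.2) • ((0, -1) : Pt) := by ext <;> simp [hg]
    refine Or.inr (isProjDir_of_not_moves (t := t * -g.2) (by nlinarith) ?_ hv fun h' => hm ?_)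
    · rw [hq, mul_smul, ← hg']
    · rw [hg']; exact h'.smul (by linarith)
  · have hg' : g = g.2 • ((0, 1) : Pt) := by ext <;> simp [hg]
    refine Or.inl (isProjDir_of_not_moves (t := t * g.2) (by positivity) ?_ hv fun h' => hm ?_)
    · rw [hq, mul_smul, ← hg']
    · rw [hg']; exact h'.smul h

lemma SectorFree.mono {x b y y' : Pt} (h : SectorFree D x b y) {θ : ℝ} (hθ : 0 ≤ θ) (hθ1 : θ ≤ 1)
    (hy : y' = x + θ • (y - x)) : SectorFree D x b y' := by
  obtain ⟨ε, hε, h⟩ := h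
  refine ⟨ε, hε, (tri_subset (convex_tri _ _ _) (mem_tri_left _ _ _) (mem_tri_middle _ _ _)
    ?_).trans h⟩
  refine (convex_tri _ _ _).segment_subset (mem_tri_left _ _ _) (mem_tri_right _ _ _)
    (mem_segment_of_eq hθ hθ1 ?_)
  rw [hy]
  module

/-- A sector depends only on the two directions; stretching the second one is compensated by a
smaller size `ε * θ`. -/
lemma SectorFree.extend {x b y y' : Pt} (h : SectorFree D x b y') {θ : ℝ} (hθ : 0 < θ) (hθ1 : θ ≤ 1)
    (hy : y' = x + θ • (y - x)) : SectorFree D x b y := by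
  obtain ⟨ε, hε, h⟩ := h
  refine ⟨ε * θ, by positivity, (tri_subset (convex_tri _ _ _) (mem_tri_left _ _ _) ?_ ?_).trans h⟩
  · refine (convex_tri _ _ _).segment_subset (mem_tri_left _ _ _) (mem_tri_middle _ _ _)
      (mem_segment_of_eq hθ.le hθ1 ?_)
    module
  · convert mem_tri_right x (x + ε • (b - x)) (x + ε • (y' - x)) using 1
    rw [hy]
    module

lemma tri_subset_of_visible {a x y : Pt} (h : ∀ p ∈ segment ℝ x y, D.Visible a p) :
    tri a x y ⊆ D.region := by
  rintro _ ⟨s, w, h1, h2, h3, rfl⟩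
  rcases (h1.trans h2).eq_or_lt with h0 | h0
  · obtain rfl : w = 0 := by linarith
    simpa [← h0] using (h x (left_mem_segment ℝ _ _)).left_mem
  · refine h (x + (w / s) • (y - x)) (mem_segment_of_eq (div_nonneg h1 h0.le)
      ((div_le_one h0).2 h2) rfl) (mem_segment_of_eq h0.le h3 ?_)
    ext <;> simp <;> field_simp <;> ring

/-- Sweeping from a point `o` on an edge `e` along this edge towards a point `x` at the height of
`b`, with the exterior of the domain behind the edge. -/
lemma edge_sweep {b c o x y : Pt} {e : Set Pt} (he : e ∈ D.edges) (ho : o ∈ e) {κ : ℝ}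
    (hκ : 0 < κ) (hκe : o + κ • (x - o) ∈ e) (hbo : D.Visible b o) (hsec : SectorFree D o b x)
    (hxb : x.2 = b.2) (hob : o.2 ≠ b.2) (hy : y ∈ e) (hyv : y ∉ D.vertices) {α β : ℝ} (hβ : 0 < β)
    (hym : ¬ Moves D y (α • (x - o) + β • (c - b))) :
    (∃ v ∈ D.vertices, v ≠ b ∧ v ≠ o ∧ tri b o v ⊆ D.region ∧ v ∈ tri b o x) ∨
      (x ∈ e ∧ D.Visible b x ∧ (x = b ∨ ¬ Moves D x (c - b))) := by
  have hereg := D.edge_subset_region he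
  have hecon := convex_edge he
  obtain ⟨A, B, hA, hB, hAB, hee, hAonly⟩ := D.exists_edge_eq_segment he
  have hxo : x ≠ o := fun h => hob (by rw [← h, hxb])
  -- Let `w` be the point where the way along `e` from `o` towards `x` ends: it is `x` itself, or an
  -- end point of the edge, hence a vertex, strictly before `x`.
  have hw : ∃ θ : ℝ, 0 < θ ∧ θ ≤ 1 ∧ o + θ • (x - o) ∈ e ∧
      (θ = 1 ∨ (θ < 1 ∧ o + θ • (x - o) ∈ D.vertices)) := by
    by_cases hxe : x ∈ e
    · exact ⟨1, one_pos, le_rfl, by simpa using hxe, Or.inl rfl⟩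
    rw [hee] at ho hκe hxe
    obtain ⟨τ, hτ0, hτ1, hoτ⟩ := exists_of_mem_segment ho
    obtain ⟨τ', hτ0', hτ1', hoτ'⟩ := exists_of_mem_segment hκe
    have hxo' : x - o = ((τ' - τ) / κ) • (B - A) := by
      have : κ • (x - o) = (τ' - τ) • (B - A) := by
        have h1 : κ • (x - o) = (A + τ' • (B - A)) - o := by rw [← hoτ']; abel
        rw [h1, hoτ]; module
      rw [div_eq_inv_mul, mul_smul, ← this, smul_smul, inv_mul_cancel₀ hκ.ne', one_smul]
    set k := (τ' - τ) / κ with hk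
    have hkκ : κ * k = τ' - τ := by rw [hk]; field_simp
    have hxA : x = A + (τ + k) • (B - A) := by
      have : x = o + (x - o) := by abel
      rw [this, hxo', hoτ]; module
    have hnot : ¬ (0 ≤ τ + k ∧ τ + k ≤ 1) := fun h => hxe (mem_segment_of_eq h.1 h.2 hxA)
    by_cases h0 : 0 ≤ τ + k
    · have h1 : 1 < τ + k := not_le.1 fun h => hnot ⟨h0, h⟩
      have hk0 : 0 < k := by linarith
      have hτlt : τ < 1 := by nlinarith
      have heq : o + ((1 - τ) / k) • (x - o) = B := by
        rw [hxo', smul_smul, div_mul_cancel₀ _ hk0.ne', hoτ]; module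
      refine ⟨(1 - τ) / k, div_pos (by linarith) hk0, (div_le_one hk0).2 (by linarith), ?_,
        Or.inr ⟨(div_lt_one hk0).2 (by linarith), ?_⟩⟩
      · rw [heq, hee]; exact right_mem_segment ℝ _ _
      · rwa [heq]
    · push Not at h0
      have hk0 : k < 0 := by linarith
      have hτlt : 0 < τ := by nlinarith
      have hk0' : 0 < -k := by linarith
      have heq : o + (τ / -k) • (x - o) = A := by
        have : τ / -k * k = -τ := by rw [div_neg, neg_mul, div_mul_cancel₀ _ hk0.ne]
        rw [hxo', smul_smul, this, hoτ]; module
      refine ⟨τ / -k, div_pos hτlt hk0', (div_le_one hk0').2 (by linarith), ?_,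
        Or.inr ⟨(div_lt_one hk0').2 (by linarith), ?_⟩⟩
      · rw [heq, hee]; exact left_mem_segment ℝ _ _
      · rwa [heq]
  obtain ⟨θ, hθ0, hθ1, hwe, hθor⟩ := hw
  set w := o + θ • (x - o) with hwdef
  have hw2 : w.2 - b.2 = (1 - θ) * (o.2 - b.2) := by
    simp only [hwdef, Prod.snd_add, Prod.smul_snd, Prod.snd_sub, smul_eq_mul, hxb]; ring
  have hob' : o.2 - b.2 ≠ 0 := sub_ne_zero.2 hob
  have hwo : w ≠ o := by
    intro h
    have h1 : θ • (x - o) = 0 := by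
      have : w - o = θ • (x - o) := by rw [hwdef]; abel
      rw [← this, h, sub_self]
    rcases smul_eq_zero.1 h1 with h2 | h2
    · exact hθ0.ne' h2
    · exact hxo (sub_eq_zero.1 h2)
  have hwT : w ∈ tri b o x := (convex_tri b o x).segment_subset (mem_tri_middle _ _ _)
    (mem_tri_right _ _ _) (mem_segment_of_eq hθ0.le hθ1 rfl)
  have hwb : θ < 1 → w ≠ b := by
    intro h h'
    rw [h', sub_self] at hw2
    exact (mul_ne_zero (by linarith) hob') hw2.symm
  by_cases hxeqb : x = b
  · rcases hθor with h | ⟨h, hwV⟩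
    · refine Or.inr ⟨?_, ?_, Or.inl hxeqb⟩
      · rw [hwdef, h, one_smul, add_sub_cancel] at hwe; exact hwe
      · rw [hxeqb]; exact visible_self hbo.left_mem
    · refine Or.inl ⟨w, hwV, hwb h, hwo, ?_, hwT⟩
      refine (tri_subset (convex_segment b o) (left_mem_segment ℝ _ _) (right_mem_segment ℝ _ _)
        ?_).trans hbo
      rw [segment_symm]
      exact mem_segment_of_eq hθ0.le hθ1 (by rw [hwdef, hxeqb])
  have how : D.Visible o w := (hecon.segment_subset ho hwe).trans hereg
  -- Sweep the triangle `b o w` about `b`. If the sweep reaches `w`, then `w` is the vertex sought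
  -- or equals `x`; otherwise it has met a vertex.
  obtain ⟨t, ht, hfree, h | ⟨s, hs0, hs1, hst, hv⟩⟩ :=
    exists_sweep hbo how (hsec.mono hθ0.le hθ1 rfl)
  · rw [h, one_smul, add_sub_cancel] at hfree
    rcases hθor with h1 | ⟨h1, hwV⟩
    · have hwx : w = x := by rw [hwdef, h1, one_smul, add_sub_cancel]
      rw [hwx] at hfree hwe
      by_cases hxV : x ∈ D.vertices
      · exact Or.inl ⟨x, hxV, hxeqb, hxo, hfree, mem_tri_right _ _ _⟩
      -- If one could move on from `x` in the direction `c - b`, then also from `y`, which is on the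
      -- same edge. Adding a move along the edge would give the blocked direction `α • (x - o) + β •
      -- (c - b)` at `y`.
      refine Or.inr ⟨hwe, visible_of_convex (convex_tri b o x) hfree (mem_tri_left _ _ _)
        (mem_tri_right _ _ _), Or.inr fun hm => hym ?_⟩
      rw [hee] at hwe hy ho
      have hin : ∀ z ∈ segment ℝ A B, z ∉ D.vertices → ∃ τ ∈ Ioo (0 : ℝ) 1, z = A + τ • (B - A) := by
        intro z hz hzV
        obtain ⟨τ, h0, h1, rfl⟩ := exists_of_mem_segment hz
        refine ⟨τ, ⟨lt_of_le_of_ne h0 fun h => hzV ?_, lt_of_le_of_ne h1 fun h => hzV ?_⟩, rfl⟩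
        · rw [← h]; simpa using hA
        · rw [h]; simpa using hB
      have hnv : ∀ τ ∈ Ioo (0 : ℝ) 1, A + τ • (B - A) ∉ D.vertices := by
        intro τ hτ hV
        have hne : B - A ≠ 0 := sub_ne_zero.2 hAB.symm
        rcases hAonly _ hV (hee ▸ mem_segment_of_eq hτ.1.le hτ.2.le rfl) with h | h
        · have : τ • (B - A) = 0 := by simpa using h
          exact (smul_eq_zero.1 this).elim hτ.1.ne' hne
        · have : (1 - τ) • (B - A) = 0 := by
            have h' : (1 - τ) • (B - A) = B - (A + τ • (B - A)) := by module
            rw [h', h, sub_self]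
          exact (smul_eq_zero.1 this).elim (fun h => by linarith [hτ.2]) hne
      obtain ⟨τx, hτx, hxτ⟩ := hin x hwe hxV
      obtain ⟨τy, hτy, hyτ⟩ := hin y hy hyv
      obtain ⟨τo, hτo0, hτo1, hoτ⟩ := exists_of_mem_segment ho
      have hABreg : segment ℝ A B ⊆ D.region := hee ▸ hereg
      have h2 : Moves D y (c - b) := by
        rw [hxτ] at hm
        rw [hyτ]
        exact Moves.along_edge hABreg hnv hτx hτy hm
      have h3 : Moves D y (α • (x - o)) := by
        have : α • (x - o) = (α * (τx - τo)) • (B - A) := by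
          rw [hxτ, hoτ]; module
        rw [this, hyτ]
        exact moves_along_edge hABreg hτy _
      exact h3.add (hABreg hy) hyv (h2.smul hβ)
    · exact Or.inl ⟨w, hwV, hwb h1, hwo, hfree, hwT⟩
  · set x' := o + t • (w - o) with hx'
    set v := b + s • (x' - b) with hvdef
    have hx'2 : x'.2 - b.2 = (1 - t * θ) * (o.2 - b.2) := by
      simp only [hx', hwdef, Prod.snd_add, Prod.smul_snd, Prod.snd_sub, smul_eq_mul, hxb]; ring
    have hv2 : v.2 - b.2 = s * ((1 - t * θ) * (o.2 - b.2)) := by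
      rw [← hx'2]; simp [hvdef]
    have hvx' : v ∈ segment ℝ b x' := mem_segment_of_eq hs0.le hs1 rfl
    -- The heights above `b` separate `v` from `b` and `o`: the height of `v` is `s * (1 - t * θ)`
    -- times that of `o`. This factor is 0 only if `x' = x`, and 1 only for `s = 1` and `t = 0`, the
    -- exempted start of the sweep.
    refine Or.inl ⟨v, hv, ?_, ?_, ?_, ?_⟩
    · intro h
      rw [h, sub_self, eq_comm] at hv2
      have h1 : t * θ = 1 := by
        rcases mul_eq_zero.1 hv2 with h1 | h1
        · exact absurd h1 hs0.ne'
        · rcases mul_eq_zero.1 h1 with h1 | h1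
          · linarith
          · exact absurd h1 hob'
      have hx'x : x' = x := by
        have : x' = o + (t * θ) • (x - o) := by rw [hx', hwdef]; module
        rw [this, h1, one_smul, add_sub_cancel]
      have : s • (x' - b) = 0 := by simpa [hvdef] using h
      rcases smul_eq_zero.1 this with h2 | h2
      · exact hs0.ne' h2
      · exact hxeqb (by rw [← hx'x]; exact sub_eq_zero.1 h2)
    · intro h
      rw [h] at hv2
      have h1 : s * (1 - t * θ) = 1 := by
        have : (s * (1 - t * θ) - 1) * (o.2 - b.2) = 0 := by linear_combination -hv2
        rcases mul_eq_zero.1 this with h2 | h2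
        · linarith
        · exact absurd h2 hob'
      have h2 : 0 ≤ t * θ := mul_nonneg ht.1 hθ0.le
      have h3 : s = 1 := by nlinarith
      have h4 : t * θ = 0 := by rw [h3] at h1; linarith
      have h5 : t = 0 := (mul_eq_zero.1 h4).resolve_right hθ0.ne'
      exact hst (by rw [h3, h5])
    · refine (tri_subset (convex_tri b o x') (mem_tri_left _ _ _) (mem_tri_middle _ _ _) ?_).trans
        hfree
      exact (convex_tri b o x').segment_subset (mem_tri_left _ _ _) (mem_tri_right _ _ _) hvx'
    · refine (convex_tri b o x).segment_subset (mem_tri_left _ _ _) ?_ hvx'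
      exact (convex_tri b o x).segment_subset (mem_tri_middle _ _ _) hwT
        (mem_segment_of_eq ht.1 ht.2 rfl)

end PolygonalDomain
end L1Domain

/-! ### The case distinction for a visible pair -/

namespace L1Domain
open Set Filter Topology
namespace PolygonalDomain

variable {D : PolygonalDomain}

/-- The edges are neither vertical nor horizontal. -/
lemma edge_slope (hD : D.GeneralPosition) {A B : Pt} (hA : A ∈ D.vertices) (hB : B ∈ D.vertices)
    (hAB : A ≠ B) : B.1 - A.1 ≠ 0 ∧ B.2 - A.2 ≠ 0 := by
  obtain ⟨h1, h2⟩ := hD A hA B hB hAB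
  exact ⟨sub_ne_zero.2 h1.symm, sub_ne_zero.2 h2.symm⟩

/-- The conclusion of the case distinction for a visible pair: an intermediate vertex. -/
def HasVertexBetween (D : PolygonalDomain) (a b : Pt) : Prop :=
  ∃ v ∈ D.vertices, v ∈ rect a b ∧ v ≠ a ∧ v ≠ b ∧ D.Visible a v ∧ D.Visible v b

/-- The conclusion of the case distinction for a visible pair: a shortest path along an edge. -/
def HasEdgeDetour (D : PolygonalDomain) (a b : Pt) : Prop :=
  ∃ a' x, ∃ e ∈ D.edges, a' ∈ e ∧ x ∈ e ∧ (a' = a ∨ D.IsVertProj a a') ∧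
    (x = b ∨ D.IsHorizProj b x) ∧ l1Dist a a' + l1Dist a' x + l1Dist x b = l1Dist a b

/-- The path `a, a', x, b` is monotone in both coordinates, because `a'` is on the side of the box
through `a` and `x` on the side through `b`. -/
lemma l1Dist_detour {a b a' x : Pt} {σ ρ : ℝ} (hσ : 0 ≤ σ) (hσ1 : σ ≤ 1) (hρ : 0 ≤ ρ) (hρ1 : ρ ≤ 1)
    (ha' : a' = (a.1, a.2 + σ * (b.2 - a.2))) (hx : x = (a.1 + ρ * (b.1 - a.1), b.2)) :
    l1Dist a a' + l1Dist a' x + l1Dist x b = l1Dist a b := by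
  have e1 : a.2 - (a.2 + σ * (b.2 - a.2)) = σ * (a.2 - b.2) := by ring
  have e2 : a.2 + σ * (b.2 - a.2) - b.2 = (1 - σ) * (a.2 - b.2) := by ring
  have e3 : a.1 - (a.1 + ρ * (b.1 - a.1)) = ρ * (a.1 - b.1) := by ring
  have e4 : a.1 + ρ * (b.1 - a.1) - b.1 = (1 - ρ) * (a.1 - b.1) := by ring
  rw [ha', hx]
  simp only [l1Dist, e1, e2, e3, e4, abs_mul, abs_of_nonneg hσ, abs_of_nonneg hρ, sub_self,
    abs_zero, abs_of_nonneg (sub_nonneg.2 hσ1), abs_of_nonneg (sub_nonneg.2 hρ1)]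
  ring

/-- The segment `av` crosses `a'b`; the parameter of the crossing point is `l = σ / (σ + ψ)`. Up to
there it runs in the triangle `b a a'`, afterwards in `b a' v`, and both are free. -/
lemma visible_across {a b c a' x v : Pt} {σ ρ : ℝ} (hσ : 0 < σ) (hσ1 : σ ≤ 1) (hρ : 0 ≤ ρ)
    (hρ1 : ρ ≤ 1) (ha' : a' = a + σ • (c - a)) (hx : x = c + ρ • (b - c))
    (h1 : tri b a a' ⊆ D.region) (h2 : tri b a' v ⊆ D.region) (hv : v ∈ tri b a' x) :
    D.Visible a v := by
  obtain ⟨s, w, hw0, hws, hs1, hveq⟩ := hv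
  set ψ := w * (1 - σ) * (1 - ρ) with hψ
  have hψ0 : 0 ≤ ψ := mul_nonneg (mul_nonneg hw0 (by linarith)) (by linarith)
  set β := (1 - s) + w * ρ with hβ
  have hβ0 : 0 ≤ β := add_nonneg (by linarith) (mul_nonneg hw0 hρ)
  have hβ1 : β ≤ 1 := by nlinarith
  set l := σ / (σ + ψ) with hl
  have hl0 : 0 ≤ l := by positivity
  have hl1 : l ≤ 1 := (div_le_one (by positivity)).2 (by linarith)
  have hlm : l * (σ + ψ) = σ := by rw [hl]; field_simp
  have hm : a + l • (v - a) = a' + (l * β) • (b - a') := by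
    rw [hveq, ha', hx]
    have e : l * w * (1 - σ) * (1 - ρ) = σ - l * σ := by
      have : l * σ + l * ψ = σ := by rw [← mul_add, hlm]
      rw [hψ] at this; linarith
    ext
    · simp only [Prod.fst_add, Prod.smul_fst, Prod.fst_sub, smul_eq_mul, hβ]
      linear_combination (c.1 - a.1) * e
    · simp only [Prod.snd_add, Prod.smul_snd, Prod.snd_sub, smul_eq_mul, hβ]
      linear_combination (c.2 - a.2) * e
  have hmseg : a + l • (v - a) ∈ segment ℝ a' b :=
    mem_segment_of_eq (mul_nonneg hl0 hβ0) (mul_le_one₀ hl1 hβ0 hβ1) hm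
  refine Visible.trans_of_mem (m := a + l • (v - a)) ?_ ?_ (mem_segment_of_eq hl0 hl1 rfl)
  · exact visible_of_convex (convex_tri b a a') h1 (mem_tri_middle _ _ _)
      ((convex_tri b a a').segment_subset (mem_tri_right _ _ _) (mem_tri_left _ _ _) hmseg)
  · exact visible_of_convex (convex_tri b a' v) h2
      ((convex_tri b a' v).segment_subset (mem_tri_middle _ _ _) (mem_tri_left _ _ _) hmseg)
      (mem_tri_right _ _ _)

/-- The vertical ray from `a` is free close to `a`. -/
lemma corner_of_sectorFree (hD : D.GeneralPosition) {a b : Pt} (hab : D.Visible a b)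
    (h1 : a.1 ≠ b.1) (h2 : a.2 ≠ b.2) (hsec : SectorFree D a b (a.1, b.2)) :
    tri b a (a.1, b.2) ⊆ D.region ∨ HasVertexBetween D a b ∨ HasEdgeDetour D a b := by
  set c : Pt := (a.1, b.2) with hc
  have hca : c - a = (0, b.2 - a.2) := by ext <;> simp [hc]
  have hbc : b - c = (b.1 - a.1, 0) := by ext <;> simp [hc]
  have hcrect : c ∈ rect a b := ⟨left_mem_uIcc, right_mem_uIcc⟩
  -- Go from `a` vertically towards the corner `c` as far as possible, to `a'`, and sweep the
  -- triangle `b a a'` about `b`. A vertex met in the sweep lies in the box and sees both points.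
  obtain ⟨σ, hσ, hup, hσor⟩ := exists_farthest a (c - a) hab.left_mem
  set a' := a + σ • (c - a) with ha'
  have ha'1 : a'.1 = a.1 := by simp [ha', hca]
  have ha'2 : a'.2 = a.2 + σ * (b.2 - a.2) := by simp [ha', hca]
  have haa' : D.Visible a a' := by
    intro z hz
    obtain ⟨t, h0, h1, rfl⟩ := exists_of_mem_segment hz
    have := hup (t * σ) ⟨mul_nonneg h0 hσ.1, mul_le_of_le_one_left hσ.1 h1⟩
    convert this using 1
    rw [ha']; module
  have hσ0 : 0 < σ := by
    refine lt_of_le_of_ne hσ.1 fun h => ?_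
    rcases hσor with h' | h'
    · linarith
    · apply h'
      rw [ha', ← h, zero_smul, add_zero]
      obtain ⟨ε, hε, hs⟩ := hsec
      exact moves_of_visible_smul hε (visible_of_convex (convex_tri _ _ _) hs (mem_tri_left _ _ _)
        (mem_tri_right _ _ _))
  have ha'rect : a' ∈ rect a b := (convex_rect a b).segment_subset (left_mem_rect a b) hcrect
    (mem_segment_of_eq hσ.1 hσ.2 rfl)
  have hba' : D.Visible b a := hab.symm
  obtain ⟨t, ht, hfree, h | ⟨s, hs0, hs1, hst, hv⟩⟩ :=
    exists_sweep hba' haa' (hsec.mono hσ.1 hσ.2 rfl)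
  swap
  · set y := a + t • (a' - a) with hy
    have hvy : b + s • (y - b) ∈ segment ℝ b y := mem_segment_of_eq hs0.le hs1 rfl
    have hvT : b + s • (y - b) ∈ tri b a y :=
      (convex_tri b a y).segment_subset (mem_tri_left _ _ _) (mem_tri_right _ _ _) hvy
    have hyrect : y ∈ rect a b := (convex_rect a b).segment_subset (left_mem_rect a b) ha'rect
      (mem_segment_of_eq ht.1 ht.2 rfl)
    have hy1 : y.1 = a.1 := by simp [hy, ha'1]
    have hy2 : y.2 = a.2 + t * (σ * (b.2 - a.2)) := by simp [hy, ha'2]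
    refine Or.inr (Or.inl ⟨_, hv, ?_, ?_, ?_, ?_, ?_⟩)
    · exact (convex_rect a b).segment_subset (right_mem_rect a b) hyrect hvy
    · intro h
      have e1 := congrArg Prod.fst h
      have e2 := congrArg Prod.snd h
      simp only [Prod.fst_add, Prod.smul_fst, Prod.fst_sub, Prod.snd_add, Prod.smul_snd,
        Prod.snd_sub, smul_eq_mul, hy1, hy2] at e1 e2
      have h3 : s = 1 := by
        have : (s - 1) * (a.1 - b.1) = 0 := by linear_combination e1
        rcases mul_eq_zero.1 this with h' | h'
        · linarith
        · exact absurd (sub_eq_zero.1 h') h1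
      rw [h3] at e2
      have h4 : t * (σ * (b.2 - a.2)) = 0 := by linarith
      have h5 : t = 0 := (mul_eq_zero.1 h4).resolve_right
        (mul_ne_zero hσ0.ne' (sub_ne_zero.2 h2.symm))
      exact hst (by rw [h3, h5])
    · intro h
      have e1 := congrArg Prod.fst h
      simp only [Prod.fst_add, Prod.smul_fst, Prod.fst_sub, smul_eq_mul, hy1] at e1
      have : s * (a.1 - b.1) = 0 := by linarith
      exact (mul_ne_zero hs0.ne' (sub_ne_zero.2 h1)) this
    · exact visible_of_convex (convex_tri b a y) hfree (mem_tri_middle _ _ _) hvT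
    · exact visible_of_convex (convex_tri b a y) hfree hvT (mem_tri_left _ _ _)
  rw [h, one_smul, add_sub_cancel] at hfree
  by_cases hσ1 : σ = 1
  · left
    have : a' = c := by rw [ha', hσ1, one_smul, add_sub_cancel]
    rwa [this] at hfree
  have hσlt : σ < 1 := lt_of_le_of_ne hσ.2 hσ1
  have hnm := hσor.resolve_left hσ1
  have ha'a : a' ≠ a := by
    intro h
    rw [h] at ha'2
    have : σ * (b.2 - a.2) = 0 := by linarith
    exact (mul_ne_zero hσ0.ne' (sub_ne_zero.2 h2.symm)) this
  have ha'b : a' ≠ b := by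
    intro h
    rw [h] at ha'1
    exact h1 ha'1.symm
  have hva'b : D.Visible a' b := visible_of_convex (convex_tri b a a') hfree
    (mem_tri_right _ _ _) (mem_tri_left _ _ _)
  by_cases ha'V : a' ∈ D.vertices
  · exact Or.inr (Or.inl ⟨a', ha'V, ha'rect, ha'a, ha'b, haa', hva'b⟩)
  obtain ⟨e, he, ha'e⟩ := exists_edge_of_not_moves haa'.right_mem hnm
  obtain ⟨A, B, hA, hB, hAB, hee, -⟩ := D.exists_edge_eq_segment he
  obtain ⟨hd1, hd2⟩ := edge_slope hD hA hB hAB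
  obtain ⟨τ, hτ0, hτ1, ha'τ⟩ := exists_of_mem_segment (hee ▸ ha'e)
  have hτ0' : 0 < τ := lt_of_le_of_ne hτ0 fun h => ha'V (by rw [ha'τ, ← h]; simpa using hA)
  have hτ1' : τ < 1 := lt_of_le_of_ne hτ1 fun h => ha'V (by rw [ha'τ, h]; simpa using hB)
  -- `a'` is an inner point of an edge. The factors `k` and `ρ` describe the point `x` where the
  -- line of this edge meets the horizontal line through `b`; the divisions are allowed because
  -- edges are neither horizontal nor vertical.
  set k := (b.2 - a'.2) / (B.2 - A.2) with hk
  have hb2 : b.2 - a'.2 = (1 - σ) * (b.2 - a.2) := by rw [ha'2]; ring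
  have hk0 : k ≠ 0 := div_ne_zero (by
    rw [hb2]; exact mul_ne_zero (by linarith) (sub_ne_zero.2 h2.symm)) hd2
  have hkd : k * (B.2 - A.2) = b.2 - a'.2 := div_mul_cancel₀ _ hd2
  set ρ := k * (B.1 - A.1) / (b.1 - a.1) with hρ
  have hba1 : b.1 - a.1 ≠ 0 := sub_ne_zero.2 h1.symm
  have hρd : ρ * (b.1 - a.1) = k * (B.1 - A.1) := div_mul_cancel₀ _ hba1
  set x := c + ρ • (b - c) with hx
  have hxa' : x - a' = k • (B - A) := by
    ext
    · simp only [hx, hc, Prod.fst_sub, Prod.fst_add, Prod.smul_fst, smul_eq_mul, ha'1, hρd]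
      ring
    · simp only [hx, hc, Prod.snd_sub, Prod.snd_add, Prod.smul_snd, smul_eq_mul, hkd]
      ring
  have hAB' : segment ℝ A B ⊆ D.region := hee ▸ D.edge_subset_region he
  have hca' : c - a = (1 / (1 - σ)) • (c - a') := by
    have : c - a' = (1 - σ) • (c - a) := by rw [ha']; module
    rw [this, smul_smul, one_div, inv_mul_cancel₀ (by linarith), one_smul]
  have hmedge : ∀ k : ℝ, Moves D a' (k • (B - A)) := fun k => by
    rw [ha'τ]; exact moves_along_edge hAB' ⟨hτ0', hτ1'⟩ k
  have hρ0 : ρ ≠ 0 := div_ne_zero (mul_ne_zero hk0 hd1) hba1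
  -- If `x` were outside the side from `c` to `b`, the direction from `a` to `c` would be a move
  -- along the edge plus a positive multiple of the direction from `a'` to the visible point `b`, so
  -- `a'` would not be blocked.
  have hρrange : 0 < ρ ∧ ρ ≤ 1 := by
    by_contra hcon
    have hpos : 0 < -ρ / ((1 - ρ) * (1 - σ)) ∧ 1 - ρ ≠ 0 := by
      rcases lt_or_ge ρ 0 with h | h
      · exact ⟨div_pos (by linarith) (mul_pos (by linarith) (by linarith)), by linarith⟩
      · have : 1 < ρ := not_le.1 fun h' => hcon ⟨lt_of_le_of_ne h hρ0.symm, h'⟩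
        exact ⟨div_pos_of_neg_of_neg (by linarith)
          (mul_neg_of_neg_of_pos (by linarith) (by linarith)), by linarith⟩
    apply hnm
    have hsplit : c - a = (k / ((1 - ρ) * (1 - σ))) • (B - A) +
        (-ρ / ((1 - ρ) * (1 - σ))) • (b - a') := by
      have h3 : (1 - ρ) • (c - a') = k • (B - A) + (-ρ) • (b - a') := by
        rw [← hxa', hx]; module
      have h4 : c - a = (1 / ((1 - ρ) * (1 - σ))) • ((1 - ρ) • (c - a')) := by
        have : 1 - σ ≠ 0 := by linarith
        rw [hca', smul_smul]
        congr 1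
        field_simp [hpos.2]
      rw [h4, h3, smul_add, smul_smul, smul_smul]
      congr 2 <;> ring
    rw [hsplit]
    exact (hmedge _).add haa'.right_mem ha'V ((moves_of_visible hva'b).smul hpos.1)
  -- `κ` is small enough that the initial part of the way from `a'` to `x` stays on the edge, and at
  -- most 1 so that `SectorFree.extend` applies.
  have hκ0 : 0 < min (min τ (1 - τ) / |k|) 1 := by
    have : 0 < min τ (1 - τ) := lt_min hτ0' (by linarith)
    have := abs_pos.2 hk0
    positivity
  set κ := min (min τ (1 - τ) / |k|) 1 with hκ
  have hκe : a' + κ • (x - a') ∈ e := by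
    have h3 : |κ * k| ≤ min τ (1 - τ) := by
      rw [abs_mul, abs_of_pos hκ0, ← le_div_iff₀ (abs_pos.2 hk0)]
      exact min_le_left _ _
    obtain ⟨h4, h5⟩ := abs_le.1 h3
    have h6 := min_le_left τ (1 - τ)
    have h7 := min_le_right τ (1 - τ)
    rw [hee]
    refine mem_segment_of_eq (t := τ + κ * k) (by linarith) (by linarith) ?_
    rw [hxa']
    nth_rw 1 [ha'τ]
    module
  have hsec' : SectorFree D a' b x := by
    refine SectorFree.extend (y' := a' + κ • (x - a')) (sectorFree_of_not_vertex ha'V hva'b ?_) hκ0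
      (min_le_right _ _) rfl
    exact ((convex_edge he).segment_subset ha'e hκe).trans (D.edge_subset_region he)
  have hxrect : x ∈ rect a b := (convex_rect a b).segment_subset hcrect (right_mem_rect a b)
    (mem_segment_of_eq hρrange.1.le hρrange.2 rfl)
  have hcb : c - b = (a.1 - b.1, 0) := by ext <;> simp [hc]
  have hx2 : x.2 = b.2 := by simp [hx, hc]
  have hσ' : 0 < 1 / (1 - σ) := by
    have : 0 < 1 - σ := by linarith
    positivity
  right
  -- The blocked direction is decomposed as `c - a = (1 / (1 - σ)) • ((x - a') + ρ • (c - b))`,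
  -- which explains `α` and `β`.
  rcases edge_sweep (c := c) (y := a') (α := 1 / (1 - σ)) (β := 1 / (1 - σ) * ρ) he ha'e hκ0 hκe
    hva'b.symm hsec' hx2 (fun h => by
      have : (1 - σ) * (b.2 - a.2) = 0 := by rw [← hb2, h, sub_self]
      exact mul_ne_zero (by linarith) (sub_ne_zero.2 h2.symm) this) ha'e ha'V
    (mul_pos hσ' hρrange.1) (by
      convert hnm using 2
      rw [hca', hx]; module) with ⟨v, hv, hvb, hva', hvfree, hvT⟩ | ⟨hxe, hbx, hor⟩
  · left
    refine ⟨v, hv, tri_subset (convex_rect a b) (right_mem_rect a b) ha'rect hxrect hvT, ?_, hvb,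
      visible_across hσ0 hσ.2 hρrange.1.le hρrange.2 rfl rfl hfree hvfree hvT,
      visible_of_convex (convex_tri b a' v) hvfree (mem_tri_right _ _ _) (mem_tri_left _ _ _)⟩
    rintro rfl
    obtain ⟨s, w, h3, h4, h5, h6⟩ := hvT
    have e2 := congrArg Prod.snd h6
    simp only [Prod.snd_add, Prod.smul_snd, Prod.snd_sub, smul_eq_mul, hx2, ha'2] at e2
    have : ((1 - s) + s * σ + w * (1 - σ)) * (b.2 - v.2) = 0 := by linear_combination -e2
    rcases mul_eq_zero.1 this with h7 | h7
    · have h8 : 0 ≤ w * (1 - σ) := mul_nonneg h3 (by linarith)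
      nlinarith
    · exact h2 (by linarith)
  · right
    refine ⟨a', x, e, he, ha'e, hxe, Or.inr ?_, hor.imp_right fun hnx => ?_, ?_⟩
    · refine isVertProj_of_not_moves hσ.1 rfl ?_ ?_ haa' hnm
      · rw [hca]
      · rw [hca]; exact sub_ne_zero.2 h2.symm
    · refine isHorizProj_of_not_moves (g := c - b) (t := 1 - ρ) (by linarith [hρrange.2]) ?_ ?_ ?_
        hbx hnx
      · rw [hx]; module
      · rw [hcb]
      · rw [hcb]; exact sub_ne_zero.2 h1
    · refine l1Dist_detour hσ.1 hσ.2 hρrange.1.le hρrange.2 (by ext <;> simp [ha'1, ha'2]) ?_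
      ext <;> simp [hx, hc]

/-- A visible pair either spans a free triangle with the corner above or below the first point, or
there is a vertex between the two points, or there is a shortest path along an edge. -/
theorem corner_trichotomy (hD : D.GeneralPosition) {a b : Pt} (hab : D.Visible a b) :
    tri b a (a.1, b.2) ⊆ D.region ∨ HasVertexBetween D a b ∨ HasEdgeDetour D a b := by
  by_cases h1 : a.1 = b.1
  · left
    have : ((a.1, b.2) : Pt) = b := by rw [h1]
    rw [this]
    exact (tri_subset (convex_segment a b) (right_mem_segment ℝ _ _) (left_mem_segment ℝ _ _)
      (right_mem_segment ℝ _ _)).trans hab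
  by_cases h2 : a.2 = b.2
  · left
    have : ((a.1, b.2) : Pt) = a := by rw [← h2]
    rw [this]
    exact (tri_subset (convex_segment a b) (right_mem_segment ℝ _ _) (left_mem_segment ℝ _ _)
      (left_mem_segment ℝ _ _)).trans hab
  set c : Pt := (a.1, b.2) with hc
  have hcrect : c ∈ rect a b := ⟨left_mem_uIcc, right_mem_uIcc⟩
  obtain ⟨r₁, hr₁, hstar⟩ := D.exists_ball_star a
  obtain ⟨r₂, hr₂, hedge⟩ := D.exists_ball_edges a
  obtain ⟨r₃, hr₃, hvert⟩ := D.exists_ball_vertices a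
  set r := min r₁ (min r₂ r₃) with hr
  have hr0 : 0 < r := by positivity
  have hrr₁ : Metric.ball a r ⊆ Metric.ball a r₁ := Metric.ball_subset_ball (min_le_left _ _)
  have hrr₂ : Metric.ball a r ⊆ Metric.ball a r₂ :=
    Metric.ball_subset_ball ((min_le_right _ _).trans (min_le_left _ _))
  have hrr₃ : Metric.ball a r ⊆ Metric.ball a r₃ :=
    Metric.ball_subset_ball ((min_le_right _ _).trans (min_le_right _ _))
  obtain ⟨ε₁, hε₁, hb₁⟩ := exists_move_mem_ball a (b - a) hr0
  obtain ⟨ε₂, hε₂, hb₂⟩ := exists_move_mem_ball a (c - a) hr0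
  set ε := min (min ε₁ ε₂) 1 with hε
  have hε0 : 0 < ε := by positivity
  have hε1 : ε ≤ 1 := min_le_right _ _
  have hbb := hb₁ ε (by rw [abs_of_pos hε0]; exact (min_le_left _ _).trans (min_le_left _ _))
  have hcb := hb₂ ε (by rw [abs_of_pos hε0]; exact (min_le_left _ _).trans (min_le_right _ _))
  set b₁ := a + ε • (b - a) with hb₁def
  have hb₁R : b₁ ∈ D.region := hab (mem_segment_of_eq hε0.le hε1 rfl)
  -- In a small copy of the triangle at `a`, go from the copy `b₁` of `b` towards the copy of the
  -- corner. Everything reached is visible from `a` by star-shapedness, so the sector between the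
  -- directions to `b` and to `x` is free.
  obtain ⟨l, hl, hfar, hlor⟩ := exists_farthest b₁ (ε • (c - b)) hb₁R
  have hball : ∀ t : ℝ, 0 ≤ t → t ≤ 1 → b₁ + t • (ε • (c - b)) ∈ Metric.ball a r := by
    intro t h0 h1
    refine (convex_ball a r).segment_subset hbb hcb (mem_segment_of_eq h0 h1 ?_)
    rw [hb₁def]; module
  set x := b + l • (c - b) with hx
  set y := b₁ + l • (ε • (c - b)) with hy
  have hyx : y = a + ε • (x - a) := by rw [hy, hb₁def, hx]; module
  have hsec : SectorFree D a b x := by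
    refine ⟨ε, hε0, ?_⟩
    rw [← hb₁def, ← hyx]
    refine tri_subset_of_visible fun p hp => ?_
    obtain ⟨t, h0, h1, rfl⟩ := exists_of_mem_segment hp
    have e : b₁ + t • (y - b₁) = b₁ + (t * l) • (ε • (c - b)) := by rw [hy]; module
    rw [e]
    have hle : t * l ≤ l := mul_le_of_le_one_left hl.1 h1
    exact hstar _ (hfar _ ⟨mul_nonneg h0 hl.1, hle⟩)
      (hrr₁ (hball _ (mul_nonneg h0 hl.1) (hle.trans hl.2)))
  rcases hlor with h | hnm
  · have : x = c := by rw [hx, h, one_smul, add_sub_cancel]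
    rw [this] at hsec
    exact corner_of_sectorFree hD hab h1 h2 hsec
  right
  have hyR : y ∈ D.region := hfar l ⟨hl.1, le_rfl⟩
  -- If the small walk is blocked, the blocking edge passes through `a`, since the ball meets no
  -- other edges. So `a` itself starts the sweep along the edge.
  obtain ⟨e, he, hye⟩ := exists_edge_of_not_moves hyR hnm
  have hyball := hball l hl.1 hl.2
  have hae : a ∈ e := hedge e he ⟨y, hrr₂ hyball, hye⟩
  have hx2 : x.2 = b.2 := by simp [hx, hc]
  have hyV : y ∉ D.vertices := by
    intro hV
    have h := hvert y hV (hrr₃ hyball)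
    have : y.2 - a.2 = ε * (b.2 - a.2) := by rw [hyx]; simp [hx2]
    rw [h, sub_self, eq_comm] at this
    exact mul_ne_zero hε0.ne' (sub_ne_zero.2 (Ne.symm h2)) this
  have hxrect : x ∈ rect a b := (convex_rect a b).segment_subset (right_mem_rect a b) hcrect
    (mem_segment_of_eq hl.1 hl.2 rfl)
  -- The direction blocked at `y` is purely horizontal, hence `α = 0`.
  rcases edge_sweep (c := c) (y := y) (α := 0) (β := ε) he hae hε0 (hyx ▸ hye) hab.symm hsec hx2 h2
    hye hyV hε0 (by rwa [zero_smul, zero_add]) with ⟨v, hv, hvb, hva, hvfree, hvT⟩ | ⟨hxe, hbx, hor⟩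
  · left
    exact ⟨v, hv, tri_subset (convex_rect a b) (right_mem_rect a b) (left_mem_rect a b) hxrect hvT,
      hva, hvb, visible_of_convex (convex_tri b a v) hvfree (mem_tri_middle _ _ _)
      (mem_tri_right _ _ _), visible_of_convex (convex_tri b a v) hvfree (mem_tri_right _ _ _)
      (mem_tri_left _ _ _)⟩
  · right
    refine ⟨a, x, e, he, hae, hxe, Or.inl rfl, hor.imp_right fun hnx => ?_, ?_⟩
    · refine isHorizProj_of_not_moves (g := c - b) hl.1 rfl ?_ ?_ hbx hnx
      · simp [hc]
      · simp only [hc, Prod.fst_sub]; exact sub_ne_zero.2 h1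
    · rw [l1Dist_self, zero_add]
      exact l1Dist_add_of_mem_rect hxrect

end PolygonalDomain
end L1Domain

namespace L1Domain
open Set Filter Topology

/-! ### Walks and their lengths -/

lemma l1Length_support_cons {G : SimpleGraph Pt} {a b c : Pt} (h : G.Adj a b) (w : G.Walk b c) :
    l1Length (SimpleGraph.Walk.cons h w).support = l1Dist a b + l1Length w.support := by
  cases w <;> rfl

lemma l1Length_support_append {G : SimpleGraph Pt} {a b c : Pt} (w : G.Walk a b) (w' : G.Walk b c) :
    l1Length (w.append w').support = l1Length w.support + l1Length w'.support := by
  induction w with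
  | nil => simp [l1Length]
  | cons h w ih =>
    rw [SimpleGraph.Walk.cons_append, l1Length_support_cons, l1Length_support_cons, ih, add_assoc]

lemma l1Length_le_cons (a : Pt) (l : List Pt) : l1Length l ≤ l1Length (a :: l) := by
  cases l with
  | nil => exact le_rfl
  | cons b l => simp only [l1Length]; linarith [l1Dist_nonneg a b]

lemma l1Length_cons_le_cons_cons (a b : Pt) (l : List Pt) :
    l1Length (a :: l) ≤ l1Length (a :: b :: l) := by
  cases l with
  | nil => simp only [l1Length]; linarith [l1Dist_nonneg a b]
  | cons c l => simp only [l1Length]; linarith [l1Dist_triangle a b c]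

/-- Omitting points does not lengthen a path. The second conjunct, with a fixed first point, carries
the induction, because omitting the first entry changes where the path starts. -/
lemma l1Length_le_of_sublist {l l' : List Pt} (h : l.Sublist l') :
    l1Length l ≤ l1Length l' ∧ ∀ a, l1Length (a :: l) ≤ l1Length (a :: l') := by
  induction h with
  | slnil => exact ⟨le_rfl, fun _ => le_rfl⟩
  | @cons l₁ l₂ b _ ih =>
    exact ⟨ih.1.trans (l1Length_le_cons b l₂),
      fun a => (ih.2 a).trans (l1Length_cons_le_cons_cons a b l₂)⟩
  | @cons_cons l₁ l₂ b _ ih =>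
    exact ⟨ih.2 b, fun a => by simp only [l1Length]; linarith [ih.2 b]⟩

/-- There is a walk from `a` to `b` of length at most `L`. -/
def WalkLE (G : SimpleGraph Pt) (a b : Pt) (L : ℝ) : Prop :=
  ∃ w : G.Walk a b, l1Length w.support ≤ L

lemma walkLE_refl {G : SimpleGraph Pt} (a : Pt) : WalkLE G a a (l1Dist a a) :=
  ⟨.nil, by simp [l1Length, l1Dist_self]⟩

lemma WalkLE.trans {G : SimpleGraph Pt} {a b c : Pt} {L L' : ℝ} (h : WalkLE G a b L)
    (h' : WalkLE G b c L') : WalkLE G a c (L + L') := by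
  obtain ⟨w, hw⟩ := h
  obtain ⟨w', hw'⟩ := h'
  exact ⟨w.append w', by rw [l1Length_support_append]; linarith⟩

lemma WalkLE.mono {G : SimpleGraph Pt} {a b : Pt} {L L' : ℝ} (h : WalkLE G a b L) (hL : L ≤ L') :
    WalkLE G a b L' :=
  h.imp fun _ hw => hw.trans hL

lemma walkLE_of_adj {G : SimpleGraph Pt} {a b : Pt} (h : G.Adj a b) : WalkLE G a b (l1Dist a b) :=
  ⟨.cons h .nil, by simp [l1Length]⟩

lemma WalkLE.symm {G : SimpleGraph Pt} {a b : Pt} {L : ℝ} (h : WalkLE G a b L) :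
    WalkLE G b a L := by
  obtain ⟨w, hw⟩ := h
  refine WalkLE.mono ?_ hw
  clear hw
  induction w with
  | nil => exact ⟨.nil, le_rfl⟩
  | @cons a b c h w ih =>
    have := ih.trans (walkLE_of_adj h.symm)
    rw [l1Length_support_cons]
    exact this.mono (by rw [l1Dist_comm b a]; linarith)

lemma eq_of_l1Dist_eq_zero {a b : Pt} (h : l1Dist a b = 0) : a = b := by
  have h1 := abs_nonneg (a.1 - b.1)
  have h2 := abs_nonneg (a.2 - b.2)
  have h3 : |a.1 - b.1| = 0 := by simp only [l1Dist] at h; linarith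
  have h4 : |a.2 - b.2| = 0 := by simp only [l1Dist] at h; linarith
  ext
  · linarith [abs_eq_zero.1 h3]
  · linarith [abs_eq_zero.1 h4]

lemma eq_of_mem_segment_of_mem_segment {a b z : Pt} (h : z ∈ segment ℝ a b)
    (h' : b ∈ segment ℝ a z) : z = b := by
  have h1 := l1Dist_add_of_mem_segment h
  have h2 := l1Dist_add_of_mem_segment h'
  have h3 := l1Dist_nonneg z b
  have h4 := l1Dist_nonneg b z
  exact eq_of_l1Dist_eq_zero (by linarith)

/-- If adjacent points of a set on a segment are connected, then its end points are connected by a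
walk along the segment. -/
lemma walkLE_of_consecutive {G : SimpleGraph Pt} {S : Set Pt} (hS : S.Finite) : ∀ (k : ℕ) (a b : Pt),
    (S ∩ segment ℝ a b).ncard = k → a ∈ S → b ∈ S →
    (∀ x y, Consecutive S x y → x ∈ segment ℝ a b → y ∈ segment ℝ a b → G.Adj x y) →
      WalkLE G a b (l1Dist a b) := by
  intro k
  induction k using Nat.strong_induction_on with
  | _ k ih =>
  intro a b hk ha hb hadj
  by_cases hab : a = b
  · subst hab
    exact walkLE_refl a
  by_cases h : ∀ z ∈ S, z ∈ segment ℝ a b → z = a ∨ z = b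
  · exact walkLE_of_adj (hadj a b ⟨ha, hb, hab, h⟩ (left_mem_segment ℝ _ _)
      (right_mem_segment ℝ _ _))
  push Not at h
  -- Split at a point of `S` strictly between. Each half misses one of the old end points, so the
  -- count drops.
  obtain ⟨z, hz, hzs, hza, hzb⟩ := h
  have hs1 : segment ℝ a z ⊆ segment ℝ a b :=
    (convex_segment a b).segment_subset (left_mem_segment ℝ _ _) hzs
  have hs2 : segment ℝ z b ⊆ segment ℝ a b :=
    (convex_segment a b).segment_subset hzs (right_mem_segment ℝ _ _)
  have hlt1 : (S ∩ segment ℝ a z).ncard < k := by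
    rw [← hk]
    refine Set.ncard_lt_ncard ⟨Set.inter_subset_inter_right _ hs1, fun hsub => hzb ?_⟩
      (hS.subset Set.inter_subset_left)
    exact eq_of_mem_segment_of_mem_segment hzs (hsub ⟨hb, right_mem_segment ℝ _ _⟩).2
  have hlt2 : (S ∩ segment ℝ z b).ncard < k := by
    rw [← hk]
    refine Set.ncard_lt_ncard ⟨Set.inter_subset_inter_right _ hs2, fun hsub => hza ?_⟩
      (hS.subset Set.inter_subset_left)
    refine eq_of_mem_segment_of_mem_segment (a := b) (by rwa [segment_symm]) ?_
    rw [segment_symm]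
    exact (hsub ⟨ha, left_mem_segment ℝ _ _⟩).2
  have h1 := ih _ hlt1 a z rfl ha hz fun x y hxy hx hy => hadj x y hxy (hs1 hx) (hs1 hy)
  have h2 := ih _ hlt2 z b rfl hz hb fun x y hxy hx hy => hadj x y hxy (hs2 hx) (hs2 hy)
  exact (h1.trans h2).mono (l1Dist_add_of_mem_segment hzs).le

/-- In a graph with finitely many non-isolated points there is a shortest walk between any two
connected points. -/
lemma exists_isShortestWalk {G : SimpleGraph Pt} (hG : G.support.Finite) {p q : Pt}
    (w₀ : G.Walk p q) : ∃ w : G.Walk p q, IsShortestWalk w := by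
  set F : Set Pt := G.support ∪ {p} with hF
  have hFf : F.Finite := hG.union (Set.finite_singleton p)
  have hmem : ∀ {a b : Pt} (w : G.Walk a b), a ∈ F → ∀ z ∈ w.support, z ∈ F := by
    intro a b w
    induction w with
    | nil => intro ha z hz; simp only [SimpleGraph.Walk.support_nil, List.mem_singleton] at hz; rwa [hz]
    | @cons a b c h w ih =>
      intro ha z hz
      rw [SimpleGraph.Walk.support_cons, List.mem_cons] at hz
      rcases hz with rfl | hz
      · exact ha
      · exact ih (Or.inl ⟨a, h.symm⟩) z hz
  -- There are only finitely many repetition-free lists over a finite set, so a shortest path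
  -- exists; bypassing cycles shows that no walk is shorter.
  set A : Set (List Pt) := {l | l.Nodup ∧ ∀ z ∈ l, z ∈ F} with hA
  have hAf : A.Finite := by
    have := hFf.to_subtype
    have h1 := List.finite_length_le F F.ncard
    refine (h1.image (List.map Subtype.val)).subset ?_
    rintro l ⟨hl, hl'⟩
    refine ⟨l.attach.map fun z => ⟨z.1, hl' z.1 z.2⟩, ?_, ?_⟩
    · change List.length _ ≤ _
      rw [List.length_map, List.length_attach]
      rw [← List.toFinset_card_of_nodup hl, ← Set.ncard_coe_finset]
      exact Set.ncard_le_ncard (fun z hz => hl' z (by simpa using hz)) hFf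
    · rw [List.map_map]
      exact List.attach_map_subtype_val l
  set B : Set ℝ := {L | ∃ w : G.Walk p q, w.IsPath ∧ L = l1Length w.support} with hB
  have hBf : B.Finite := by
    refine (hAf.image l1Length).subset ?_
    rintro L ⟨w, hw, rfl⟩
    exact ⟨w.support, ⟨hw.support_nodup, hmem w (Or.inr rfl)⟩, rfl⟩
  classical
  obtain ⟨L, ⟨w, hw, rfl⟩, hmin⟩ := Set.exists_min_image B id hBf
    ⟨_, w₀.bypass, w₀.bypass_isPath, rfl⟩
  refine ⟨w, fun w' => ?_⟩
  exact (hmin _ ⟨w'.bypass, w'.bypass_isPath, rfl⟩).trans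
    (l1Length_le_of_sublist w'.support_bypass_sublist_support).1

/-! ### Cut-line trees -/

lemma cuts_node (c : ℝ) (l r : BinaryTree ℝ) :
    cuts (.node c l r) = insert c (cuts l ∪ cuts r) := by
  ext x
  constructor
  · rintro ⟨a, ha⟩
    match a, ha with
    | [], ha => exact Or.inl (by simpa [cutAt, eq_comm] using ha)
    | false :: a, ha => exact Or.inr (Or.inl ⟨a, ha⟩)
    | true :: a, ha => exact Or.inr (Or.inr ⟨a, ha⟩)
  · rintro (rfl | ⟨a, ha⟩ | ⟨a, ha⟩)
    exacts [⟨[], rfl⟩, ⟨false :: a, ha⟩, ⟨true :: a, ha⟩]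

lemma cuts_nil : cuts .nil = ∅ := by
  ext x
  simp [cuts, cutAt]

lemma cuts_finite (T : BinaryTree ℝ) : (cuts T).Finite := by
  induction T with
  | nil => simp [cuts_nil]
  | node c l r hl hr => rw [cuts_node]; exact (hl.union hr).insert c

lemma exists_cutAt_of_prefix {T : BinaryTree ℝ} {u m : List Bool} {x : ℝ} (h : cutAt T u = some x)
    (hm : m <+: u) : ∃ c, cutAt T m = some c := by
  obtain ⟨k, rfl⟩ := hm
  induction m generalizing T with
  | nil =>
    cases T with
    | nil => simp [cutAt] at h
    | node c l r => exact ⟨c, rfl⟩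
  | cons b m ih =>
    cases T with
    | nil => simp [cutAt] at h
    | node c l r => cases b <;> exact ih h

lemma Extends.cutAt {T T' : BinaryTree ℝ} (hE : Extends T T') {u : List Bool} {x : ℝ}
    (h : cutAt T u = some x) : cutAt T' u = some x := by
  induction hE generalizing u with
  | nil t => simp [L1Domain.cutAt] at h
  | node c l r l' r' _ _ ihl ihr =>
    match u, h with
    | [], h => exact h
    | false :: u, h => exact ihl h
    | true :: u, h => exact ihr h

lemma routes_of_prefix {x : ℝ} {T : BinaryTree ℝ} {u m : List Bool} (h : Routes x T u)
    (hm : m <+: u) : Routes x T m := by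
  obtain ⟨k, rfl⟩ := hm
  induction m generalizing T with
  | nil => cases T <;> trivial
  | cons b m ih =>
    cases T with
    | nil => cases b <;> exact h.elim
    | node c l r => cases b <;> exact ⟨h.1, ih h.2⟩

/-- Places every polygon vertex on a cut-line at the end of its own descent, so that it is its own
type-3 point at that leaf. -/
lemma IsCutTree.exists_leaf {T : BinaryTree ℝ} {W : Finset Pt} (h : IsCutTree T W) {p : Pt}
    (hp : p ∈ W) : ∃ u, cutAt T u = some p.1 ∧ Routes p.1 T u := by
  induction h with
  | leaf q =>
    obtain rfl : p = q := by simpa using hp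
    exact ⟨[], rfl, trivial⟩
  | node c l r A B hA hB _ _ _ _ ihl ihr =>
    rcases Finset.mem_union.1 hp with h | h
    · obtain ⟨u, h1, h2⟩ := ihl h
      exact ⟨false :: u, h1, hA p h, h2⟩
    · obtain ⟨u, h1, h2⟩ := ihr h
      exact ⟨true :: u, h1, hB p h, h2⟩

/-- The cut-line at the lowest common ancestor of two nodes of a search tree lies between the
cut-lines of these nodes. -/
lemma IsSearchTree.exists_common_prefix {T : BinaryTree ℝ} (hT : IsSearchTree T) {u w : List Bool}
    {x y : ℝ} (hu : cutAt T u = some x) (hw : cutAt T w = some y) :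
    ∃ m c, m <+: u ∧ m <+: w ∧ cutAt T m = some c ∧ c ∈ uIcc x y := by
  induction T generalizing u w with
  | nil => simp [cutAt] at hu
  | node c l r ihl ihr =>
    obtain ⟨hl, hr, hl', hr'⟩ := hT
    match u, w, hu, hw with
    | [], w, hu, hw =>
      obtain rfl : c = x := by simpa [cutAt] using hu
      exact ⟨[], c, List.nil_prefix, List.nil_prefix, rfl, left_mem_uIcc⟩
    | u, [], hu, hw =>
      obtain rfl : c = y := by simpa [cutAt] using hw
      exact ⟨[], c, List.nil_prefix, List.nil_prefix, rfl, right_mem_uIcc⟩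
    | false :: u, false :: w, hu, hw =>
      obtain ⟨m, d, h1, h2, h3, h4⟩ := ihl hl' hu hw
      exact ⟨false :: m, d, by simpa using h1, by simpa using h2, h3, h4⟩
    | true :: u, true :: w, hu, hw =>
      obtain ⟨m, d, h1, h2, h3, h4⟩ := ihr hr' hu hw
      exact ⟨true :: m, d, by simpa using h1, by simpa using h2, h3, h4⟩
    | false :: u, true :: w, hu, hw =>
      exact ⟨[], c, List.nil_prefix, List.nil_prefix, rfl,
        mem_uIcc.2 (Or.inl ⟨(hl x ⟨u, hu⟩).le, (hr y ⟨w, hw⟩).le⟩)⟩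
    | true :: u, false :: w, hu, hw =>
      exact ⟨[], c, List.nil_prefix, List.nil_prefix, rfl,
        mem_uIcc.2 (Or.inr ⟨(hl y ⟨w, hw⟩).le, (hr x ⟨u, hu⟩).le⟩)⟩

lemma superTop_prefix_self (D : PolygonalDomain) (u : List Bool) : superTop D u <+: u :=
  List.take_prefix _ _

/-- Passing to an ancestor can only raise the top of the super-level. Hence a vertex that
contributes to a node is also a candidate at all ancestors of that node. -/
lemma superTop_prefix (D : PolygonalDomain) {m u : List Bool} (h : m <+: u) :
    superTop D m <+: superTop D u := by
  obtain ⟨k, rfl⟩ := h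
  unfold superTop
  have h1 : superSize D * (m.length / superSize D) ≤ m.length := Nat.mul_div_le _ _
  have h2 : superSize D * (m.length / superSize D) ≤
      superSize D * ((m ++ k).length / superSize D) :=
    Nat.mul_le_mul_left _ (Nat.div_le_div_right (by simp))
  rw [← List.take_append_of_le_length (l₂ := k) h1]
  exact List.take_prefix_take_left h2

end L1Domain

namespace L1Domain
open Set Filter Topology

/-! ### Projections -/

lemma IsProjDir.unique {D : PolygonalDomain} {d p q q' : Pt} (h : D.IsProjDir d p q)
    (h' : D.IsProjDir d p q') : q = q' := by
  obtain ⟨t, _, rfl, hv, hs⟩ := h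
  obtain ⟨t', _, rfl, hv', hs'⟩ := h'
  rcases lt_trichotomy t t' with hlt | rfl | hlt
  · exact absurd hv' (hs _ hlt)
  · rfl
  · exact absurd hv (hs' _ hlt)

lemma isProjDir_finite (D : PolygonalDomain) (d p : Pt) :
    {q | D.IsProjDir d p q}.Finite ∧ {q | D.IsProjDir d p q}.ncard ≤ 1 := by
  have hs : {q | D.IsProjDir d p q}.Subsingleton := fun _ h _ h' => IsProjDir.unique h h'
  exact ⟨hs.finite, (Set.ncard_le_one hs.finite).2 hs⟩

lemma isHorizProj_finite (D : PolygonalDomain) (p : Pt) :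
    {q | D.IsHorizProj p q}.Finite ∧ {q | D.IsHorizProj p q}.ncard ≤ 2 := by
  have h : {q | D.IsHorizProj p q} = {q | D.IsProjDir (1, 0) p q} ∪ {q | D.IsProjDir (-1, 0) p q} :=
    rfl
  rw [h]
  refine ⟨(isProjDir_finite D _ p).1.union (isProjDir_finite D _ p).1, ?_⟩
  exact (Set.ncard_union_le _ _).trans
    (Nat.add_le_add (isProjDir_finite D _ p).2 (isProjDir_finite D _ p).2)

lemma isProj_finite (D : PolygonalDomain) (p : Pt) :
    {q | D.IsProj p q}.Finite ∧ {q | D.IsProj p q}.ncard ≤ 4 := by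
  have h : {q | D.IsProj p q} = {q | D.IsHorizProj p q} ∪
      ({q | D.IsProjDir (0, 1) p q} ∪ {q | D.IsProjDir (0, -1) p q}) := rfl
  rw [h]
  refine ⟨(isHorizProj_finite D p).1.union
    ((isProjDir_finite D _ p).1.union (isProjDir_finite D _ p).1), ?_⟩
  exact (Set.ncard_union_le _ _).trans (Nat.add_le_add (isHorizProj_finite D p).2
    ((Set.ncard_union_le _ _).trans
      (Nat.add_le_add (isProjDir_finite D _ p).2 (isProjDir_finite D _ p).2)))

lemma IsProjDir.visible {D : PolygonalDomain} {d p q : Pt} (h : D.IsProjDir d p q) :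
    D.Visible p q := by
  obtain ⟨t, _, _, hv, _⟩ := h
  exact hv

lemma IsHorizProj.visible {D : PolygonalDomain} {p q : Pt} (h : D.IsHorizProj p q) :
    D.Visible p q :=
  h.elim IsProjDir.visible IsProjDir.visible

lemma IsVertProj.visible {D : PolygonalDomain} {p q : Pt} (h : D.IsVertProj p q) :
    D.Visible p q :=
  h.elim IsProjDir.visible IsProjDir.visible

lemma IsProj.visible {D : PolygonalDomain} {p q : Pt} (h : D.IsProj p q) : D.Visible p q :=
  h.elim IsHorizProj.visible IsVertProj.visible

lemma IsHorizProj.snd_eq {D : PolygonalDomain} {p q : Pt} (h : D.IsHorizProj p q) : q.2 = p.2 := by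
  rcases h with ⟨t, _, rfl, _⟩ | ⟨t, _, rfl, _⟩ <;> simp

lemma IsVertProj.fst_eq {D : PolygonalDomain} {p q : Pt} (h : D.IsVertProj p q) : q.1 = p.1 := by
  rcases h with ⟨t, _, rfl, _⟩ | ⟨t, _, rfl, _⟩ <;> simp

lemma visible_trans_of_snd_eq {D : PolygonalDomain} {a b c : Pt} (h : D.Visible a b)
    (h' : D.Visible b c) (hab : b.2 = a.2) (hbc : c.2 = b.2) : D.Visible a c :=
  (segment_subset_union_of_collinear (by rw [hab, hbc, hab]; ring)).trans (Set.union_subset h h')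

lemma IsProjDir.not_moves {D : PolygonalDomain} {d p q : Pt} (h : D.IsProjDir d p q) :
    ¬ D.Moves q d := by
  obtain ⟨t, ht, rfl, hv, hs⟩ := h
  rintro ⟨η, hη, hm⟩
  refine hs (t + η) (by linarith) (PolygonalDomain.Visible.trans_of_mem (m := p + t • d) hv ?_ ?_)
  · intro z hz
    obtain ⟨k, h0, h1, rfl⟩ := exists_of_mem_segment hz
    have := hm (k * η) ⟨by positivity, mul_le_of_le_one_left hη.le h1⟩
    convert this using 1
    module
  · have : 0 < t + η := by linarith
    refine mem_segment_of_eq (t := t / (t + η)) (by positivity) ((div_le_one this).2 (by linarith)) ?_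
    rw [add_sub_cancel_left, smul_smul, div_mul_cancel₀ _ this.ne']

lemma IsHorizProj.of_visible {D : PolygonalDomain} {p g x : Pt} (hpg : D.Visible p g)
    (hy : g.2 = p.2) (h : D.IsHorizProj g x) : D.IsHorizProj p x := by
  have key : ∀ δ : ℝ, δ * δ = 1 → D.IsProjDir (δ, 0) g x → D.IsProjDir (δ, 0) p x := by
    intro δ hδ h
    have hpx : D.Visible p x := by
      obtain ⟨t, _, hx, hv, _⟩ := h
      exact visible_trans_of_snd_eq hpg hv hy (by simp [hx])
    have hm := IsProjDir.not_moves h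
    obtain ⟨t, ht, hx, hv, hs⟩ := h
    have hg : g = p + (δ * (g.1 - p.1)) • ((δ, 0) : Pt) := by
      ext
      · simp only [Prod.fst_add, Prod.smul_fst, smul_eq_mul]
        linear_combination -(g.1 - p.1) * hδ
      · simp [hy]
    by_cases h0 : 0 ≤ δ * (g.1 - p.1) + t
    · refine PolygonalDomain.isProjDir_of_not_moves h0 ?_ hpx hm
      rw [hx]
      nth_rw 1 [hg]
      module
    -- Here `p` would lie beyond the projection of `g` in the same direction, although `g` sees `p`.
    · exfalso
      refine hs (-(δ * (g.1 - p.1))) (by linarith) ?_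
      have : g + (-(δ * (g.1 - p.1))) • ((δ, 0) : Pt) = p := by
        nth_rw 1 [hg]
        module
      rw [this]
      exact hpg.symm
  rcases h with h | h
  · exact Or.inl (key 1 (by norm_num) h)
  · exact Or.inr (key (-1) (by norm_num) h)

/-! ### Finiteness and visibility of the Steiner points -/

variable {D : PolygonalDomain} {T T' : BinaryTree ℝ}

lemma V1_finite (D : PolygonalDomain) : D.V1.Finite := by
  have : {q | ∃ p ∈ D.vertices, D.IsProj p q} = ⋃ p ∈ D.vertices, {q | D.IsProj p q} := by
    ext; simp
  rw [PolygonalDomain.V1, this]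
  exact D.vertices_finite.union (D.vertices_finite.biUnion fun p _ => (isProj_finite D p).1)

lemma type3_finite (D : PolygonalDomain) (T : BinaryTree ℝ) (p : Pt) : (type3 D T p).Finite := by
  refine ((cuts_finite T).image fun c => ((c, p.2) : Pt)).subset ?_
  rintro s ⟨v, c, hc, -, -, rfl⟩
  exact ⟨c, ⟨v, hc⟩, rfl⟩

lemma newType2_finite (D : PolygonalDomain) (T' : BinaryTree ℝ) (p : Pt) :
    (newType2 D T' p).Finite := by
  refine ((cuts_finite T').image fun c => ((c, p.2) : Pt)).subset ?_
  rintro s ⟨-, u, v, c, -, -, hc, -, rfl⟩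
  exact ⟨c, ⟨v, hc⟩, rfl⟩

lemma V3_finite (D : PolygonalDomain) (T : BinaryTree ℝ) : (V3 D T).Finite :=
  D.vertices_finite.biUnion fun p _ => type3_finite D T p

lemma allNewType2_finite (D : PolygonalDomain) (T' : BinaryTree ℝ) : (allNewType2 D T').Finite :=
  (V1_finite D).biUnion fun p _ => newType2_finite D T' p

lemma newType1_finite (D : PolygonalDomain) (T : BinaryTree ℝ) : (newType1 D T).Finite := by
  have : newType1 D T = ⋃ p ∈ D.V1 ∪ V3 D T, {q | D.IsProj p q} := by
    ext; simp [newType1]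
  rw [this]
  exact ((V1_finite D).union (V3_finite D T)).biUnion fun p _ => (isProj_finite D p).1

lemma steinerRow_finite (D : PolygonalDomain) (T T' : BinaryTree ℝ) (p : Pt) :
    (steinerRow D T T' p).Finite :=
  (((Set.finite_singleton p).union (type3_finite D T p)).union (newType2_finite D T' p)).union
    (isHorizProj_finite D p).1

lemma G2Vertices_finite (D : PolygonalDomain) (T T' : BinaryTree ℝ) :
    (G2Vertices D T T').Finite :=
  (((V1_finite D).union (V3_finite D T)).union (newType1_finite D T)).union
    (allNewType2_finite D T')

lemma V1_subset_region : D.V1 ⊆ D.region := by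
  rintro q (h | ⟨p, -, h⟩)
  · exact D.vertices_subset_region h
  · exact (IsProj.visible h).right_mem

lemma V3_subset_region : V3 D T ⊆ D.region := by
  intro q hq
  simp only [V3, Set.mem_iUnion] at hq
  obtain ⟨p, -, v, c, -, -, h, rfl⟩ := hq
  exact PolygonalDomain.Visible.right_mem h

lemma steinerRow_spec {p q : Pt} (hp : p ∈ D.region) (hq : q ∈ steinerRow D T T' p) :
    q.2 = p.2 ∧ D.Visible p q := by
  rcases hq with ((hq | ⟨v, c, -, -, h, rfl⟩) | ⟨-, u, v, c, -, -, -, h, rfl⟩) | hq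
  · rw [Set.mem_singleton_iff.1 hq]
    exact ⟨rfl, PolygonalDomain.visible_self hp⟩
  · exact ⟨rfl, h⟩
  · exact ⟨rfl, h⟩
  · exact ⟨IsHorizProj.snd_eq hq, IsHorizProj.visible hq⟩

lemma steinerRow_visible {p q q' : Pt} (hp : p ∈ D.region) (hq : q ∈ steinerRow D T T' p)
    (hq' : q' ∈ steinerRow D T T' p) : q.2 = q'.2 ∧ D.Visible q q' := by
  obtain ⟨h1, h2⟩ := steinerRow_spec hp hq
  obtain ⟨h1', h2'⟩ := steinerRow_spec hp hq'
  exact ⟨h1.trans h1'.symm, visible_trans_of_snd_eq h2.symm h2' h1.symm h1'⟩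

lemma snd_eq_of_rowStars {a b : Pt} (h : (rowStars D T T').Adj a b) : a.2 = b.2 := by
  rw [rowStars, SimpleGraph.fromRel_adj] at h
  rcases h.2 with ⟨ha, hb⟩ | ⟨hb, ha⟩
  · exact (steinerRow_spec (V1_subset_region ha) hb).1.symm
  · exact (steinerRow_spec (V1_subset_region hb) ha).1

/-- The third step removes only horizontal edges, so every other edge survives it. -/
lemma G2_adj_of_snd_ne {a b : Pt} (hne : a.2 ≠ b.2)
    (h : (G1 D T).Adj a b ∨ (step1 D T).Adj a b ∨ (step2 D T T').Adj a b) :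
    (G2 D T T').Adj a b := by
  refine Or.inl ⟨?_, fun h' => hne (snd_eq_of_rowStars h')⟩
  rcases h with h | h | h
  exacts [Or.inl (Or.inl h), Or.inl (Or.inr h), Or.inr h]

/-! ### Walks along rows, cut-lines and edges -/

lemma walkLE_row {p a b : Pt} (hp : p ∈ D.V1) (ha : a ∈ steinerRow D T T' p)
    (hb : b ∈ steinerRow D T T' p) : WalkLE (G2 D T T') a b (l1Dist a b) := by
  refine walkLE_of_consecutive (steinerRow_finite D T T' p) _ a b rfl ha hb ?_
  intro x y hxy _ _
  refine Or.inr ?_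
  rw [rowChains, SimpleGraph.fromRel_adj]
  exact ⟨hxy.2.2.1, Or.inl ⟨p, hp, hxy⟩⟩

lemma walkLE_cut {a b : Pt} (ha : a ∈ V3 D T ∪ allNewType2 D T')
    (hb : b ∈ V3 D T ∪ allNewType2 D T') (hab : a.1 = b.1) (hv : D.Visible a b) :
    WalkLE (G2 D T T') a b (l1Dist a b) := by
  have hfin : {s | s ∈ V3 D T ∪ allNewType2 D T' ∧ s.1 = b.1}.Finite :=
    ((V3_finite D T).union (allNewType2_finite D T')).subset fun _ h => h.1
  refine walkLE_of_consecutive hfin _ a b rfl ⟨ha, hab⟩ ⟨hb, rfl⟩ ?_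
  intro x y hxy hx hy
  have hne : x.2 ≠ y.2 := fun h => hxy.2.2.1 (Prod.ext (hxy.1.2.trans hxy.2.1.2.symm) h)
  refine G2_adj_of_snd_ne hne (Or.inr (Or.inr ?_))
  rw [step2, SimpleGraph.fromRel_adj]
  exact ⟨hxy.2.2.1, Or.inl (Or.inr ⟨b.1, hxy, hv.mono hx hy⟩)⟩

lemma edge_snd_ne (hD : D.GeneralPosition) {e : Set Pt} (he : e ∈ D.edges) {x y : Pt} (hx : x ∈ e)
    (hy : y ∈ e) (hxy : x ≠ y) : x.2 ≠ y.2 := by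
  obtain ⟨A, B, hA, hB, hAB, rfl, -⟩ := D.exists_edge_eq_segment he
  have hd := (PolygonalDomain.edge_slope hD hA hB hAB).2
  obtain ⟨t, -, -, rfl⟩ := exists_of_mem_segment hx
  obtain ⟨t', -, -, rfl⟩ := exists_of_mem_segment hy
  intro h
  simp only [Prod.snd_add, Prod.smul_snd, Prod.snd_sub, smul_eq_mul] at h
  have : (t - t') * (B.2 - A.2) = 0 := by linear_combination h
  have htt : t = t' := by
    rcases mul_eq_zero.1 this with h' | h'
    · linarith
    · exact absurd h' hd
  exact hxy (by rw [htt])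

/-- Polygon edges are not horizontal in general position, so the adjacencies on them are untouched
by the third step. -/
lemma walkLE_edge (hD : D.GeneralPosition) {e : Set Pt} (he : e ∈ D.edges) {a b : Pt}
    (ha : a ∈ D.V1 ∪ V3 D T ∪ newType1 D T) (hb : b ∈ D.V1 ∪ V3 D T ∪ newType1 D T)
    (hae : a ∈ e) (hbe : b ∈ e) : WalkLE (G2 D T T') a b (l1Dist a b) := by
  have hfin : ((D.V1 ∪ V3 D T ∪ newType1 D T) ∩ e).Finite :=
    (((V1_finite D).union (V3_finite D T)).union (newType1_finite D T)).subset
      Set.inter_subset_left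
  refine walkLE_of_consecutive hfin _ a b rfl ⟨ha, hae⟩ ⟨hb, hbe⟩ ?_
  intro x y hxy _ _
  refine G2_adj_of_snd_ne (edge_snd_ne hD he hxy.1.2 hxy.2.1.2 hxy.2.2.1) (Or.inr (Or.inl ?_))
  rw [step1, SimpleGraph.fromRel_adj]
  exact ⟨hxy.2.2.1, Or.inl (Or.inr ⟨e, he, hxy⟩)⟩

/-- Every vertex of `G₁` lies on a cut-line and belongs to the row of some point of `V₁`, together
with its visible projections on the cut-lines at the ancestors. -/
lemma exists_row_of_mem (hT : IsCutLineTree D T) (hI : IsInsertion D T T') {g : Pt}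
    (hg : g ∈ D.V1 ∪ V3 D T) :
    ∃ p ∈ D.V1, ∃ u, cutAt T' u = some g.1 ∧ g ∈ steinerRow D T T' p ∧
      (∀ x, D.IsHorizProj g x → x ∈ steinerRow D T T' p) ∧
      ∀ m c, m <+: u → cutAt T' m = some c → D.HorizVisible g c →
        ((c, g.2) : Pt) ∈ steinerRow D T T' p ∧ ((c, g.2) : Pt) ∈ V3 D T ∪ allNewType2 D T' := by
  -- A prefix of an address of `T` is a node of `T` with the same cut-line in `T'`. By monotonicity
  -- of `superTop`, the vertex belongs to the top above this node, so its visible projection there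
  -- is a type-3 point.
  have type3_case : ∀ v ∈ D.vertices, ∀ u x, cutAt T u = some x →
      v ∈ nodeVertices D T (superTop D u) → D.HorizVisible v x →
      ∀ m c, m <+: u → cutAt T' m = some c → D.HorizVisible (x, v.2) c →
        ((c, v.2) : Pt) ∈ type3 D T v := by
    intro v hv u x hu hvu hvx m c hm hc hvis
    obtain ⟨c', hc'⟩ := exists_cutAt_of_prefix hu hm
    obtain rfl : c' = c := by simpa [hI.1.cutAt hc'] using hc
    refine ⟨m, c', hc', ⟨hv, routes_of_prefix hvu.2 (superTop_prefix D hm)⟩, ?_, rfl⟩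
    exact visible_trans_of_snd_eq (b := (x, v.2)) hvx hvis rfl rfl
  have vert_case : ∀ v ∈ D.vertices, ∀ u x, cutAt T u = some x →
      v ∈ nodeVertices D T (superTop D u) → D.HorizVisible v x →
      ∃ p ∈ D.V1, ∃ u, cutAt T' u = some x ∧ ((x, v.2) : Pt) ∈ steinerRow D T T' p ∧
        (∀ y, D.IsHorizProj (x, v.2) y → y ∈ steinerRow D T T' p) ∧
        ∀ m c, m <+: u → cutAt T' m = some c → D.HorizVisible (x, v.2) c →
        ((c, v.2) : Pt) ∈ steinerRow D T T' p ∧ ((c, v.2) : Pt) ∈ V3 D T ∪ allNewType2 D T' := by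
    intro v hv u x hu hvu hvx
    refine ⟨v, Or.inl hv, u, hI.1.cutAt hu, Or.inl (Or.inl (Or.inr ⟨u, x, hu, hvu, hvx, rfl⟩)),
      fun y hy => Or.inr (IsHorizProj.of_visible hvx rfl hy), fun m c hm hc hvis => ?_⟩
    have := type3_case v hv u x hu hvu hvx m c hm hc hvis
    exact ⟨Or.inl (Or.inl (Or.inr this)), Or.inl (Set.mem_biUnion hv this)⟩
  by_cases hgv : g ∈ D.vertices
  · obtain ⟨W, hW, hTW⟩ := hT
    obtain ⟨u, hu, hr⟩ := hTW.exists_leaf (p := g) (by rw [← Finset.mem_coe, hW]; exact hgv)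
    exact vert_case g hgv u g.1 hu ⟨hgv, routes_of_prefix hr (superTop_prefix_self D u)⟩
      (PolygonalDomain.visible_self (D.vertices_subset_region hgv))
  rcases hg with hg | hg
  -- A point of `V₁` that is not a vertex owns its row: insertion put its `x`-coordinate on a
  -- cut-line, and step 2 added its projections on the path to the root.
  · have : g.1 ∈ cuts T' := by rw [hI.2.2]; exact Or.inr ⟨g, hg, rfl⟩
    obtain ⟨u, hu⟩ := this
    refine ⟨g, hg, u, hu, Or.inl (Or.inl (Or.inl rfl)), fun x hx => Or.inr hx,
      fun m c hm hc hvis => ?_⟩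
    have : ((c, g.2) : Pt) ∈ newType2 D T' g := ⟨⟨hg, hgv⟩, u, m, c, hu, hm, hc, hvis, rfl⟩
    exact ⟨Or.inl (Or.inr this), Or.inr (Set.mem_biUnion hg this)⟩
  · simp only [V3, Set.mem_iUnion] at hg
    obtain ⟨v, hv, u, x, hu, hvu, hvx, rfl⟩ := hg
    exact vert_case v hv u x hu hvu hvx

/-- The case `m = u` of `exists_row_of_mem`: the point is its own projection on its own cut-line. -/
lemma mem_cut_of_mem (hT : IsCutLineTree D T) (hI : IsInsertion D T T') {g : Pt}
    (hg : g ∈ D.V1 ∪ V3 D T) : g ∈ V3 D T ∪ allNewType2 D T' := by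
  obtain ⟨p, hp, u, hu, -, -, h⟩ := exists_row_of_mem hT hI hg
  have hR : g ∈ D.region := hg.elim (fun h => V1_subset_region h) (fun h => V3_subset_region h)
  exact (h u g.1 (List.prefix_refl u) hu (PolygonalDomain.visible_self hR)).2

/-- Step 1 joins a point directly only to projections outside `V₁`. If the projection is in `V₁`,
both points are Steiner points on one cut-line and the walk follows that line. -/
lemma walkLE_vertProj (hT : IsCutLineTree D T) (hI : IsInsertion D T T') {a b : Pt}
    (ha : a ∈ D.V1 ∪ V3 D T) (hb : D.IsVertProj a b) : WalkLE (G2 D T T') a b (l1Dist a b) := by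
  have h1 : a.1 = b.1 := (IsVertProj.fst_eq hb).symm
  by_cases hab : a = b
  · subst hab
    exact walkLE_refl a
  by_cases hbV : b ∈ D.V1
  · exact walkLE_cut (mem_cut_of_mem hT hI ha) (mem_cut_of_mem hT hI (Or.inl hbV)) h1
      (IsVertProj.visible hb)
  · refine walkLE_of_adj (G2_adj_of_snd_ne (fun h => hab (Prod.ext h1 h)) (Or.inr (Or.inl ?_)))
    rw [step1, SimpleGraph.fromRel_adj]
    exact ⟨hab, Or.inl (Or.inl ⟨ha, Or.inr hb, hbV⟩)⟩

lemma rect_subset_of_tri {a b : Pt} (h : tri b a (a.1, b.2) ⊆ D.region)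
    (h' : tri a b (b.1, a.2) ⊆ D.region) : rect a b ⊆ D.region := by
  rintro ⟨z1, z2⟩ ⟨hz1, hz2⟩
  rw [← segment_eq_uIcc, segment_eq_image'] at hz1 hz2
  obtain ⟨s, hs, e1⟩ := hz1
  obtain ⟨t, ht, e2⟩ := hz2
  simp only [smul_eq_mul] at e1 e2
  subst e1 e2
  rcases le_total s t with hst | hst
  · refine h ⟨1 - s, t - s, by linarith, by linarith [ht.2], by linarith [hs.1], ?_⟩
    ext <;> simp <;> ring
  · refine h' ⟨s, s - t, by linarith, by linarith [ht.1], hs.2, ?_⟩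
    ext
    · simp
    · simp
      ring

/-- Projecting both points on the cut-line at the lowest common ancestor gives a monotone path of
two row parts and one part of the cut-line, all in the free box. -/
lemma walkLE_of_rect (hT : IsCutLineTree D T) (hI : IsInsertion D T T') {a b : Pt}
    (ha : a ∈ D.V1 ∪ V3 D T) (hb : b ∈ D.V1 ∪ V3 D T) (hR : rect a b ⊆ D.region) :
    WalkLE (G2 D T T') a b (l1Dist a b) := by
  obtain ⟨p, hp, u, hu, hap, -, hrow⟩ := exists_row_of_mem hT hI ha
  obtain ⟨p', hp', u', hu', hbp, -, hrow'⟩ := exists_row_of_mem hT hI hb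
  obtain ⟨m, c, hm, hm', hc, hcI⟩ := hI.2.1.exists_common_prefix hu hu'
  have hA : ((c, a.2) : Pt) ∈ rect a b := ⟨hcI, left_mem_uIcc⟩
  have hB : ((c, b.2) : Pt) ∈ rect a b := ⟨hcI, right_mem_uIcc⟩
  have hvis : ∀ {x y : Pt}, x ∈ rect a b → y ∈ rect a b → D.Visible x y := fun hx hy =>
    PolygonalDomain.visible_of_convex (convex_rect a b) hR hx hy
  obtain ⟨h1, h2⟩ := hrow m c hm hc (hvis (left_mem_rect a b) hA)
  obtain ⟨h1', h2'⟩ := hrow' m c hm' hc (hvis (right_mem_rect a b) hB)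
  have w1 := walkLE_row hp hap h1
  have w2 := walkLE_cut h2 h2' rfl (hvis hA hB)
  have w3 := walkLE_row hp' h1' hbp
  refine ((w1.trans w2).trans w3).mono ?_
  have := abs_sub_add_of_mem_uIcc hcI
  simp only [l1Dist, sub_self, abs_zero]
  linarith

/-- Two visible vertices of `G₁` are connected in `G₂` by a walk that is as short as possible. -/
theorem walkLE_of_visible (hD : D.GeneralPosition) (hT : IsCutLineTree D T)
    (hI : IsInsertion D T T') : ∀ (k : ℕ) (a b : Pt),
    ((D.vertices ∩ rect a b) \ {a, b}).ncard = k → a ∈ D.V1 ∪ V3 D T → b ∈ D.V1 ∪ V3 D T →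
      D.Visible a b → WalkLE (G2 D T T') a b (l1Dist a b) := by
  intro k
  induction k using Nat.strong_induction_on with
  | _ k ih =>
  intro a b hk ha hb hab
  -- The boxes of `a, v` and of `v, b` lie in the box of `a, b`, omit the opposite end point, and no
  -- longer count `v`.
  have hbetween : ∀ v ∈ D.vertices, v ∈ rect a b → v ≠ a → v ≠ b → D.Visible a v →
      D.Visible v b → WalkLE (G2 D T T') a b (l1Dist a b) := by
    intro v hv hvr hva hvb hav hvb'
    have hvg : v ∈ D.V1 ∪ V3 D T := Or.inl (Or.inl hv)
    have hadd := l1Dist_add_of_mem_rect hvr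
    have hfin : ((D.vertices ∩ rect a b) \ {a, b}).Finite :=
      D.vertices_finite.subset fun _ h => h.1.1
    have hs1 : rect a v ⊆ rect a b := fun z hz =>
      ⟨uIcc_subset_uIcc left_mem_uIcc hvr.1 hz.1, uIcc_subset_uIcc left_mem_uIcc hvr.2 hz.2⟩
    have hs2 : rect v b ⊆ rect a b := fun z hz =>
      ⟨uIcc_subset_uIcc hvr.1 right_mem_uIcc hz.1, uIcc_subset_uIcc hvr.2 right_mem_uIcc hz.2⟩
    have hb' : b ∉ rect a v := by
      intro h
      have := l1Dist_add_of_mem_rect h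
      have h3 := l1Dist_nonneg v b
      rw [l1Dist_comm b v] at this
      exact hvb (eq_of_l1Dist_eq_zero (by linarith))
    have ha' : a ∉ rect v b := by
      intro h
      have := l1Dist_add_of_mem_rect h
      have h3 := l1Dist_nonneg a v
      rw [l1Dist_comm v a] at this
      exact hva (eq_of_l1Dist_eq_zero (by linarith)).symm
    have hlt1 : ((D.vertices ∩ rect a v) \ {a, v}).ncard < k := by
      rw [← hk]
      refine Set.ncard_lt_ncard ⟨?_, fun hsub => ?_⟩ hfin
      · rintro z ⟨⟨hz1, hz2⟩, hz3⟩
        refine ⟨⟨hz1, hs1 hz2⟩, ?_⟩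
        rintro (rfl | rfl)
        · exact hz3 (Or.inl rfl)
        · exact hb' hz2
      · exact (hsub ⟨⟨hv, hvr⟩, by simp [hva, hvb]⟩).2 (Or.inr rfl)
    have hlt2 : ((D.vertices ∩ rect v b) \ {v, b}).ncard < k := by
      rw [← hk]
      refine Set.ncard_lt_ncard ⟨?_, fun hsub => ?_⟩ hfin
      · rintro z ⟨⟨hz1, hz2⟩, hz3⟩
        refine ⟨⟨hz1, hs2 hz2⟩, ?_⟩
        rintro (rfl | rfl)
        · exact ha' hz2
        · exact hz3 (Or.inr rfl)
      · exact (hsub ⟨⟨hv, hvr⟩, by simp [hva, hvb]⟩).2 (Or.inl rfl)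
    exact ((ih _ hlt1 a v rfl ha hvg hav).trans (ih _ hlt2 v b rfl hvg hb hvb')).mono hadd.le
  -- Stated for any two points because it is used in both directions. The last piece lies in the row
  -- that contains `b`, which also contains its horizontal projections.
  have hdetour : ∀ {a b : Pt}, a ∈ D.V1 ∪ V3 D T → b ∈ D.V1 ∪ V3 D T → D.HasEdgeDetour a b →
      WalkLE (G2 D T T') a b (l1Dist a b) := by
    rintro a b ha hb ⟨a', x, e, he, ha'e, hxe, ha', hx, hlen⟩
    have w1 : WalkLE (G2 D T T') a a' (l1Dist a a') := by
      rcases ha' with rfl | ha'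
      · exact walkLE_refl _
      · exact walkLE_vertProj hT hI ha ha'
    have ha'S : a' ∈ D.V1 ∪ V3 D T ∪ newType1 D T := by
      rcases ha' with rfl | ha'
      · exact Or.inl ha
      · exact Or.inr ⟨a, ha, Or.inr ha'⟩
    have hxS : x ∈ D.V1 ∪ V3 D T ∪ newType1 D T := by
      rcases hx with rfl | hx
      · exact Or.inl hb
      · exact Or.inr ⟨b, hb, Or.inl hx⟩
    have w3 : WalkLE (G2 D T T') x b (l1Dist x b) := by
      obtain ⟨p, hp, u, -, hbp, hproj, -⟩ := exists_row_of_mem hT hI hb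
      rcases hx with rfl | hx
      · exact walkLE_refl _
      · exact walkLE_row hp (hproj x hx) hbp
    exact ((w1.trans (walkLE_edge hD he ha'S hxS ha'e hxe)).trans w3).mono hlen.le
  -- Exchanging the two points treats the opposite corner, hence the other half of the box.
  rcases PolygonalDomain.corner_trichotomy hD hab with h1 | ⟨v, hv, hvr, hva, hvb, h2, h3⟩ | h1
  · rcases PolygonalDomain.corner_trichotomy hD hab.symm with h2 | ⟨v, hv, hvr, hvb, hva, h2, h3⟩ | h2
    · exact walkLE_of_rect hT hI ha hb (rect_subset_of_tri h1 h2)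
    · refine hbetween v hv ?_ hva hvb h3.symm h2.symm
      exact ⟨by rw [uIcc_comm]; exact hvr.1, by rw [uIcc_comm]; exact hvr.2⟩
    · rw [l1Dist_comm]
      exact (hdetour hb ha h2).symm
  · exact hbetween v hv hvr hva hvb h2 h3
  · exact hdetour ha hb h1

lemma walkLE_of_chain (hD : D.GeneralPosition) (hT : IsCutLineTree D T)
    (hI : IsInsertion D T T') {p q : Pt} {L : ℝ} (h : Chain D p q L) (hp : p ∈ D.V1 ∪ V3 D T)
    (hq : q ∈ D.V1 ∪ V3 D T) : WalkLE (G2 D T T') p q L := by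
  induction h with
  | single h => exact walkLE_of_visible hD hT hI _ _ _ rfl hp hq h
  | cons h hv _ ih =>
    have hvg : _ ∈ D.V1 ∪ V3 D T := Or.inl (Or.inl hv)
    exact (walkLE_of_visible hD hT hI _ _ _ rfl hp hvg h).trans (ih hvg hq)

lemma walkLE_of_isPathIn (hD : D.GeneralPosition) (hT : IsCutLineTree D T)
    (hI : IsInsertion D T T') {p q : Pt} (hp : p ∈ D.V1 ∪ V3 D T) (hq : q ∈ D.V1 ∪ V3 D T)
    {l : List Pt} (h : IsPathIn D p q l) : WalkLE (G2 D T T') p q (l1Length l) := by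
  obtain ⟨L, hL, hch⟩ := exists_chain_of_isPathIn h
  exact (walkLE_of_chain hD hT hI hch hp hq).mono hL

/-! ### The edges of `G₂` lie in the domain -/

lemma CutAdj.visible {S : Set Pt} {a b : Pt} (h : CutAdj D S a b) : D.Visible a b := by
  obtain ⟨_, _, h⟩ := h
  exact h

lemma EdgeAdj.visible {S : Set Pt} {a b : Pt} (h : EdgeAdj D S a b) : D.Visible a b := by
  obtain ⟨e, he, h⟩ := h
  exact ((PolygonalDomain.convex_edge he).segment_subset h.1.2 h.2.1.2).trans
    (D.edge_subset_region he)

lemma G2_visible {a b : Pt} (h : (G2 D T T').Adj a b) : D.Visible a b := by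
  have key : ∀ {r : Pt → Pt → Prop}, (∀ a b, r a b → D.Visible a b) → ∀ {a b},
      (SimpleGraph.fromRel r).Adj a b → D.Visible a b := by
    intro r hr a b h
    rw [SimpleGraph.fromRel_adj] at h
    exact h.2.elim (hr a b) fun h => (hr b a h).symm
  rcases h with ⟨(h | h) | h, -⟩ | h
  · refine key ?_ h
    rintro a b (⟨-, h | ⟨v, c, -, -, h, rfl⟩⟩ | h | h)
    exacts [IsProj.visible h, h, EdgeAdj.visible h, CutAdj.visible h]
  · refine key ?_ h
    rintro a b (⟨-, h, -⟩ | h)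
    exacts [IsProj.visible h, EdgeAdj.visible h]
  · refine key ?_ h
    rintro a b (⟨-, u, v, c, -, -, -, h, rfl⟩ | h)
    exacts [h, CutAdj.visible h]
  · refine key ?_ h
    rintro a b ⟨p, hp, h⟩
    exact (steinerRow_visible (V1_subset_region hp) h.1 h.2.1).2

lemma isPathIn_support {p q : Pt} (hp : p ∈ D.region) (w : (G2 D T T').Walk p q) :
    IsPathIn D p q w.support := by
  induction w with
  | nil => exact ⟨rfl, rfl, by simp [hp], List.isChain_singleton _⟩
  | @cons a b c h w ih =>
    have hv := G2_visible h
    obtain ⟨h1, h2, h3, h4⟩ := ih hv.right_mem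
    rw [SimpleGraph.Walk.support_cons]
    refine ⟨rfl, ?_, ?_, ?_⟩
    · cases w with
      | nil => rfl
      | cons h' w' => simpa using h2
    · intro z hz
      rcases List.mem_cons.1 hz with rfl | hz
      exacts [hp, h3 z hz]
    · cases w with
      | nil => simp [hv]
      | cons h' w' =>
        rw [SimpleGraph.Walk.support_cons] at h4 ⊢
        exact List.isChain_cons_cons.2 ⟨hv, h4⟩

/-! ### The vertices of `G₂` -/

lemma steinerRow_subset {p : Pt} (hp : p ∈ D.V1) : steinerRow D T T' p ⊆ G2Vertices D T T' := by
  rintro q (((hq | hq) | hq) | hq)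
  · rw [Set.mem_singleton_iff.1 hq]
    exact Or.inl (Or.inl (Or.inl hp))
  · have hpv : p ∈ D.vertices := by
      obtain ⟨v, c, -, h, -⟩ := hq
      exact h.1
    exact Or.inl (Or.inl (Or.inr (Set.mem_biUnion hpv hq)))
  · exact Or.inr (Set.mem_biUnion hp hq)
  · exact Or.inl (Or.inr ⟨p, Or.inl hp, Or.inl hq⟩)

lemma G2_adj_mem {a b : Pt} (h : (G2 D T T').Adj a b) :
    a ∈ G2Vertices D T T' ∧ b ∈ G2Vertices D T T' := by
  have key : ∀ {r : Pt → Pt → Prop},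
      (∀ a b, r a b → a ∈ G2Vertices D T T' ∧ b ∈ G2Vertices D T T') → ∀ {a b},
      (SimpleGraph.fromRel r).Adj a b → a ∈ G2Vertices D T T' ∧ b ∈ G2Vertices D T T' := by
    intro r hr a b h
    rw [SimpleGraph.fromRel_adj] at h
    exact h.2.elim (hr a b) fun h => (hr b a h).symm
  have hedge : ∀ {S : Set Pt} {a b}, S ⊆ G2Vertices D T T' → EdgeAdj D S a b →
      a ∈ G2Vertices D T T' ∧ b ∈ G2Vertices D T T' := by
    rintro S a b hS ⟨e, he, h⟩
    exact ⟨hS h.1.1, hS h.2.1.1⟩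
  have hcut : ∀ {S : Set Pt} {a b}, S ⊆ G2Vertices D T T' → CutAdj D S a b →
      a ∈ G2Vertices D T T' ∧ b ∈ G2Vertices D T T' := by
    rintro S a b hS ⟨e, h, -⟩
    exact ⟨hS h.1.1, hS h.2.1.1⟩
  rcases h with ⟨(h | h) | h, -⟩ | h
  · refine key ?_ h
    rintro a b (⟨ha, h⟩ | h | h)
    · refine ⟨Or.inl (Or.inl (Or.inl (Or.inl ha))), ?_⟩
      rcases h with h | h
      · exact Or.inl (Or.inl (Or.inl (Or.inr ⟨a, ha, h⟩)))
      · exact Or.inl (Or.inl (Or.inr (Set.mem_biUnion ha h)))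
    · exact hedge (fun z hz => Or.inl (Or.inl hz)) h
    · exact hcut (fun z hz => Or.inl (Or.inl (Or.inr hz))) h
  · refine key ?_ h
    rintro a b (⟨ha, h, -⟩ | h)
    · exact ⟨Or.inl (Or.inl ha), Or.inl (Or.inr ⟨a, ha, h⟩)⟩
    · exact hedge (fun z hz => Or.inl hz) h
  · refine key ?_ h
    rintro a b (h | h)
    · have ha : a ∈ D.V1 := h.1.1
      exact ⟨Or.inl (Or.inl (Or.inl ha)), Or.inr (Set.mem_biUnion ha h)⟩
    · exact hcut (fun z hz => hz.elim (fun h => Or.inl (Or.inl (Or.inr h))) Or.inr) h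
  · refine key ?_ h
    rintro a b ⟨p, hp, h⟩
    exact ⟨steinerRow_subset hp h.1, steinerRow_subset hp h.2.1⟩

lemma G2_support_subset : (G2 D T T').support ⊆ G2Vertices D T T' := by
  rintro a ⟨b, h⟩
  exact (G2_adj_mem h).1

end L1Domain

namespace L1Domain
open Set Filter Topology

/-! ### The domain is connected -/

lemma isCompact_boundary {m : ℕ} (Q : Polygon Pt m) : IsCompact (Q.boundary ℝ) := by
  refine isCompact_iUnion fun i => ?_
  rw [edgeSet_eq_segment, ← convexHull_pair]
  exact Set.Finite.isCompact_convexHull ℝ (by simp)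

lemma not_inside_of_right {m : ℕ} {Q : Polygon Pt m} {M : ℝ} (hM : ∀ z ∈ Q.boundary ℝ, z.1 ≤ M)
    {z : Pt} (hz : M < z.1) : z ∉ inside Q := by
  refine not_inside_of_ray (d := (1, 0)) (by simp) fun t ht h => ?_
  have := hM _ h
  simp at this
  linarith

lemma exists_fst_le_region (D : PolygonalDomain) : ∃ M : ℝ, ∀ z ∈ D.region, z.1 ≤ M := by
  obtain ⟨M, hM⟩ := ((isCompact_boundary D.outer).image continuous_fst).bddAbove
  have hM' : ∀ z ∈ D.outer.boundary ℝ, z.1 ≤ M := fun z hz => hM ⟨z, hz, rfl⟩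
  refine ⟨M, fun z hz => ?_⟩
  rcases hz.1 with h | h
  · exact hM' z h
  · by_contra! hlt
    exact not_inside_of_right hM' hlt h

/-- Two points are joined by a polygonal path in the domain. -/
def Reach (D : PolygonalDomain) : Pt → Pt → Prop := Relation.ReflTransGen fun a b => D.Visible a b

lemma Reach.symm {D : PolygonalDomain} {a b : Pt} (h : Reach D a b) : Reach D b a := by
  induction h with
  | refl => exact Relation.ReflTransGen.refl
  | tail _ h ih => exact Relation.ReflTransGen.head h.symm ih

lemma Reach.exists_isPathIn {D : PolygonalDomain} {a b : Pt} (ha : a ∈ D.region)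
    (h : Reach D a b) : ∃ l, IsPathIn D a b l := by
  induction h using Relation.ReflTransGen.head_induction_on with
  | refl => exact ⟨[b], rfl, rfl, by simpa using ha, List.isChain_singleton _⟩
  | @head a c hac _ ih =>
    obtain ⟨l, h1, h2, h3, h4⟩ := ih hac.right_mem
    cases l with
    | nil => simp at h1
    | cons d l =>
      obtain rfl : d = c := by simpa using h1
      refine ⟨a :: d :: l, rfl, by simpa using h2, ?_, List.isChain_cons_cons.2 ⟨hac, h4⟩⟩
      intro z hz
      rcases List.mem_cons.1 hz with rfl | hz
      exacts [ha, h3 z hz]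

lemma exists_right_stop (D : PolygonalDomain) {z : Pt} (hz : z ∈ D.region) :
    ∃ x, D.Visible z x ∧ z.1 ≤ x.1 ∧ (D.Moves z (1, 0) → z.1 < x.1) ∧ ∃ e ∈ D.edges, x ∈ e := by
  obtain ⟨M, hM⟩ := exists_fst_le_region D
  -- The tested segment is long enough to leave the bounded domain, so it must be blocked before its
  -- end.
  have hk : 0 < |M - z.1| + 1 := by positivity
  set k := |M - z.1| + 1 with hkdef
  set g : Pt := k • ((1, 0) : Pt) with hg
  have hg1 : g.1 = k := by simp [hg]
  obtain ⟨σ, hσ, hfar, hor⟩ := PolygonalDomain.exists_farthest z g hz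
  have hσ1 : σ ≠ 1 := by
    intro h
    have := hM _ (hfar σ ⟨hσ.1, le_rfl⟩)
    rw [h, one_smul, Prod.fst_add, hg1] at this
    have := le_abs_self (M - z.1)
    linarith
  have hnm := hor.resolve_left hσ1
  refine ⟨z + σ • g, ?_, ?_, fun hm => ?_,
    PolygonalDomain.exists_edge_of_not_moves (hfar σ ⟨hσ.1, le_rfl⟩) hnm⟩
  · intro y hy
    obtain ⟨t, h0, h1, rfl⟩ := exists_of_mem_segment hy
    have := hfar (t * σ) ⟨mul_nonneg h0 hσ.1, mul_le_of_le_one_left hσ.1 h1⟩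
    convert this using 1
    module
  · simp only [Prod.fst_add, Prod.smul_fst, hg1, smul_eq_mul]
    have := mul_nonneg hσ.1 hk.le
    linarith
  · have hσ0 : 0 < σ := by
      refine lt_of_le_of_ne hσ.1 fun h => hnm ?_
      rw [← h, zero_smul, add_zero]
      exact hm.smul hk
    simp only [Prod.fst_add, Prod.smul_fst, hg1, smul_eq_mul]
    have := mul_pos hσ0 hk
    linarith

lemma finRotate_mk {m k : ℕ} (hk : k + 1 < m) :
    finRotate m ⟨k, by omega⟩ = ⟨k + 1, hk⟩ := by
  obtain ⟨m, rfl⟩ : ∃ m', m = m' + 1 := ⟨m - 1, by omega⟩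
  exact finRotate_of_lt (by omega)

lemma reach_boundary (D : PolygonalDomain) (o : Option (Fin D.h)) {a b : Pt}
    (ha : a ∈ (D.poly o).boundary ℝ) (hb : b ∈ (D.poly o).boundary ℝ) : Reach D a b := by
  have hm := (D.poly_simple o).three_le
  have hedge : ∀ i {x y}, x ∈ (D.poly o).edgeSet ℝ i → y ∈ (D.poly o).edgeSet ℝ i →
      D.Visible x y := by
    intro i x y hx hy
    have he := D.mem_edges.2 ⟨o, i, rfl⟩
    exact PolygonalDomain.visible_of_convex (PolygonalDomain.convex_edge he)
      (D.edge_subset_region he) hx hy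
  have hvert : ∀ k (hk : k < D.size o),
      Reach D ((D.poly o).vertices ⟨0, by omega⟩) ((D.poly o).vertices ⟨k, hk⟩) := by
    intro k
    induction k with
    | zero => intro _; exact Relation.ReflTransGen.refl
    | succ k ih =>
      intro hk
      refine (ih (by omega)).tail (hedge ⟨k, by omega⟩ (left_mem_edgeSet _ _) ?_)
      convert right_mem_edgeSet (D.poly o) ⟨k, by omega⟩ using 2
      exact (finRotate_mk hk).symm
  have hone : ∀ {a}, a ∈ (D.poly o).boundary ℝ →
      Reach D ((D.poly o).vertices ⟨0, by omega⟩) a := by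
    intro a ha
    obtain ⟨i, hi⟩ := Set.mem_iUnion.1 ha
    exact (hvert i.1 i.2).tail (hedge i (left_mem_edgeSet _ _) hi)
  exact (hone ha).symm.trans (hone hb)

lemma boundary_nonempty (D : PolygonalDomain) (o : Option (Fin D.h)) :
    ((D.poly o).boundary ℝ).Nonempty := by
  have := (D.poly_simple o).three_le
  exact ⟨_, Set.mem_iUnion.2 ⟨⟨0, by omega⟩, left_mem_edgeSet _ _⟩⟩

lemma mem_boundary_of_mem_edge (D : PolygonalDomain) {z : Pt} {e : Set Pt} (he : e ∈ D.edges)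
    (hz : z ∈ e) : ∃ o, z ∈ (D.poly o).boundary ℝ := by
  obtain ⟨o, i, rfl⟩ := D.mem_edges.1 he
  exact ⟨o, Set.mem_iUnion.2 ⟨i, hz⟩⟩

/-- Near `r` the outer interior is open and the other holes keep a positive distance, while nothing
strictly to the right of a rightmost point is enclosed by the hole itself. -/
lemma moves_right_of_hole (D : PolygonalDomain) (j : Fin D.h) {r : Pt}
    (hr : r ∈ (D.hole j).boundary ℝ) (hmax : ∀ z ∈ (D.hole j).boundary ℝ, z.1 ≤ r.1) :
    D.Moves r (1, 0) := by
  have hin := D.hole_inside j (Or.inl hr)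
  obtain ⟨r₁, hr₁, hb₁⟩ := Metric.isOpen_iff.1 (isOpen_inside D.outer) r hin
  have hcl : IsClosed (⋃ i ∈ {i | i ≠ j}, closedInside (D.hole i)) :=
    (Set.toFinite _).isClosed_biUnion fun i _ => isClosed_closedInside _
  have hnot : r ∉ ⋃ i ∈ {i | i ≠ j}, closedInside (D.hole i) := by
    intro h
    simp only [Set.mem_iUnion] at h
    obtain ⟨i, hi, h⟩ := h
    exact Set.disjoint_left.1 (D.hole_disjoint i j hi) h (Or.inl hr)
  obtain ⟨r₂, hr₂, hb₂⟩ := Metric.isOpen_iff.1 hcl.isOpen_compl r hnot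
  obtain ⟨ε, hε, hm⟩ := exists_move_mem_ball r (1, 0) (lt_min hr₁ hr₂)
  refine ⟨ε, hε, fun η hη => ?_⟩
  have hball := hm η (by rw [abs_of_nonneg hη.1]; exact hη.2)
  refine ⟨Or.inr (hb₁ (Metric.ball_subset_ball (min_le_left _ _) hball)), fun h => ?_⟩
  obtain ⟨i, hi⟩ := Set.mem_iUnion.1 h
  by_cases hij : i = j
  · subst hij
    rcases hη.1.eq_or_lt with h0 | h0
    · rw [← h0, zero_smul, add_zero] at hi
      exact hi.1 hr
    · exact not_inside_of_right hmax (by simpa using h0) hi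
  · exact hb₂ (Metric.ball_subset_ball (min_le_right _ _) hball)
      (Set.mem_biUnion (show i ∈ {i | i ≠ j} from hij) (Or.inr hi))

lemma reach_outer_of_hole (D : PolygonalDomain) (j : Fin D.h) :
    ∃ a ∈ (D.hole j).boundary ℝ, ∃ b ∈ D.outer.boundary ℝ, Reach D a b := by
  have hr : ∀ j, ∃ r ∈ (D.hole j).boundary ℝ, ∀ z ∈ (D.hole j).boundary ℝ, z.1 ≤ r.1 := fun j =>
    (isCompact_boundary (D.hole j)).exists_isMaxOn (boundary_nonempty D (some j))
      continuous_fst.continuousOn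
  choose r hrb hrmax using hr
  by_contra hcon
  -- Among the holes not joined to the outer polygon take one whose rightmost point is farthest
  -- right. Going right from there reaches the outer polygon, a hole already joined, or a hole
  -- reaching farther right, and each is impossible.
  obtain ⟨i, hi, hmax⟩ := Set.exists_max_image
    {j | ¬ ∃ a ∈ (D.hole j).boundary ℝ, ∃ b ∈ D.outer.boundary ℝ, Reach D a b}
    (fun j => (r j).1) (Set.toFinite _) ⟨j, hcon⟩
  have hrR : r i ∈ D.region := by
    obtain ⟨k, hk⟩ := Set.mem_iUnion.1 (hrb i)
    exact D.edge_subset_region (Or.inr ⟨i, k, rfl⟩) hk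
  obtain ⟨x, hvis, -, hlt, e, he, hxe⟩ := exists_right_stop D hrR
  have hlt := hlt (moves_right_of_hole D i (hrb i) (hrmax i))
  obtain ⟨o, ho⟩ := mem_boundary_of_mem_edge D he hxe
  rcases o with _ | k
  · exact hi ⟨r i, hrb i, x, ho, Relation.ReflTransGen.single hvis⟩
  · by_cases hk : ∃ a ∈ (D.hole k).boundary ℝ, ∃ b ∈ D.outer.boundary ℝ, Reach D a b
    · obtain ⟨a, ha, b, hb, hab⟩ := hk
      exact hi ⟨r i, hrb i, b, hb, (Relation.ReflTransGen.single hvis).trans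
        ((reach_boundary D (some k) ho ha).trans hab)⟩
    · have h1 := hmax k hk
      have h2 := hrmax k x ho
      linarith

lemma reach_of_mem_region (D : PolygonalDomain) {p q : Pt} (hp : p ∈ D.region)
    (hq : q ∈ D.region) : Reach D p q := by
  obtain ⟨b₀, hb₀⟩ := boundary_nonempty D none
  have key : ∀ {z}, z ∈ D.region → Reach D z b₀ := by
    intro z hz
    obtain ⟨x, hvis, -, -, e, he, hxe⟩ := exists_right_stop D hz
    obtain ⟨o, ho⟩ := mem_boundary_of_mem_edge D he hxe
    refine (Relation.ReflTransGen.single hvis).trans ?_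
    rcases o with _ | k
    · exact reach_boundary D none ho hb₀
    · obtain ⟨a, ha, b, hb, hab⟩ := reach_outer_of_hole D k
      exact (reach_boundary D (some k) ho ha).trans (hab.trans (reach_boundary D none hb hb₀))
  exact (key hp).trans (key hq).symm

/-- Shortest paths in `G₂` between vertices of `G₁` exist and are shortest paths in the domain. -/
theorem G2_shortest_paths {D : PolygonalDomain} {T T' : BinaryTree ℝ} (hD : D.GeneralPosition)
    (hT : IsCutLineTree D T) (hI : IsInsertion D T T') {p q : Pt} (hp : p ∈ D.V1 ∪ V3 D T)
    (hq : q ∈ D.V1 ∪ V3 D T) :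
    (∃ w : (G2 D T T').Walk p q, IsShortestWalk w) ∧
      ∀ w : (G2 D T T').Walk p q, IsShortestWalk w → IsShortestPathIn D p q w.support := by
  have hR : ∀ {z}, z ∈ D.V1 ∪ V3 D T → z ∈ D.region := fun h =>
    h.elim (fun h => V1_subset_region h) fun h => V3_subset_region h
  constructor
  · obtain ⟨l, hl⟩ := (reach_of_mem_region D (hR hp) (hR hq)).exists_isPathIn (hR hp)
    obtain ⟨w, -⟩ := walkLE_of_isPathIn hD hT hI hp hq hl
    exact exists_isShortestWalk ((G2Vertices_finite D T T').subset G2_support_subset) w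
  · refine fun w hw => ⟨isPathIn_support (hR hp) w, fun l hl => ?_⟩
    obtain ⟨w', hw'⟩ := walkLE_of_isPathIn hD hT hI hp hq hl
    exact (hw w').trans hw'

end L1Domain

namespace L1Domain
open Set Filter Topology

/-! ### Construction of cut-line trees -/

lemma exists_lower_subset {α : Type*} [DecidableEq α] (f : α → ℝ) (W : Finset α)
    (hf : Set.InjOn f W) : ∀ k ≤ W.card, ∃ A ⊆ W, A.card = k ∧ ∀ a ∈ A, ∀ b ∈ W \ A, f a < f b := by
  intro k
  induction k with
  | zero => exact fun _ => ⟨∅, by simp⟩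
  | succ k ih =>
    intro hk
    obtain ⟨A, hA, hc, hlt⟩ := ih (by omega)
    have hne : (W \ A).Nonempty := by
      rw [← Finset.card_pos, Finset.card_sdiff_of_subset hA]
      omega
    obtain ⟨m, hm, hmin⟩ := Finset.exists_min_image (W \ A) f hne
    rw [Finset.mem_sdiff] at hm
    refine ⟨insert m A, Finset.insert_subset hm.1 hA, by rw [Finset.card_insert_of_notMem hm.2, hc],
      ?_⟩
    intro a ha b hb
    rw [Finset.mem_sdiff, Finset.mem_insert, not_or] at hb
    have hb' : b ∈ W \ A := Finset.mem_sdiff.2 ⟨hb.1, hb.2.2⟩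
    rcases Finset.mem_insert.1 ha with rfl | ha
    · refine lt_of_le_of_ne (hmin b hb') fun h => hb.2.1 ?_
      exact (hf hm.1 hb.1 h).symm
    · exact hlt a ha b hb'

lemma exists_isCutTree : ∀ (k : ℕ) (W : Finset Pt), W.card = k → W.Nonempty →
    Set.InjOn Prod.fst (W : Set Pt) → ∃ T, IsCutTree T W := by
  intro k
  induction k using Nat.strong_induction_on with
  | _ k ih =>
  intro W hk hne hinj
  by_cases h1 : k = 1
  · obtain ⟨p, rfl⟩ := Finset.card_eq_one.1 (hk.trans h1)
    exact ⟨_, .leaf p⟩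
  have hpos := Finset.card_pos.2 hne
  obtain ⟨A, hA, hc, hlt⟩ := exists_lower_subset Prod.fst W hinj (k / 2) (by omega)
  have hcB : (W \ A).card = k - k / 2 := by rw [Finset.card_sdiff_of_subset hA, hk, hc]
  have hAne : A.Nonempty := Finset.card_pos.1 (by omega)
  have hBne : (W \ A).Nonempty := Finset.card_pos.1 (by omega)
  obtain ⟨a, ha, hamax⟩ := Finset.exists_max_image A Prod.fst hAne
  obtain ⟨b, hb, hbmin⟩ := Finset.exists_min_image (W \ A) Prod.fst hBne
  have hab := hlt a ha b hb
  obtain ⟨l, hl⟩ := ih _ (by omega) A hc hAne (hinj.mono (by exact_mod_cast hA))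
  obtain ⟨r, hr⟩ := ih _ (by omega) (W \ A) hcB hBne
    (hinj.mono (by exact_mod_cast Finset.sdiff_subset))
  refine ⟨.node ((a.1 + b.1) / 2) l r, ?_⟩
  have := IsCutTree.node ((a.1 + b.1) / 2) l r A (W \ A)
    (fun x hx => by linarith [hamax x hx]) (fun x hx => by linarith [hbmin x hx])
    (by omega) (by omega) hl hr
  rwa [Finset.union_sdiff_of_subset hA] at this

lemma IsCutTree.nonempty {T : BinaryTree ℝ} {W : Finset Pt} (h : IsCutTree T W) : W.Nonempty := by
  induction h with
  | leaf p => simp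
  | node c l r A B _ _ _ _ _ _ ihl _ => exact ihl.mono Finset.subset_union_left

/-- The second part, that all cuts lie within the range of the `x`-coordinates of `W`, is what the
induction needs to compare the cuts of a subtree with its parent. -/
lemma IsCutTree.isSearchTree {T : BinaryTree ℝ} {W : Finset Pt} (h : IsCutTree T W) :
    IsSearchTree T ∧ ∀ x ∈ cuts T, (∃ p ∈ W, p.1 ≤ x) ∧ ∃ q ∈ W, x ≤ q.1 := by
  induction h with
  | leaf p => simp [IsSearchTree, cuts_node, cuts_nil]
  | node c l r A B hA hB _ _ hl hr ihl ihr =>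
    refine ⟨⟨fun x hx => ?_, fun x hx => ?_, ihl.1, ihr.1⟩, fun x hx => ?_⟩
    · obtain ⟨q, hq, hxq⟩ := (ihl.2 x hx).2
      exact hxq.trans_lt (hA q hq)
    · obtain ⟨q, hq, hxq⟩ := (ihr.2 x hx).1
      exact (hB q hq).trans_le hxq
    · obtain ⟨a, ha⟩ := hl.nonempty
      obtain ⟨b, hb⟩ := hr.nonempty
      rw [cuts_node] at hx
      rcases hx with rfl | hx | hx
      · exact ⟨⟨a, Finset.mem_union_left _ ha, (hA a ha).le⟩,
          ⟨b, Finset.mem_union_right _ hb, (hB b hb).le⟩⟩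
      · obtain ⟨⟨p, hp, h1⟩, ⟨q, hq, h2⟩⟩ := ihl.2 x hx
        exact ⟨⟨p, Finset.mem_union_left _ hp, h1⟩, ⟨q, Finset.mem_union_left _ hq, h2⟩⟩
      · obtain ⟨⟨p, hp, h1⟩, ⟨q, hq, h2⟩⟩ := ihr.2 x hx
        exact ⟨⟨p, Finset.mem_union_right _ hp, h1⟩, ⟨q, Finset.mem_union_right _ hq, h2⟩⟩

lemma IsCutTree.height_le {T : BinaryTree ℝ} {W : Finset Pt} (h : IsCutTree T W) :
    ∀ k, W.card ≤ 2 ^ k → T.height ≤ k + 1 := by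
  induction h with
  | leaf p => simp
  | node c l r A B hA hB hAB hBA hl hr ihl ihr =>
    intro k hk
    have hd : Disjoint A B := Finset.disjoint_left.2 fun x hx hx' =>
      lt_asymm (hA x hx) (hB x hx')
    rw [Finset.card_union_of_disjoint hd] at hk
    have h1 := Finset.card_pos.2 hl.nonempty
    have h2 := Finset.card_pos.2 hr.nonempty
    cases k with
    | zero => simp at hk; omega
    | succ k =>
      rw [pow_succ] at hk
      -- From `A.card ≤ B.card + 1` and a total of at most `2 ^ k * 2`, parity gives `A.card ≤ 2 ^
      -- k`, and symmetrically for `B`.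
      have h3 := ihl k (by omega)
      have h4 := ihr k (by omega)
      simp only [BinaryTree.height]
      omega

lemma exists_balanced : ∀ (k : ℕ) (X : Finset ℝ), X.card < 2 ^ k →
    ∃ t, IsSearchTree t ∧ cuts t = X ∧ t.height ≤ k := by
  intro k
  induction k with
  | zero =>
    intro X hX
    obtain rfl : X = ∅ := Finset.card_eq_zero.1 (by simpa using hX)
    exact ⟨.nil, trivial, by simp [cuts_nil], le_rfl⟩
  | succ k ih =>
    intro X hX
    by_cases h0 : X.card = 0
    · obtain rfl : X = ∅ := Finset.card_eq_zero.1 h0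
      exact ⟨.nil, trivial, by simp [cuts_nil], Nat.zero_le _⟩
    obtain ⟨A, hA, hc, hlt⟩ := exists_lower_subset id X (Set.injOn_id _) (X.card / 2) (by omega)
    have hcB : (X \ A).card = X.card - X.card / 2 := by rw [Finset.card_sdiff_of_subset hA, hc]
    have hBne : (X \ A).Nonempty := Finset.card_pos.1 (by omega)
    obtain ⟨m, hm, hmin⟩ := Finset.exists_min_image (X \ A) id hBne
    rw [pow_succ] at hX
    obtain ⟨l, hl, hlc, hlh⟩ := ih A (by omega)
    obtain ⟨r, hr, hrc, hrh⟩ := ih ((X \ A).erase m) (by rw [Finset.card_erase_of_mem hm]; omega)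
    refine ⟨.node m l r, ⟨?_, ?_, hl, hr⟩, ?_, ?_⟩
    · intro x hx
      rw [hlc] at hx
      exact hlt x hx m hm
    · intro x hx
      rw [hrc] at hx
      have hx' := Finset.mem_erase.1 (Finset.mem_coe.1 hx)
      exact lt_of_le_of_ne (hmin x hx'.2) hx'.1.symm
    · rw [cuts_node, hlc, hrc]
      have hmX := (Finset.mem_sdiff.1 hm)
      ext x
      simp only [Set.mem_insert_iff, Set.mem_union, Finset.mem_coe, Finset.mem_erase,
        Finset.mem_sdiff]
      constructor
      · rintro (rfl | h | h)
        exacts [hmX.1, hA h, h.2.1]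
      · intro h
        by_cases hxm : x = m
        · exact Or.inl hxm
        · by_cases hxA : x ∈ A
          · exact Or.inr (Or.inl hxA)
          · exact Or.inr (Or.inr ⟨hxm, h, hxA⟩)
    · simp only [BinaryTree.height]
      omega

/-- New values sort themselves into the empty subtrees of `T`, each of which is replaced by a
balanced tree. Allowing the size of all of `X` in every gap costs only `k` extra levels. -/
lemma exists_extends {T : BinaryTree ℝ} (hT : IsSearchTree T) {k : ℕ} : ∀ X : Finset ℝ,
    (∀ x ∈ X, x ∉ cuts T) → X.card < 2 ^ k →
    ∃ T', Extends T T' ∧ IsSearchTree T' ∧ cuts T' = cuts T ∪ X ∧ T'.height ≤ T.height + k := by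
  induction T with
  | nil =>
    intro X _ hX
    obtain ⟨t, h1, h2, h3⟩ := exists_balanced k X hX
    exact ⟨t, .nil t, h1, by simp [h2, cuts_nil], by simpa using h3⟩
  | node c l r ihl ihr =>
    intro X hdis hX
    obtain ⟨h1, h2, hl, hr⟩ := hT
    obtain ⟨l', el, sl, cl, hlh⟩ := ihl hl (X.filter (· < c))
      (fun x hx h => hdis x (Finset.mem_filter.1 hx).1 (by rw [cuts_node]; exact Or.inr (Or.inl h)))
      ((Finset.card_filter_le _ _).trans_lt hX)
    obtain ⟨r', er, sr, cr, hrh⟩ := ihr hr (X.filter (c < ·))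
      (fun x hx h => hdis x (Finset.mem_filter.1 hx).1 (by rw [cuts_node]; exact Or.inr (Or.inr h)))
      ((Finset.card_filter_le _ _).trans_lt hX)
    have hcX : c ∉ X := fun h => hdis c h (by rw [cuts_node]; exact Or.inl rfl)
    refine ⟨.node c l' r', .node c l r l' r' el er, ⟨?_, ?_, sl, sr⟩, ?_, ?_⟩
    · intro x hx
      rw [cl] at hx
      rcases hx with hx | hx
      exacts [h1 x hx, (Finset.mem_filter.1 hx).2]
    · intro x hx
      rw [cr] at hx
      rcases hx with hx | hx
      exacts [h2 x hx, (Finset.mem_filter.1 hx).2]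
    · rw [cuts_node, cuts_node, cl, cr]
      ext x
      simp only [Set.mem_insert_iff, Set.mem_union, Finset.mem_coe, Finset.mem_filter]
      constructor
      · rintro (h | (h | h) | (h | h))
        exacts [Or.inl (Or.inl h), Or.inl (Or.inr (Or.inl h)), Or.inr h.1,
          Or.inl (Or.inr (Or.inr h)), Or.inr h.1]
      · rintro ((h | h | h) | h)
        · exact Or.inl h
        · exact Or.inr (Or.inl (Or.inl h))
        · exact Or.inr (Or.inr (Or.inl h))
        · rcases lt_trichotomy x c with hlt | rfl | hlt
          · exact Or.inr (Or.inl (Or.inr ⟨h, hlt⟩))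
          · exact absurd h hcX
          · exact Or.inr (Or.inr (Or.inr ⟨h, hlt⟩))
    · simp only [BinaryTree.height]
      omega

/-! ### Cardinalities -/

lemma ncard_biUnion_le {α β : Type*} {S : Set α} (hS : S.Finite) {f : α → Set β} {k : ℕ}
    (hk : ∀ x ∈ S, (f x).ncard ≤ k) :
    (⋃ x ∈ S, f x).ncard ≤ S.ncard * k := by
  induction S, hS using Set.Finite.induction_on with
  | empty => simp
  | @insert a S ha hS ih =>
    rw [Set.biUnion_insert, Set.ncard_insert_of_notMem ha hS, Nat.succ_mul, add_comm]
    exact (Set.ncard_union_le _ _).trans (Nat.add_le_add (hk a (Or.inl rfl))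
      (ih fun x hx => hk x (Or.inr hx)))

lemma V1_ncard_le (D : PolygonalDomain) : D.V1.ncard ≤ 5 * D.n := by
  have : {q | ∃ p ∈ D.vertices, D.IsProj p q} = ⋃ p ∈ D.vertices, {q | D.IsProj p q} := by
    ext; simp
  rw [PolygonalDomain.V1, this]
  have h1 := D.vertices_ncard_le
  have h2 := ncard_biUnion_le D.vertices_finite fun p _ => (isProj_finite D p).2
  have h3 := Set.ncard_union_le D.vertices (⋃ p ∈ D.vertices, {q | D.IsProj p q})
  omega

lemma one_le_log_n (D : PolygonalDomain) : 1 ≤ Real.log D.n := by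
  have h3 : (3 : ℝ) ≤ D.n := by exact_mod_cast D.three_le_n
  rw [Real.le_log_iff_exp_le (by linarith)]
  exact (Real.exp_one_lt_d9.le.trans (by norm_num)).trans h3

lemma natLog_n_le (D : PolygonalDomain) : (Nat.log 2 D.n : ℝ) ≤ 3 / 2 * Real.log D.n := by
  have h1 : (Nat.log 2 D.n : ℝ) ≤ Real.logb 2 D.n := by
    exact_mod_cast Real.natLog_le_logb D.n 2
  have h2 := Real.log_two_gt_d9
  have h3 := one_le_log_n D
  refine h1.trans ?_
  rw [Real.logb, div_le_iff₀ (by linarith)]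
  nlinarith

lemma card_le_of_coe_eq_vertices {D : PolygonalDomain} {W : Finset Pt}
    (hW : (W : Set Pt) = D.vertices) : W.card ≤ D.n := by
  rw [← Set.ncard_coe_finset, hW]
  exact D.vertices_ncard_le

lemma IsCutLineTree.height_le {D : PolygonalDomain} {T : BinaryTree ℝ} (hT : IsCutLineTree D T) :
    T.height ≤ Nat.log 2 D.n + 2 := by
  obtain ⟨W, hW, h⟩ := hT
  exact h.height_le _ ((card_le_of_coe_eq_vertices hW).trans
    (Nat.lt_pow_succ_log_self one_lt_two D.n).le)

lemma exists_isCutLineTree {D : PolygonalDomain} (hD : D.GeneralPosition) :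
    ∃ T, IsCutLineTree D T := by
  have hcoe : (D.vertices_finite.toFinset : Set Pt) = D.vertices := D.vertices_finite.coe_toFinset
  obtain ⟨T, hT⟩ := exists_isCutTree _ D.vertices_finite.toFinset rfl (by
    have := D.outer_simple.three_le
    exact ⟨D.outer.vertices ⟨0, by omega⟩, by simp [PolygonalDomain.vertices]⟩) (by
    rw [hcoe]
    intro a ha b hb hab
    by_contra hne
    exact (hD a ha b hb hne).1 hab)
  exact ⟨T, _, hcoe, hT⟩

lemma exists_isInsertion {D : PolygonalDomain} {T : BinaryTree ℝ} (hT : IsCutLineTree D T) :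
    ∃ T', IsInsertion D T T' ∧ (T'.height : ℝ) ≤ 9 * Real.log D.n := by
  have hs : IsSearchTree T := by
    obtain ⟨W, -, h⟩ := hT
    exact h.isSearchTree.1
  have hfin : (Prod.fst '' D.V1 \ cuts T).Finite :=
    ((V1_finite D).image _).subset Set.sdiff_subset
  -- The set `V₁` has at most `5n` points, fewer than `2 ^ (Nat.log 2 D.n + 4)`.
  obtain ⟨T', h1, h2, h3, h4⟩ := exists_extends hs (k := Nat.log 2 D.n + 4) hfin.toFinset
    (fun x hx => ((hfin.mem_toFinset).1 hx).2) (by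
      rw [← Set.ncard_eq_toFinset_card _ hfin]
      have e1 := Set.ncard_le_ncard (Set.sdiff_subset (s := Prod.fst '' D.V1) (t := cuts T))
        ((V1_finite D).image _)
      have e2 := Set.ncard_image_le (f := Prod.fst) (V1_finite D)
      have e3 := V1_ncard_le D
      have e4 := Nat.lt_pow_succ_log_self one_lt_two D.n
      have e5 : 2 ^ (Nat.log 2 D.n + 4) = 8 * 2 ^ (Nat.log 2 D.n + 1) := by ring
      rw [Nat.succ_eq_add_one] at e4
      have := D.three_le_n
      omega)
  refine ⟨T', ⟨h1, h2, ?_⟩, ?_⟩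
  · rw [h3, hfin.coe_toFinset, Set.union_sdiff_self]
  · have e1 := hT.height_le
    have e2 : T'.height ≤ 2 * Nat.log 2 D.n + 6 := by omega
    have e3 : (T'.height : ℝ) ≤ 2 * (Nat.log 2 D.n : ℝ) + 6 := by exact_mod_cast e2
    have := natLog_n_le D
    have := one_le_log_n D
    linarith

end L1Domain

namespace L1Domain
open Set Filter Topology

/-! ### The number of Steiner points -/

lemma boolList_length_lt_finite (s : ℕ) :
    {l : List Bool | l.length < s}.Finite ∧ {l : List Bool | l.length < s}.ncard + 1 ≤ 2 ^ s := by
  induction s with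
  | zero => simp
  | succ s ih =>
    have h : {l : List Bool | l.length < s + 1} ⊆ {[]} ∪
        (List.cons false '' {l | l.length < s} ∪ List.cons true '' {l | l.length < s}) := by
      rintro (_ | ⟨b, l⟩) hl
      · exact Or.inl rfl
      · have hl' : l.length < s := by simpa using hl
        cases b
        exacts [Or.inr (Or.inl ⟨l, hl', rfl⟩), Or.inr (Or.inr ⟨l, hl', rfl⟩)]
    have hf := (Set.finite_singleton ([] : List Bool)).union
      ((ih.1.image (List.cons false)).union (ih.1.image (List.cons true)))
    refine ⟨hf.subset h, ?_⟩
    have h0 := Set.ncard_le_ncard h hf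
    have h1 := Set.ncard_union_le {([] : List Bool)}
      (List.cons false '' {l | l.length < s} ∪ List.cons true '' {l | l.length < s})
    have h2 := Set.ncard_union_le (List.cons false '' {l | l.length < s})
      (List.cons true '' {l | l.length < s})
    have h3 := Set.ncard_image_le (f := List.cons false) ih.1
    have h4 := Set.ncard_image_le (f := List.cons true) ih.1
    rw [Set.ncard_singleton] at h1
    rw [pow_succ]
    have := ih.2
    omega

lemma Routes.unique {x : ℝ} {T : BinaryTree ℝ} {u v : List Bool} (hu : Routes x T u)
    (hv : Routes x T v) (h : u.length = v.length) : u = v := by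
  induction T generalizing u v with
  | nil =>
    match u, v, hu, hv, h with
    | [], [], _, _, _ => rfl
  | node c l r ihl ihr =>
    match u, v, hu, hv, h with
    | [], [], _, _, _ => rfl
    | false :: u, false :: v, hu, hv, h => rw [ihl hu.2 hv.2 (by simpa using h)]
    | true :: u, true :: v, hu, hv, h => rw [ihr hu.2 hv.2 (by simpa using h)]
    | false :: u, true :: v, hu, hv, h => exact absurd hu.1 (lt_asymm hv.1)
    | true :: u, false :: v, hu, hv, h => exact absurd hu.1 (lt_asymm hv.1)

lemma length_lt_height_of_cutAt {T : BinaryTree ℝ} {v : List Bool} {c : ℝ}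
    (h : cutAt T v = some c) : v.length < T.height := by
  induction T generalizing v with
  | nil => simp [cutAt] at h
  | node d l r ihl ihr =>
    simp only [BinaryTree.height]
    match v, h with
    | [], _ => simp
    | false :: v, h => have := ihl h; simp only [List.length_cons]; omega
    | true :: v, h => have := ihr h; simp only [List.length_cons]; omega

lemma IsSearchTree.address_unique {T : BinaryTree ℝ} (hT : IsSearchTree T) {u v : List Bool} {x : ℝ}
    (hu : cutAt T u = some x) (hv : cutAt T v = some x) : u = v := by
  induction T generalizing u v with
  | nil => simp [cutAt] at hu
  | node c l r ihl ihr =>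
    obtain ⟨hl, hr, hl', hr'⟩ := hT
    match u, v, hu, hv with
    | [], [], _, _ => rfl
    | false :: u, false :: v, hu, hv => rw [ihl hl' hu hv]
    | true :: u, true :: v, hu, hv => rw [ihr hr' hu hv]
    | [], false :: v, hu, hv =>
      obtain rfl : c = x := by simpa [cutAt] using hu
      exact absurd (hl c ⟨v, hv⟩) (lt_irrefl c)
    | [], true :: v, hu, hv =>
      obtain rfl : c = x := by simpa [cutAt] using hu
      exact absurd (hr c ⟨v, hv⟩) (lt_irrefl c)
    | false :: u, [], hu, hv =>
      obtain rfl : c = x := by simpa [cutAt] using hv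
      exact absurd (hl c ⟨u, hu⟩) (lt_irrefl c)
    | true :: u, [], hu, hv =>
      obtain rfl : c = x := by simpa [cutAt] using hv
      exact absurd (hr c ⟨u, hu⟩) (lt_irrefl c)
    | false :: u, true :: v, hu, hv => exact absurd (hl x ⟨u, hu⟩) (lt_asymm (hr x ⟨v, hv⟩))
    | true :: u, false :: v, hu, hv => exact absurd (hl x ⟨v, hv⟩) (lt_asymm (hr x ⟨u, hu⟩))

variable {D : PolygonalDomain} {T T' : BinaryTree ℝ}

lemma superSize_pos (D : PolygonalDomain) : 0 < superSize D :=
  Nat.le_max_left 1 _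

/-- In each super-level the descent of `p` fixes one top node `t`, and a node below it is given by a
word shorter than the super-level size, of which there are fewer than `2 ^ superSize D`. -/
lemma type3_ncard_le (D : PolygonalDomain) (T : BinaryTree ℝ) (p : Pt) :
    (type3 D T p).ncard ≤ (T.height / superSize D + 1) * 2 ^ superSize D := by
  set s := superSize D with hs
  have hspos : 0 < s := superSize_pos D
  set f : ℕ → List Bool → Set Pt := fun k m => {q | ∃ t c, Routes p.1 T t ∧ t.length = s * k ∧
    cutAt T (t ++ m) = some c ∧ q = (c, p.2)} with hf
  have hsub : ∀ k m, (f k m).Subsingleton := by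
    rintro k m _ ⟨t, c, h1, h2, h3, rfl⟩ _ ⟨t', c', h1', h2', h3', rfl⟩
    obtain rfl := h1.unique h1' (h2.trans h2'.symm)
    obtain rfl : c = c' := Option.some.inj (h3.symm.trans h3')
    rfl
  have hfin := boolList_length_lt_finite s
  have hkfin := Set.finite_Iio (T.height / s + 1)
  have hcover : type3 D T p ⊆
      ⋃ k ∈ Set.Iio (T.height / s + 1), ⋃ m ∈ {l : List Bool | l.length < s}, f k m := by
    rintro _ ⟨v, c, hc, ⟨-, hr⟩, -, rfl⟩
    simp only [Set.mem_iUnion]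
    have hmul : s * (v.length / s) ≤ v.length := Nat.mul_div_le _ _
    refine ⟨v.length / s, Nat.lt_succ_of_le
      (Nat.div_le_div_right (length_lt_height_of_cutAt hc).le), v.drop (s * (v.length / s)), ?_,
      v.take (s * (v.length / s)), c, hr, ?_, ?_, rfl⟩
    · have := Nat.div_add_mod v.length s
      have := Nat.mod_lt v.length hspos
      change (List.drop _ _).length < s
      rw [List.length_drop]
      omega
    · rw [List.length_take]
      omega
    · rwa [List.take_append_drop]
  have hin : ∀ k ∈ Set.Iio (T.height / s + 1),
      (⋃ m ∈ {l : List Bool | l.length < s}, f k m).ncard ≤ 2 ^ s := fun k _ =>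
    (ncard_biUnion_le (k := 1) hfin.1
      fun m _ => (Set.ncard_le_one (hsub k m).finite).2 (hsub k m)).trans
      (by have := hfin.2; omega)
  have h1 := Set.ncard_le_ncard hcover (hkfin.biUnion fun k _ => hfin.1.biUnion fun m _ =>
    (hsub k m).finite)
  refine h1.trans ((ncard_biUnion_le hkfin hin).trans_eq ?_)
  rw [Set.ncard_eq_toFinset_card' (Set.Iio _)]
  simp

/-- In a search tree the node of `p` is determined by `p.1`, so there is at most one point for each
level above it. -/
lemma newType2_ncard_le (D : PolygonalDomain) (hT : IsSearchTree T) (p : Pt) :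
    (newType2 D T p).ncard ≤ T.height := by
  set f : ℕ → Set Pt := fun k => {q | ∃ u c, cutAt T u = some p.1 ∧ cutAt T (u.take k) = some c ∧
    q = (c, p.2)} with hf
  have hsub : ∀ k, (f k).Subsingleton := by
    rintro k _ ⟨u, c, h1, h2, rfl⟩ _ ⟨u', c', h1', h2', rfl⟩
    obtain rfl := hT.address_unique h1 h1'
    obtain rfl : c = c' := Option.some.inj (h2.symm.trans h2')
    rfl
  have hkfin := Set.finite_Iio T.height
  have hcover : newType2 D T p ⊆ ⋃ k ∈ Set.Iio T.height, f k := by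
    rintro _ ⟨-, u, v, c, hu, hv, hc, -, rfl⟩
    simp only [Set.mem_iUnion]
    refine ⟨v.length, length_lt_height_of_cutAt hc, u, c, hu, ?_, rfl⟩
    rwa [← List.prefix_iff_eq_take.1 hv]
  refine (Set.ncard_le_ncard hcover (hkfin.biUnion fun k _ => (hsub k).finite)).trans
    ((ncard_biUnion_le (k := 1) hkfin
      fun k _ => (Set.ncard_le_one (hsub k).finite).2 (hsub k)).trans_eq ?_)
  rw [Set.ncard_eq_toFinset_card' (Set.Iio _)]
  simp

lemma V3_ncard_le {M : ℕ} (hM : ∀ p, (type3 D T p).ncard ≤ M) : (V3 D T).ncard ≤ D.n * M :=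
  (ncard_biUnion_le D.vertices_finite fun p _ => hM p).trans
    (Nat.mul_le_mul_right M D.vertices_ncard_le)

lemma allNewType2_ncard_le {N : ℕ} (hN : ∀ p, (newType2 D T' p).ncard ≤ N) :
    (allNewType2 D T').ncard ≤ 5 * D.n * N :=
  (ncard_biUnion_le (V1_finite D) fun p _ => hN p).trans (Nat.mul_le_mul_right N (V1_ncard_le D))

lemma V1_union_V3_ncard_le {M : ℕ} (hM : ∀ p, (type3 D T p).ncard ≤ M) :
    (D.V1 ∪ V3 D T).ncard ≤ 5 * D.n + D.n * M :=
  (Set.ncard_union_le _ _).trans (Nat.add_le_add (V1_ncard_le D) (V3_ncard_le hM))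

lemma newType1_ncard_le {M : ℕ} (hM : ∀ p, (type3 D T p).ncard ≤ M) :
    (newType1 D T).ncard ≤ (5 * D.n + D.n * M) * 4 := by
  have : newType1 D T = ⋃ p ∈ D.V1 ∪ V3 D T, {q | D.IsProj p q} := by
    ext; simp [newType1]
  rw [this]
  exact (ncard_biUnion_le ((V1_finite D).union (V3_finite D T)) fun p _ =>
    (isProj_finite D p).2).trans (Nat.mul_le_mul_right 4 (V1_union_V3_ncard_le hM))

lemma G2Vertices_ncard_le {M N : ℕ} (hM : ∀ p, (type3 D T p).ncard ≤ M)
    (hN : ∀ p, (newType2 D T' p).ncard ≤ N) :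
    (G2Vertices D T T').ncard ≤ D.n * (25 + 5 * M + 5 * N) := by
  refine (Set.ncard_union_le _ _).trans ((Nat.add_le_add ((Set.ncard_union_le _ _).trans
    (Nat.add_le_add (V1_union_V3_ncard_le hM) (newType1_ncard_le hM)))
    (allNewType2_ncard_le hN)).trans_eq ?_)
  ring

lemma steinerRow_ncard_le {M N : ℕ} (hM : ∀ p, (type3 D T p).ncard ≤ M)
    (hN : ∀ p, (newType2 D T' p).ncard ≤ N) (p : Pt) :
    (steinerRow D T T' p).ncard ≤ 1 + M + N + 2 :=
  (Set.ncard_union_le _ _).trans (Nat.add_le_add ((Set.ncard_union_le _ _).trans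
    (Nat.add_le_add ((Set.ncard_union_le _ _).trans
      (Nat.add_le_add (Set.ncard_singleton p).le (hM p))) (hN p))) (isHorizProj_finite D p).2)

/-! ### Neighbours on a line -/

lemma mem_segment_of_injOn {A : Set Pt} (hA : Convex ℝ A) (f : Pt →ₗ[ℝ] ℝ) (hf : Set.InjOn f A)
    {x y z : Pt} (hx : x ∈ A) (hy : y ∈ A) (hz : z ∈ A) (h1 : f x ≤ f z) (h2 : f z ≤ f y) :
    z ∈ segment ℝ x y := by
  have h : f z ∈ segment ℝ (f x) (f y) := by
    rw [segment_eq_Icc (h1.trans h2)]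
    exact ⟨h1, h2⟩
  obtain ⟨a, b, ha, hb, hab, h⟩ := h
  refine ⟨a, b, ha, hb, hab, hf (hA hx hy ha hb hab) hz ?_⟩
  rw [← h]
  simp

/-- The injective linear functional `f` orders the line, and there is at most one neighbour on each
side. -/
lemma consecutive_finite {A S : Set Pt} (hA : Convex ℝ A) (f : Pt →ₗ[ℝ] ℝ) (hf : Set.InjOn f A)
    (hS : S ⊆ A) (a : Pt) :
    {b | Consecutive S a b}.Finite ∧ {b | Consecutive S a b}.ncard ≤ 2 := by
  have h1 : {b | Consecutive S a b ∧ f a ≤ f b}.Subsingleton := by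
    have key : ∀ b b', Consecutive S a b → Consecutive S a b' → f a ≤ f b → f b ≤ f b' →
        b = b' := fun b b' hb hb' h h' =>
      (hb'.2.2.2 b hb.2.1 (mem_segment_of_injOn hA f hf (hS hb.1) (hS hb'.2.1) (hS hb.2.1)
        h h')).resolve_left hb.2.2.1.symm
    rintro b ⟨hb, h⟩ b' ⟨hb', h'⟩
    rcases le_total (f b) (f b') with hbb | hbb
    exacts [key b b' hb hb' h hbb, (key b' b hb' hb h' hbb).symm]
  have h2 : {b | Consecutive S a b ∧ f b ≤ f a}.Subsingleton := by
    have key : ∀ b b', Consecutive S a b → Consecutive S a b' → f b' ≤ f b → f b ≤ f a →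
        b = b' := fun b b' hb hb' h h' =>
      (hb'.2.2.2 b hb.2.1 (by
        rw [segment_symm]
        exact mem_segment_of_injOn hA f hf (hS hb'.2.1) (hS hb.1) (hS hb.2.1) h h')).resolve_left
        hb.2.2.1.symm
    rintro b ⟨hb, h⟩ b' ⟨hb', h'⟩
    rcases le_total (f b') (f b) with hbb | hbb
    exacts [key b b' hb hb' hbb h, (key b' b hb' hb hbb h').symm]
  have h : {b | Consecutive S a b} =
      {b | Consecutive S a b ∧ f a ≤ f b} ∪ {b | Consecutive S a b ∧ f b ≤ f a} := by
    ext b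
    simp only [Set.mem_ofPred_eq, Set.mem_union, ← and_or_left, le_total, and_true]
  rw [h]
  exact ⟨h1.finite.union h2.finite, (Set.ncard_union_le _ _).trans
    (Nat.add_le_add ((Set.ncard_le_one h1.finite).2 h1) ((Set.ncard_le_one h2.finite).2 h2))⟩

lemma cutAdj_finite (D : PolygonalDomain) (S : Set Pt) (a : Pt) :
    {b | CutAdj D S a b}.Finite ∧ {b | CutAdj D S a b}.ncard ≤ 2 := by
  have hsub : {b | CutAdj D S a b} ⊆ {b | Consecutive {s | s ∈ S ∧ s.1 = a.1} a b} := by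
    rintro b ⟨c, h, -⟩
    obtain rfl : a.1 = c := h.1.2
    exact h
  have hA : Convex ℝ {s : Pt | s.1 = a.1} :=
    (convex_singleton a.1).linear_preimage (LinearMap.fst ℝ ℝ ℝ)
  have h := consecutive_finite hA (LinearMap.snd ℝ ℝ ℝ)
    (fun x hx y hy hxy => Prod.ext (hx.trans hy.symm) hxy)
    (S := {s | s ∈ S ∧ s.1 = a.1}) (fun _ hz => hz.2) a
  exact ⟨h.1.subset hsub, (Set.ncard_le_ncard hsub h.1).trans h.2⟩

lemma edgeAdj_finite (hD : D.GeneralPosition) (S : Set Pt) (a : Pt) :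
    {b | EdgeAdj D S a b}.Finite ∧ {b | EdgeAdj D S a b}.ncard ≤ 6 := by
  have hE : {e | e ∈ D.edges ∧ a ∈ e}.Finite := D.edges_finite.subset fun _ h => h.1
  have hsub : {b | EdgeAdj D S a b} ⊆
      ⋃ e ∈ {e | e ∈ D.edges ∧ a ∈ e}, {b | Consecutive (S ∩ e) a b} := by
    rintro b ⟨e, he, h⟩
    exact Set.mem_biUnion (x := e) ⟨he, h.1.2⟩ h
  have h : ∀ e ∈ {e | e ∈ D.edges ∧ a ∈ e}, {b | Consecutive (S ∩ e) a b}.Finite ∧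
      {b | Consecutive (S ∩ e) a b}.ncard ≤ 2 := by
    rintro e ⟨he, -⟩
    have hc : Convex ℝ e := by
      obtain ⟨A, B, -, -, -, rfl, -⟩ := D.exists_edge_eq_segment he
      exact convex_segment A B
    refine consecutive_finite hc (LinearMap.snd ℝ ℝ ℝ) ?_ Set.inter_subset_right a
    intro x hx y hy hxy
    by_contra hne
    exact edge_snd_ne hD he hx hy hne hxy
  have hfin := hE.biUnion fun e he => (h e he).1
  refine ⟨hfin.subset hsub, (Set.ncard_le_ncard hsub hfin).trans
    ((ncard_biUnion_le hE fun e he => (h e he).2).trans ?_)⟩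
  have := D.ncard_edges_through_le a
  omega

/-! ### The number of edges -/

/-- At most `k` unordered pairs are related by `r`. -/
def PairBound (r : Pt → Pt → Prop) (k : ℕ) : Prop :=
  {e | ∃ a b, r a b ∧ e = s(a, b)}.Finite ∧ {e | ∃ a b, r a b ∧ e = s(a, b)}.ncard ≤ k

lemma PairBound.mono {r r' : Pt → Pt → Prop} {k k' : ℕ} (h : PairBound r k)
    (hr : ∀ a b, r' a b → r a b) (hk : k ≤ k') : PairBound r' k' := by
  have hsub : {e | ∃ a b, r' a b ∧ e = s(a, b)} ⊆ {e | ∃ a b, r a b ∧ e = s(a, b)} := by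
    rintro _ ⟨a, b, hab, rfl⟩
    exact ⟨a, b, hr a b hab, rfl⟩
  exact ⟨h.1.subset hsub, (Set.ncard_le_ncard hsub h.1).trans (h.2.trans hk)⟩

lemma PairBound.or {r r' : Pt → Pt → Prop} {k k' : ℕ} (h : PairBound r k) (h' : PairBound r' k') :
    PairBound (fun a b => r a b ∨ r' a b) (k + k') := by
  have hsub : {e | ∃ a b, (r a b ∨ r' a b) ∧ e = s(a, b)} ⊆
      {e | ∃ a b, r a b ∧ e = s(a, b)} ∪ {e | ∃ a b, r' a b ∧ e = s(a, b)} := by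
    rintro _ ⟨a, b, hab | hab, rfl⟩
    exacts [Or.inl ⟨a, b, hab, rfl⟩, Or.inr ⟨a, b, hab, rfl⟩]
  have hf := h.1.union h'.1
  exact ⟨hf.subset hsub, (Set.ncard_le_ncard hsub hf).trans
    ((Set.ncard_union_le _ _).trans (Nat.add_le_add h.2 h'.2))⟩

lemma PairBound.exists_mem {S : Set Pt} (hS : S.Finite) {r : Pt → Pt → Pt → Prop} {k : ℕ}
    (h : ∀ p ∈ S, PairBound (r p) k) :
    PairBound (fun a b => ∃ p ∈ S, r p a b) (S.ncard * k) := by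
  have hsub : {e | ∃ a b, (∃ p ∈ S, r p a b) ∧ e = s(a, b)} ⊆
      ⋃ p ∈ S, {e | ∃ a b, r p a b ∧ e = s(a, b)} := by
    rintro _ ⟨a, b, ⟨p, hp, hab⟩, rfl⟩
    exact Set.mem_biUnion hp ⟨a, b, hab, rfl⟩
  have hf := hS.biUnion fun p hp => (h p hp).1
  exact ⟨hf.subset hsub, (Set.ncard_le_ncard hsub hf).trans
    (ncard_biUnion_le hS fun p hp => (h p hp).2)⟩

lemma PairBound.edgeSet {r : Pt → Pt → Prop} {k : ℕ} (h : PairBound r k) {G : SimpleGraph Pt}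
    (hG : ∀ a b, G.Adj a b → ∃ x y, r x y ∧ s(a, b) = s(x, y)) :
    G.edgeSet.Finite ∧ G.edgeSet.ncard ≤ k := by
  have hsub : G.edgeSet ⊆ {e | ∃ a b, r a b ∧ e = s(a, b)} := by
    intro e
    induction e using Sym2.ind with
    | _ a b => exact hG a b
  exact ⟨h.1.subset hsub, (Set.ncard_le_ncard hsub h.1).trans h.2⟩

lemma pairBound_of_degree {S : Set Pt} (hS : S.Finite) {r : Pt → Pt → Prop} {k : ℕ}
    (hr : ∀ a b, r a b → a ∈ S) (hk : ∀ a, {b | r a b}.Finite ∧ {b | r a b}.ncard ≤ k) :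
    PairBound r (S.ncard * k) := by
  refine (PairBound.exists_mem hS (r := fun p a b => a = p ∧ r a b) (k := k) fun p _ => ?_).mono
    (fun a b h => ⟨a, hr a b h, rfl, h⟩) le_rfl
  have hsub : {e | ∃ a b, (a = p ∧ r a b) ∧ e = s(a, b)} ⊆ (fun b => s(p, b)) '' {b | r p b} := by
    rintro _ ⟨a, b, ⟨rfl, hab⟩, rfl⟩
    exact ⟨b, hab, rfl⟩
  have hf := (hk p).1.image fun b => s(p, b)
  exact ⟨hf.subset hsub, (Set.ncard_le_ncard hsub hf).trans
    ((Set.ncard_image_le (hk p).1).trans (hk p).2)⟩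

/-- Each of the eight adjacency relations is bounded separately; the edges removed in the third step
are simply counted as well. -/
lemma G2_edgeSet_finite (hD : D.GeneralPosition) {M N : ℕ} (hM : ∀ p, (type3 D T p).ncard ≤ M)
    (hN : ∀ p, (newType2 D T' p).ncard ≤ N) :
    (G2 D T T').edgeSet.Finite ∧
      (G2 D T T').edgeSet.ncard ≤ D.n * (234 + 55 * M + 25 * N) := by
  have fV := D.vertices_finite
  have f1 := V1_finite D
  have f3 := V3_finite D T
  have fN := allNewType2_finite D T'
  have f13 := f1.union f3
  have fall := f13.union (newType1_finite D T)
  have b1 : PairBound (fun a b => a ∈ D.vertices ∧ (D.IsProj a b ∨ b ∈ type3 D T a))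
      (D.n * (4 + M)) := by
    have hfin (a : Pt) := (isProj_finite D a).1.union (type3_finite D T a)
    refine (pairBound_of_degree fV (r := fun a b => a ∈ D.vertices ∧
      (D.IsProj a b ∨ b ∈ type3 D T a)) (k := 4 + M) (fun a b h => h.1) fun a =>
      ⟨(hfin a).subset fun b h => h.2, ?_⟩).mono (fun _ _ h => h)
      (Nat.mul_le_mul_right _ D.vertices_ncard_le)
    exact (Set.ncard_le_ncard (fun b h => h.2) (hfin a)).trans ((Set.ncard_union_le _ _).trans
      (Nat.add_le_add (isProj_finite D a).2 (hM a)))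
  have b2 : PairBound (EdgeAdj D (D.V1 ∪ V3 D T)) ((5 * D.n + D.n * M) * 6) :=
    (pairBound_of_degree f13 (fun a b ⟨e, _, h⟩ => h.1.1) (edgeAdj_finite hD _)).mono
      (fun _ _ h => h) (Nat.mul_le_mul_right _ (V1_union_V3_ncard_le hM))
  have b3 : PairBound (CutAdj D (V3 D T)) (D.n * M * 2) :=
    (pairBound_of_degree f3 (fun a b ⟨c, h, _⟩ => h.1.1) (cutAdj_finite D _)).mono
      (fun _ _ h => h) (Nat.mul_le_mul_right _ (V3_ncard_le hM))
  have b4 : PairBound (fun a b => a ∈ D.V1 ∪ V3 D T ∧ D.IsProj a b ∧ b ∉ D.V1)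
      ((5 * D.n + D.n * M) * 4) :=
    (pairBound_of_degree f13 (r := fun a b => a ∈ D.V1 ∪ V3 D T ∧ D.IsProj a b ∧ b ∉ D.V1)
      (k := 4) (fun a b h => h.1) fun a => ⟨(isProj_finite D a).1.subset fun b h => h.2.1,
        (Set.ncard_le_ncard (fun b h => h.2.1) (isProj_finite D a).1).trans
          (isProj_finite D a).2⟩).mono (fun _ _ h => h)
      (Nat.mul_le_mul_right _ (V1_union_V3_ncard_le hM))
  have b5 : PairBound (EdgeAdj D (D.V1 ∪ V3 D T ∪ newType1 D T))
      ((5 * D.n + D.n * M + (5 * D.n + D.n * M) * 4) * 6) :=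
    (pairBound_of_degree fall (fun a b ⟨e, _, h⟩ => h.1.1) (edgeAdj_finite hD _)).mono
      (fun _ _ h => h) (Nat.mul_le_mul_right _ ((Set.ncard_union_le _ _).trans
        (Nat.add_le_add (V1_union_V3_ncard_le hM) (newType1_ncard_le hM))))
  have b6 : PairBound (fun a b => b ∈ newType2 D T' a) (5 * D.n * N) :=
    (pairBound_of_degree f1 (r := fun a b => b ∈ newType2 D T' a) (fun a b h => h.1.1)
      fun a => ⟨newType2_finite D T' a, hN a⟩).mono (fun _ _ h => h)
      (Nat.mul_le_mul_right _ (V1_ncard_le D))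
  have b7 : PairBound (CutAdj D (V3 D T ∪ allNewType2 D T')) ((D.n * M + 5 * D.n * N) * 2) :=
    (pairBound_of_degree (f3.union fN) (fun a b ⟨c, h, _⟩ => h.1.1) (cutAdj_finite D _)).mono
      (fun _ _ h => h) (Nat.mul_le_mul_right _ ((Set.ncard_union_le _ _).trans
        (Nat.add_le_add (V3_ncard_le hM) (allNewType2_ncard_le hN))))
  have b8 : PairBound (fun a b => ∃ p ∈ D.V1, Consecutive (steinerRow D T T' p) a b)
      (5 * D.n * ((1 + M + N + 2) * 2)) := by
    refine (PairBound.exists_mem f1 fun p hp => ?_).mono (fun _ _ h => h)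
      (Nat.mul_le_mul_right _ (V1_ncard_le D))
    have hA : Convex ℝ {s : Pt | s.2 = p.2} :=
      (convex_singleton p.2).linear_preimage (LinearMap.snd ℝ ℝ ℝ)
    exact (pairBound_of_degree (steinerRow_finite D T T' p) (fun a b h => h.1)
      (consecutive_finite hA (LinearMap.fst ℝ ℝ ℝ)
        (fun x hx y hy hxy => Prod.ext hxy (hx.trans hy.symm))
        fun z hz => (steinerRow_spec (V1_subset_region hp) hz).1)).mono (fun _ _ h => h)
      (Nat.mul_le_mul_right _ (steinerRow_ncard_le hM hN p))
  have hall := ((b1.or (b2.or b3)).or (b4.or b5)).or ((b6.or b7).or b8)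
  have key : ∀ {r : Pt → Pt → Prop} {a b}, (SimpleGraph.fromRel r).Adj a b →
      ∃ x y, r x y ∧ s(a, b) = s(x, y) := by
    intro r a b h
    rw [SimpleGraph.fromRel_adj] at h
    exact h.2.elim (fun h => ⟨a, b, h, rfl⟩) fun h => ⟨b, a, h, Sym2.eq_swap⟩
  obtain ⟨hf, hc⟩ := hall.edgeSet (G := G2 D T T') (by
    rintro a b (⟨(h | h) | h, -⟩ | h)
    · obtain ⟨x, y, h, he⟩ := key h
      exact ⟨x, y, Or.inl (Or.inl h), he⟩
    · obtain ⟨x, y, h, he⟩ := key h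
      exact ⟨x, y, Or.inl (Or.inr h), he⟩
    · obtain ⟨x, y, h, he⟩ := key h
      exact ⟨x, y, Or.inr (Or.inl h), he⟩
    · obtain ⟨x, y, h, he⟩ := key h
      exact ⟨x, y, Or.inr (Or.inr h), he⟩)
  refine ⟨hf, hc.trans_eq ?_⟩
  ring

/-! ### Asymptotics -/

lemma log_log_n_pos (D : PolygonalDomain) : 0 < Real.log (Real.log D.n) := by
  have h3 : (3 : ℝ) ≤ D.n := by exact_mod_cast D.three_le_n
  refine Real.log_pos ?_
  rw [Real.lt_log_iff_exp_lt (by linarith)]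
  exact Real.exp_one_lt_three.trans_le h3

lemma log_le_of_le_two_pow {x : ℝ} (hx : 0 < x) {k : ℕ} (h : x ≤ 2 ^ k) : Real.log x ≤ k := by
  have h1 := Real.log_le_log hx h
  rw [Real.log_pow] at h1
  have h2 : Real.log 2 < 1 := Real.log_two_lt_d9.trans (by norm_num)
  have h3 : (0 : ℝ) ≤ k := Nat.cast_nonneg k
  nlinarith

/-- A super-level has at least half of log log n levels, so there are O(log n / log log n) of them.
The maximum with 1 makes up for rounding down. -/
lemma log_log_n_le (D : PolygonalDomain) : Real.log (Real.log D.n) ≤ 2 * superSize D := by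
  have hn : 0 < (D.n : ℝ) := by have := D.three_le_n; positivity
  have h1 : Real.log D.n ≤ (Nat.log 2 D.n + 1 : ℕ) :=
    log_le_of_le_two_pow hn (by exact_mod_cast (Nat.lt_pow_succ_log_self one_lt_two D.n).le)
  have h2 : Nat.log 2 D.n + 1 ≤ 2 ^ (Nat.log 2 (Nat.log 2 D.n) + 1) :=
    Nat.lt_pow_succ_log_self one_lt_two _
  have h0 := one_le_log_n D
  have h3 : Real.log D.n ≤ 2 ^ (Nat.log 2 (Nat.log 2 D.n) + 1) := h1.trans (by exact_mod_cast h2)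
  have h4 := log_le_of_le_two_pow (by linarith) h3
  have h5 : Nat.log 2 (Nat.log 2 D.n) + 1 ≤ 2 * superSize D := by
    have e1 : 1 ≤ superSize D := le_max_left _ _
    have e2 : Nat.log 2 (Nat.log 2 D.n) ≤ superSize D := le_max_right _ _
    omega
  exact h4.trans (by exact_mod_cast h5)

/-- Rounding down the iterated logarithm keeps the size of a super-level subtree at order log n;
this balances the two factors in the type-3 count. -/
lemma two_pow_superSize_le (D : PolygonalDomain) :
    (2 : ℝ) ^ superSize D ≤ 3 * Real.log D.n := by
  have h0 := one_le_log_n D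
  have h1 := natLog_n_le D
  have h2 : Nat.log 2 D.n ≠ 0 := (Nat.log_pos one_lt_two (by have := D.three_le_n; omega)).ne'
  rcases max_choice 1 (Nat.log 2 (Nat.log 2 D.n)) with h | h
  · rw [superSize, h]
    linarith
  · rw [superSize, h]
    have h3 : (2 : ℝ) ^ Nat.log 2 (Nat.log 2 D.n) ≤ Nat.log 2 D.n := by
      exact_mod_cast Nat.pow_log_le_self 2 h2
    linarith

lemma IsCutLineTree.type3_ncard_le (hT : IsCutLineTree D T) (p : Pt) :
    ((type3 D T p).ncard : ℝ) ≤ 24 * (Real.log D.n ^ 2 / Real.log (Real.log D.n)) := by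
  set L := Real.log D.n with hL
  have h0 : 1 ≤ L := one_le_log_n D
  have hLL := log_log_n_pos D
  have hs := log_log_n_le D
  have hpow := two_pow_superSize_le D
  have hle : Real.log L ≤ L := (Real.log_le_sub_one_of_pos (by linarith)).trans (by linarith)
  have hh : (T.height : ℝ) ≤ 7 / 2 * L := by
    have h1 : (T.height : ℝ) ≤ Nat.log 2 D.n + 2 := by exact_mod_cast hT.height_le
    have h2 := natLog_n_le D
    linarith
  -- The height `7 / 2 * L` over a super-level of at least `Real.log L / 2` levels gives 7, and the
  -- additional 1 is absorbed by `L / Real.log L`.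
  have hdiv : ((T.height / superSize D : ℕ) : ℝ) + 1 ≤ 8 * L / Real.log L := by
    have e1 : ((T.height / superSize D : ℕ) : ℝ) ≤ T.height / superSize D := Nat.cast_div_le
    have hs0 : (0 : ℝ) < superSize D := by exact_mod_cast superSize_pos D
    have e2 : (T.height : ℝ) / superSize D ≤ 7 * L / Real.log L := by
      rw [div_le_div_iff₀ hs0 hLL]
      nlinarith
    have e3 : 1 ≤ L / Real.log L := (one_le_div hLL).2 hle
    have e4 : 8 * L / Real.log L = 7 * L / Real.log L + L / Real.log L := by ring
    linarith
  calc ((type3 D T p).ncard : ℝ)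
      ≤ (((T.height / superSize D : ℕ) : ℝ) + 1) * 2 ^ superSize D := by
        exact_mod_cast L1Domain.type3_ncard_le D T p
    _ ≤ 8 * L / Real.log L * (3 * L) := by gcongr
    _ = 24 * (L ^ 2 / Real.log L) := by ring

theorem G2_size (hD : D.GeneralPosition) {K : ℝ} (hT : IsCutLineTree D T)
    (hI : IsInsertion D T T') (hK : (T'.height : ℝ) ≤ K * Real.log D.n) :
    (G2 D T T').edgeSet.Finite ∧
    ((G2Vertices D T T').ncard : ℝ) ≤
      (1554 + 25 * |K|) * (D.n * Real.log D.n ^ 2 / Real.log (Real.log D.n)) ∧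
    ((G2 D T T').edgeSet.ncard : ℝ) ≤
      (1554 + 25 * |K|) * (D.n * Real.log D.n ^ 2 / Real.log (Real.log D.n)) := by
  set L := Real.log D.n with hL
  have h0 : 1 ≤ L := one_le_log_n D
  have hLL := log_log_n_pos D
  have hle : Real.log L ≤ L := (Real.log_le_sub_one_of_pos (by linarith)).trans (by linarith)
  set Q := L ^ 2 / Real.log L with hQ
  have hLQ : L ≤ Q := by
    rw [hQ, le_div_iff₀ hLL]
    nlinarith
  set M := ⌊24 * Q⌋₊ with hMdef
  have hM : ∀ p, (type3 D T p).ncard ≤ M := fun p => Nat.le_floor (hT.type3_ncard_le p)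
  have hMQ : (M : ℝ) ≤ 24 * Q := Nat.floor_le (by linarith)
  have hN : ∀ p, (newType2 D T' p).ncard ≤ T'.height := newType2_ncard_le D hI.2.1
  have hNQ : (T'.height : ℝ) ≤ |K| * Q := hK.trans
    ((mul_le_mul_of_nonneg_right (le_abs_self K) (by linarith)).trans
      (mul_le_mul_of_nonneg_left hLQ (abs_nonneg K)))
  have hn : 0 ≤ (D.n : ℝ) := Nat.cast_nonneg _
  have hKQ : 0 ≤ |K| * Q := mul_nonneg (abs_nonneg K) (by linarith)
  -- With `M ≤ 24 * Q` and `1 ≤ Q`, the edge count has the constant `234 + 55 * 24 = 1554`, which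
  -- also covers the vertex count. The absolute value admits negative `K`.
  have hR : (1554 + 25 * |K|) * (D.n * L ^ 2 / Real.log L) =
      D.n * ((1554 + 25 * |K|) * Q) := by rw [hQ]; ring
  obtain ⟨hf, hE⟩ := G2_edgeSet_finite hD hM hN
  refine ⟨hf, ?_, ?_⟩
  · have h : ((G2Vertices D T T').ncard : ℝ) ≤ D.n * (25 + 5 * M + 5 * T'.height) := by
      exact_mod_cast G2Vertices_ncard_le hM hN
    rw [hR]
    exact h.trans (mul_le_mul_of_nonneg_left (by linarith) hn)
  · have h : ((G2 D T T').edgeSet.ncard : ℝ) ≤ D.n * (234 + 55 * M + 25 * T'.height) := by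
      exact_mod_cast hE
    rw [hR]
    exact h.trans (mul_le_mul_of_nonneg_left (by linarith) hn)

end L1Domain

/-! ### Height, size and shortest paths together -/

theorem mainTheorem5 :
    -- the new cut-lines can be inserted so that the tree keeps logarithmic height
    (∃ K : ℝ, ∀ D : L1Domain.PolygonalDomain, D.GeneralPosition →
      (∃ T, L1Domain.IsCutLineTree D T) ∧
      ∀ T, L1Domain.IsCutLineTree D T →
        ∃ T', L1Domain.IsInsertion D T T' ∧ (T'.height : ℝ) ≤ K * Real.log D.n) ∧
    -- size of the graph
    (∀ K : ℝ, ∃ C : ℝ, ∀ D : L1Domain.PolygonalDomain, D.GeneralPosition →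
      ∀ T T' : BinaryTree ℝ, L1Domain.IsCutLineTree D T → L1Domain.IsInsertion D T T' →
        (T'.height : ℝ) ≤ K * Real.log D.n →
        (L1Domain.G2 D T T').support ⊆ L1Domain.G2Vertices D T T' ∧
        (L1Domain.G2Vertices D T T').Finite ∧
        (L1Domain.G2 D T T').edgeSet.Finite ∧
        ((L1Domain.G2Vertices D T T').ncard : ℝ) ≤
          C * (D.n * Real.log D.n ^ 2 / Real.log (Real.log D.n)) ∧
        ((L1Domain.G2 D T T').edgeSet.ncard : ℝ) ≤
          C * (D.n * Real.log D.n ^ 2 / Real.log (Real.log D.n))) ∧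
    -- preservation of shortest paths
    (∀ D : L1Domain.PolygonalDomain, D.GeneralPosition →
      ∀ T T' : BinaryTree ℝ, L1Domain.IsCutLineTree D T → L1Domain.IsInsertion D T T' →
        ∀ p ∈ D.V1 ∪ L1Domain.V3 D T, ∀ q ∈ D.V1 ∪ L1Domain.V3 D T,
          (∃ w : (L1Domain.G2 D T T').Walk p q, L1Domain.IsShortestWalk w) ∧
          ∀ w : (L1Domain.G2 D T T').Walk p q, L1Domain.IsShortestWalk w →
            L1Domain.IsShortestPathIn D p q w.support) := by
  refine ⟨⟨9, fun D hD => ⟨L1Domain.exists_isCutLineTree hD, fun T hT =>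
    L1Domain.exists_isInsertion hT⟩⟩, fun K => ⟨1554 + 25 * |K|, fun D hD T T' hT hI hK => ?_⟩,
    fun D hD T T' hT hI p hp q hq => L1Domain.G2_shortest_paths hD hT hI hp hq⟩
  obtain ⟨h1, h2, h3⟩ := L1Domain.G2_size hD hT hI hK
  exact ⟨L1Domain.G2_support_subset, L1Domain.G2Vertices_finite D T T', h1, h2, h3⟩
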